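/- Let $n\ge 2$, let $\widetilde\Omega\subset\mathbb R^n$ be open, and let $\varphi\in C^\infty(\widetilde\Omega;\mathbb R)$ be a limiting Carleman weight: $\varphi'(x)=\nabla\varphi(x)\neq 0$ for every $x\in\widetilde\Omega$, and, with $a(x,\xi)=|\xi|^2-|\varphi'(x)|^2$ and $b(x,\xi)=2\,\varphi'(x)\cdot\xi$ on $\widetilde\Omega\times\mathbb R^n$, the Poisson bracket $\{a,b\}=a'_\xi\cdot b'_x-a'_x\cdot b'_\xi$ satisfies $$\{a,b\}(x,\xi)=0\quad\text{whenever } a(x,\xi)=b(x,\xi)=0 .$$ Let $\Omega$ be an open set with $C^\infty$ boundary such that $\overline\Omega$ is a compact subset of $\widetilde\Omega$, and let $q\in L^\infty(\Omega)$ (complex valued). Let $\nu$ be the exterior unit normal to $\partial\Omega$, let $dS$ be the surface measure on $\partial\Omega$, put $\partial\Omega_\pm=\{x\in\partial\Omega:\ \pm\varphi'(x)\cdot\nu(x)\ge 0\}$, and let $\|\cdot\|$ be the norm of $L^2(\Omega)$. Then there exist constants $C_0>0$ and $h_0>0$ such that for every $u\in C^\infty(\overline\Omega)$ (complex valued, the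 restriction to $\overline\Omega$ of a function in $C^\infty(\mathbb R^n)$) with $u|_{\partial\Omega}=0$ and every $0<h<h_0$, $$-\frac{h^3}{C_0}\int_{\partial\Omega_-}(\varphi'\cdot\nu)\,\bigl|e^{\varphi/h}\partial_\nu u\bigr|^2\,dS+\frac{h^2}{C_0}\Bigl(\bigl\|e^{\varphi/h}u\bigr\|^2+\bigl\|e^{\varphi/h}h\nabla u\bigr\|^2\Bigr)$$ $$\le\ \bigl\|e^{\varphi/h}(-h^2\Delta+h^2q)u\bigr\|^2+C_0h^3\int_{\partial\Omega_+}(\varphi'\cdot\nu)\,\bigl|e^{\varphi/h}\partial_\nu u\bigr|^2\,dS .$$ -/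

import Mathlib

open MeasureTheory Set
open scoped ContDiff InnerProductSpace

namespace CarlemanEstimate

noncomputable section

/-- Poisson bracket `{a, b} = ∂_ξ a · ∂_x b - ∂_x a · ∂_ξ b` of two symbols on `ℝⁿ × ℝⁿ`. -/
def poissonBracket {n : ℕ}
    (a b : EuclideanSpace ℝ (Fin n) → EuclideanSpace ℝ (Fin n) → ℝ)
    (x ξ : EuclideanSpace ℝ (Fin n)) : ℝ :=
  ⟪gradient (fun η => a x η) ξ, gradient (fun y => b y ξ) x⟫_ℝ
    - ⟪gradient (fun y => a y ξ) x, gradient (fun η => b x η) ξ⟫_ℝ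

/-- The symbol `a(x, ξ) = ξ² - (φ'(x))²`. -/
def symbolA {n : ℕ} (φ : EuclideanSpace ℝ (Fin n) → ℝ) (x ξ : EuclideanSpace ℝ (Fin n)) : ℝ :=
  ‖ξ‖ ^ 2 - ‖gradient φ x‖ ^ 2

/-- The symbol `b(x, ξ) = 2 φ'(x) · ξ`. -/
def symbolB {n : ℕ} (φ : EuclideanSpace ℝ (Fin n) → ℝ) (x ξ : EuclideanSpace ℝ (Fin n)) : ℝ :=
  2 * ⟪gradient φ x, ξ⟫_ℝ

/-- `φ` is a (smooth, real) limiting Carleman weight on the open set `W`: its gradient vanishes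
nowhere in `W`, and `{a, b} = 0` wherever `a = b = 0`. -/
structure IsLimitingCarlemanWeight {n : ℕ} (W : Set (EuclideanSpace ℝ (Fin n)))
    (φ : EuclideanSpace ℝ (Fin n) → ℝ) : Prop where
  contDiffOn : ContDiffOn ℝ ∞ φ W
  gradient_ne_zero : ∀ x ∈ W, gradient φ x ≠ 0
  poissonBracket_eq_zero : ∀ x ∈ W, ∀ ξ : EuclideanSpace ℝ (Fin n),
    symbolA φ x ξ = 0 → symbolB φ x ξ = 0 → poissonBracket (symbolA φ) (symbolB φ) x ξ = 0

/-- In the open set `U`, the set `Ω` is the sublevel set `{ρ < 0}` of a smooth function `ρ` without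
critical points. -/
structure IsDefiningFunction {n : ℕ} (Ω U : Set (EuclideanSpace ℝ (Fin n)))
    (ρ : EuclideanSpace ℝ (Fin n) → ℝ) : Prop where
  isOpen : IsOpen U
  contDiffOn : ContDiffOn ℝ ∞ ρ U
  gradient_ne_zero : ∀ x ∈ U, gradient ρ x ≠ 0
  mem_iff : ∀ x ∈ U, (x ∈ Ω ↔ ρ x < 0)

/-- The set `Ω` has `C^∞` boundary (and lies locally on one side of it). -/
def HasSmoothBoundary {n : ℕ} (Ω : Set (EuclideanSpace ℝ (Fin n))) : Prop :=
  ∀ x ∈ frontier Ω, ∃ U ρ, x ∈ U ∧ IsDefiningFunction Ω U ρ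

/-- `v` is the exterior unit normal to `∂Ω` at the boundary point `x`: the normalized gradient
of a local defining function. -/
def IsExteriorUnitNormal {n : ℕ} (Ω : Set (EuclideanSpace ℝ (Fin n)))
    (x v : EuclideanSpace ℝ (Fin n)) : Prop :=
  x ∈ frontier Ω ∧ ∃ U ρ, x ∈ U ∧ IsDefiningFunction Ω U ρ ∧ v = ‖gradient ρ x‖⁻¹ • gradient ρ x

open Classical in
/-- The exterior unit normal field `ν` of `∂Ω` (with value `0` where there is none). -/
def exteriorNormal {n : ℕ} (Ω : Set (EuclideanSpace ℝ (Fin n)))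
    (x : EuclideanSpace ℝ (Fin n)) : EuclideanSpace ℝ (Fin n) :=
  if h : ∃ v, IsExteriorUnitNormal Ω x v then h.choose else 0

theorem isExteriorUnitNormal_exteriorNormal {n : ℕ} {Ω : Set (EuclideanSpace ℝ (Fin n))}
    (hΩ : HasSmoothBoundary Ω) {x : EuclideanSpace ℝ (Fin n)} (hx : x ∈ frontier Ω) :
    IsExteriorUnitNormal Ω x (exteriorNormal Ω x) := by
  have h : ∃ v, IsExteriorUnitNormal Ω x v := by
    obtain ⟨U, ρ, hxU, hρ⟩ := hΩ x hx
    exact ⟨_, hx, U, ρ, hxU, hρ, rfl⟩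
  unfold exteriorNormal
  rw [dif_pos h]
  exact h.choose_spec

/-- Along a ray leaving a boundary point in a direction with nonzero slope, membership in `Ω` is
decided by the sign of the slope. -/
theorem IsDefiningFunction.eventually_of_slope {n : ℕ} {Ω U : Set (EuclideanSpace ℝ (Fin n))}
    {ρ : EuclideanSpace ℝ (Fin n) → ℝ} (hρ : IsDefiningFunction Ω U ρ)
    {x : EuclideanSpace ℝ (Fin n)} (hxU : x ∈ U) (hx : x ∈ frontier Ω)
    (w : EuclideanSpace ℝ (Fin n)) :
    (⟪gradient ρ x, w⟫_ℝ < 0 → ∀ᶠ t in nhdsWithin (0 : ℝ) (Ioi 0), x + t • w ∈ Ω) ∧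
    (0 < ⟪gradient ρ x, w⟫_ℝ → ∀ᶠ t in nhdsWithin (0 : ℝ) (Ioi 0), x + t • w ∉ Ω) := by
  have hU : U ∈ nhds x := hρ.isOpen.mem_nhds hxU
  have hcd : ContDiffAt ℝ ∞ ρ x := hρ.contDiffOn.contDiffAt hU
  have hd : DifferentiableAt ℝ ρ x := hcd.differentiableAt (by simp)
  have h0 : ρ x = 0 := by
    have hc := hd.continuousAt
    rcases lt_trichotomy (ρ x) 0 with h | h | h
    · exfalso
      have : ∀ᶠ y in nhds x, y ∈ Ω := by
        filter_upwards [hc.eventually_lt continuousAt_const h, hU] with y hy hyU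
        exact (hρ.mem_iff y hyU).2 hy
      exact hx.2 (mem_interior_iff_mem_nhds.2 this)
    · exact h
    · exfalso
      have : ∀ᶠ y in nhds x, y ∉ Ω := by
        filter_upwards [continuousAt_const.eventually_lt hc h, hU] with y hy hyU hyΩ
        exact absurd ((hρ.mem_iff y hyU).1 hyΩ) (not_lt.2 hy.le)
      exact (mem_closure_iff_frequently.1 hx.1) this
  have hline : HasDerivAt (fun t : ℝ => x + t • w) w 0 := by
    simpa using ((hasDerivAt_id (0 : ℝ)).smul_const w).const_add x
  have hgrad : HasFDerivAt ρ (fderiv ℝ ρ x) (x + (0 : ℝ) • w) := by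
    simpa using hd.hasFDerivAt
  have hder : HasDerivAt (fun t : ℝ => ρ (x + t • w)) ⟪gradient ρ x, w⟫_ℝ 0 := by
    have := hgrad.comp_hasDerivAt (0 : ℝ) hline
    simpa [gradient, InnerProductSpace.toDual_symm_apply, Function.comp_def] using this
  have hslope := (hasDerivAt_iff_tendsto_slope.1 hder).mono_left
    (nhdsWithin_mono (0 : ℝ) (fun t (ht : t ∈ Ioi (0 : ℝ)) => (ne_of_gt ht : t ≠ 0)))
  have hUev : ∀ᶠ t in nhdsWithin (0 : ℝ) (Ioi 0), x + t • w ∈ U := by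
    have hc : ContinuousAt (fun t : ℝ => x + t • w) 0 := hline.continuousAt
    have : U ∈ nhds ((fun t : ℝ => x + t • w) 0) := by simpa using hU
    exact (hc.eventually this).filter_mono nhdsWithin_le_nhds
  constructor
  · intro hneg
    filter_upwards [hslope.eventually (gt_mem_nhds hneg), hUev, self_mem_nhdsWithin] with t ht htU ht0
    refine (hρ.mem_iff _ htU).2 ?_
    have ht0' : (0 : ℝ) < t := ht0
    simp only [slope_def_field, zero_smul, add_zero, h0, sub_zero] at ht
    exact (div_neg_iff.1 ht).elim (fun h => absurd h.2 (not_lt.2 ht0'.le)) (fun h => h.1)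
  · intro hpos
    filter_upwards [hslope.eventually (lt_mem_nhds hpos), hUev, self_mem_nhdsWithin] with t ht htU ht0
    intro hmem
    have hlt := (hρ.mem_iff _ htU).1 hmem
    have ht0' : (0 : ℝ) < t := ht0
    simp only [slope_def_field, zero_smul, add_zero, h0, sub_zero] at ht
    exact absurd ht (not_lt.2 (div_nonpos_of_nonpos_of_nonneg hlt.le ht0'.le))

/-- The exterior unit normal does not depend on the choice of the local defining function. -/
theorem IsExteriorUnitNormal.unique {n : ℕ} {Ω : Set (EuclideanSpace ℝ (Fin n))}
    {x v w : EuclideanSpace ℝ (Fin n)}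
    (hv : IsExteriorUnitNormal Ω x v) (hw : IsExteriorUnitNormal Ω x w) : v = w := by
  obtain ⟨hx, U, ρ, hxU, hρ, rfl⟩ := hv
  obtain ⟨-, V, σ, hxV, hσ, rfl⟩ := hw
  set p := gradient ρ x with hp
  set r := gradient σ x with hr
  have hp0 : 0 < ‖p‖ := norm_pos_iff.2 (hρ.gradient_ne_zero x hxU)
  have hr0 : 0 < ‖r‖ := norm_pos_iff.2 (hσ.gradient_ne_zero x hxV)
  by_contra hne
  set v := ‖p‖⁻¹ • p with hvdef
  set w := ‖r‖⁻¹ • r with hwdef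
  have hv1 : ‖v‖ = 1 := by rw [hvdef, norm_smul, norm_inv, norm_norm, inv_mul_cancel₀ hp0.ne']
  have hw1 : ‖w‖ = 1 := by rw [hwdef, norm_smul, norm_inv, norm_norm, inv_mul_cancel₀ hr0.ne']
  have hlt : ⟪v, w⟫_ℝ < 1 := inner_lt_one_iff_real_of_norm_eq_one hv1 hw1 |>.2 hne
  have hpv : p = ‖p‖ • v := by rw [hvdef, smul_smul, mul_inv_cancel₀ hp0.ne', one_smul]
  have hrw : r = ‖r‖ • w := by rw [hwdef, smul_smul, mul_inv_cancel₀ hr0.ne', one_smul]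
  have h1 : ⟪p, w - v⟫_ℝ < 0 := by
    rw [hpv, real_inner_smul_left, inner_sub_right, real_inner_self_eq_norm_sq, hv1]
    exact mul_neg_of_pos_of_neg hp0 (by linarith)
  have h2 : 0 < ⟪r, w - v⟫_ℝ := by
    rw [hrw, real_inner_smul_left, inner_sub_right, real_inner_self_eq_norm_sq, hw1,
      real_inner_comm]
    exact mul_pos hr0 (by linarith)
  have e1 := (hρ.eventually_of_slope hxU hx (w - v)).1 h1
  have e2 := (hσ.eventually_of_slope hxV hx (w - v)).2 h2
  obtain ⟨t, ht1, ht2⟩ := (e1.and e2).exists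
  exact ht2 ht1

/-- Outer derivative `φ' · ν` of the weight at a boundary point. -/
def normalSlope {n : ℕ} (Ω : Set (EuclideanSpace ℝ (Fin n)))
    (φ : EuclideanSpace ℝ (Fin n) → ℝ) (x : EuclideanSpace ℝ (Fin n)) : ℝ :=
  ⟪gradient φ x, exteriorNormal Ω x⟫_ℝ

/-- `∂Ω₊ = {x ∈ ∂Ω : φ' · ν ≥ 0}`. -/
def boundaryPlus {n : ℕ} (Ω : Set (EuclideanSpace ℝ (Fin n)))
    (φ : EuclideanSpace ℝ (Fin n) → ℝ) : Set (EuclideanSpace ℝ (Fin n)) :=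
  {x | x ∈ frontier Ω ∧ 0 ≤ normalSlope Ω φ x}

/-- `∂Ω₋ = {x ∈ ∂Ω : φ' · ν ≤ 0}`. -/
def boundaryMinus {n : ℕ} (Ω : Set (EuclideanSpace ℝ (Fin n)))
    (φ : EuclideanSpace ℝ (Fin n) → ℝ) : Set (EuclideanSpace ℝ (Fin n)) :=
  {x | x ∈ frontier Ω ∧ normalSlope Ω φ x ≤ 0}

/-- Normal derivative `∂_ν u` on `∂Ω`. -/
def normalDeriv {n : ℕ} (Ω : Set (EuclideanSpace ℝ (Fin n)))
    (u : EuclideanSpace ℝ (Fin n) → ℂ) (x : EuclideanSpace ℝ (Fin n)) : ℂ :=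
  fderiv ℝ u x (exteriorNormal Ω x)

/-- The complex gradient `∇u = (∂₁u, …, ∂ₙu) ∈ ℂⁿ`. -/
def complexGradient {n : ℕ} (u : EuclideanSpace ℝ (Fin n) → ℂ)
    (x : EuclideanSpace ℝ (Fin n)) : EuclideanSpace ℂ (Fin n) :=
  WithLp.toLp 2 fun j => fderiv ℝ u x (EuclideanSpace.single j 1)

/-- Squared `L²(Ω)` norm of a scalar or vector valued function. -/
def normSqL2 {n : ℕ} {F : Type*} [NormedAddCommGroup F] (Ω : Set (EuclideanSpace ℝ (Fin n)))
    (f : EuclideanSpace ℝ (Fin n) → F) : ℝ :=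
  ∫ x in Ω, ‖f x‖ ^ 2

/-- The weighted boundary form `((φ' · ν) f | f)_Γ`, for the surface measure, that is the
`(n-1)`-dimensional Euclidean Hausdorff measure, on `Γ ⊆ ∂Ω`. -/
def boundaryForm {n : ℕ} (Ω : Set (EuclideanSpace ℝ (Fin n)))
    (φ : EuclideanSpace ℝ (Fin n) → ℝ) (Γ : Set (EuclideanSpace ℝ (Fin n)))
    (f : EuclideanSpace ℝ (Fin n) → ℂ) : ℝ :=
  ∫ x in Γ, normalSlope Ω φ x * ‖f x‖ ^ 2 ∂(μHE[n - 1])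

/-- The operator `u ↦ -h²Δu + h²q u`. -/
def schrodingerOp {n : ℕ} (q : EuclideanSpace ℝ (Fin n) → ℂ) (h : ℝ)
    (u : EuclideanSpace ℝ (Fin n) → ℂ) (x : EuclideanSpace ℝ (Fin n)) : ℂ :=
  -(h : ℂ) ^ 2 * Laplacian.laplacian u x + (h : ℂ) ^ 2 * q x * u x

end

end CarlemanEstimate

open CarlemanEstimate

open Filter Topology

namespace CarlemanEstimate

noncomputable section

/-! Put `v = e^{ψ/h} u`, where `ψ = φ + κφ²/2` is a convexified weight. Then `e^{ψ/h}(-h²Δ)u = Av +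
Bv` with `Av = -h²Δv - |∇ψ|²v` and `Bv = 2h∇ψ·∇v + hΔψ v`. In `(Av + Bv)²` the cross term `2·Av·Bv`
is, up to a divergence, the commutator form `4h³ψ''(∇v,∇v) + 4hψ''(∇ψ,∇ψ)v²` plus a lower order term
(`divg_carlemanField`). The whole estimate is proved pointwise, and a divergence is integrated only
once.

The limiting condition says that `φ''(ξ,ξ) + φ''(φ',φ') = 0` for `ξ ⟂ φ'` with `|ξ| = |φ'|`
(`poissonBracket_eq`). By linear algebra (`quadratic_form_of_orthogonal`), with `m =
φ''(φ',φ')/|φ'|²`, the form `φ''(ξ,ξ) + m|ξ|²` is divisible by `φ'·ξ`. Hence the commutator of `φ`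
is a multiple of `v·Av`, modulo a divergence, plus a multiple of `φ'·∇v`, which `Bv` controls; both
are absorbed by `(Av)² + (Bv)²` with errors of size `h²(v² + |h∇v|²)`. Convexification adds a
positive term of size `hκv²`, and a small multiple of `div(v∇v)` converts part of it into `hκ|h∇v|²`
(`pointwise_carleman_aux`, `exists_pointwise_carleman`). With `κ = h/ε` and `ε` small and fixed,
this gain beats the errors, while `e^{ψ/h} = e^{φ/h}e^{φ²/(2ε)}` remains comparable with `e^{φ/h}`
uniformly in `h`.

On the boundary `u = 0`, so `∇v` is normal and the flux of the field is
`-2h³(1+κφ)(φ'·ν)|e^{ψ/h}∂_νu|²` (`flux_carlemanField_exp_mul`). Constants are free in the theorem,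
so the exact divergence theorem is not needed: `exists_divergenceBound` bounds the integral of a
divergence by `C` times the outflow minus `C⁻¹` times the inflow. It rests on tangential fields,
Lipschitz graphs and comparison of Hausdorff measures.

Real and imaginary parts are added, and the potential, which costs only `h⁴‖e^{φ/h}u‖²`, is absorbed
for small `h` (`normSqL2_laplacian_le`). -/

/-- The Euclidean space `ℝⁿ`. -/
abbrev Eu (n : ℕ) := EuclideanSpace ℝ (Fin n)

/-- The `i`-th partial derivative of a real function on `ℝⁿ`. -/
def pd {n : ℕ} (i : Fin n) (f : Eu n → ℝ) (x : Eu n) : ℝ :=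
  fderiv ℝ f x (EuclideanSpace.single i 1)

/-- The divergence of a vector field, given by its components. -/
def divg {n : ℕ} (F : Fin n → Eu n → ℝ) (x : Eu n) : ℝ := ∑ i, pd i (F i) x

/-! ### Partial derivatives, divergence and smooth extension. -/

section Calculus

variable {n : ℕ} {f g : Eu n → ℝ} {x : Eu n}

theorem smooth_differentiableAt (hf : ContDiff ℝ ∞ f) (x : Eu n) : DifferentiableAt ℝ f x :=
  hf.contDiffAt.differentiableAt (by simp)

theorem contDiff_pd (i : Fin n) (hf : ContDiff ℝ ∞ f) : ContDiff ℝ ∞ (pd i f) := by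
  have h : ContDiff ℝ ∞ (fderiv ℝ f) := hf.fderiv_right (by simp)
  exact h.clm_apply contDiff_const

theorem contDiffOn_pd {U : Set (Eu n)} (hU : IsOpen U) (i : Fin n) (hf : ContDiffOn ℝ ∞ f U) :
    ContDiffOn ℝ ∞ (pd i f) U := by
  have h : ContDiffOn ℝ ∞ (fderiv ℝ f) U := hf.fderiv_of_isOpen hU (by simp)
  exact h.clm_apply contDiffOn_const

theorem contDiff_divg {F : Fin n → Eu n → ℝ} (hF : ∀ i, ContDiff ℝ ∞ (F i)) :
    ContDiff ℝ ∞ (divg F) :=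
  ContDiff.sum fun i _ => contDiff_pd i (hF i)

theorem pd_congr (i : Fin n) (h : f =ᶠ[𝓝 x] g) : pd i f x = pd i g x := by
  unfold pd; rw [h.fderiv_eq]

theorem pd_eventuallyEq (i : Fin n) (h : f =ᶠ[𝓝 x] g) : pd i f =ᶠ[𝓝 x] pd i g := by
  filter_upwards [h.eventuallyEq_nhds] with y hy using pd_congr i hy

theorem pd_const (i : Fin n) (c : ℝ) : pd i (fun _ => c) x = 0 := by
  simp [pd]

theorem pd_add (i : Fin n) (hf : DifferentiableAt ℝ f x) (hg : DifferentiableAt ℝ g x) :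
    pd i (fun y => f y + g y) x = pd i f x + pd i g x := by
  unfold pd; rw [fderiv_fun_add hf hg]; simp

theorem pd_sub (i : Fin n) (hf : DifferentiableAt ℝ f x) (hg : DifferentiableAt ℝ g x) :
    pd i (fun y => f y - g y) x = pd i f x - pd i g x := by
  unfold pd; rw [fderiv_fun_sub hf hg]; simp

theorem pd_mul (i : Fin n) (hf : DifferentiableAt ℝ f x) (hg : DifferentiableAt ℝ g x) :
    pd i (fun y => f y * g y) x = pd i f x * g x + f x * pd i g x := by
  unfold pd; rw [fderiv_fun_mul hf hg]; simp; ring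

theorem pd_const_mul (i : Fin n) (c : ℝ) (hf : DifferentiableAt ℝ f x) :
    pd i (fun y => c * f y) x = c * pd i f x := by
  unfold pd; rw [fderiv_const_mul hf]; simp

theorem pd_sq (i : Fin n) (hf : DifferentiableAt ℝ f x) :
    pd i (fun y => f y ^ 2) x = 2 * f x * pd i f x := by
  simp only [pow_two]; rw [pd_mul i hf hf]; ring

theorem pd_sum {ι : Type*} (i : Fin n) (s : Finset ι) {f : ι → Eu n → ℝ}
    (hf : ∀ j ∈ s, DifferentiableAt ℝ (f j) x) :
    pd i (fun y => ∑ j ∈ s, f j y) x = ∑ j ∈ s, pd i (f j) x := by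
  unfold pd; rw [fderiv_fun_sum hf]; simp

theorem pd_comp (i : Fin n) {k : ℝ → ℝ} (hk : DifferentiableAt ℝ k (f x))
    (hf : DifferentiableAt ℝ f x) :
    pd i (fun y => k (f y)) x = deriv k (f x) * pd i f x := by
  unfold pd
  have := (hk.hasDerivAt.comp_hasFDerivAt x hf.hasFDerivAt).fderiv
  rw [show (fun y => k (f y)) = k ∘ f from rfl, this]; simp

theorem pd_comm (hf : ContDiffAt ℝ 2 f x) (i j : Fin n) :
    pd i (pd j f) x = pd j (pd i f) x := by
  have hs : IsSymmSndFDerivAt ℝ f x := hf.isSymmSndFDerivAt (by simp)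
  have hd : DifferentiableAt ℝ (fderiv ℝ f) x :=
    (hf.fderiv_right (m := 1) (by norm_num)).differentiableAt (by simp)
  have key : ∀ a b : Fin n, pd a (pd b f) x
      = fderiv ℝ (fderiv ℝ f) x (EuclideanSpace.single a 1) (EuclideanSpace.single b 1) := by
    intro a b
    have := (hd.hasFDerivAt.clm_apply
      (hasFDerivAt_const (EuclideanSpace.single b (1 : ℝ)) x)).fderiv
    unfold pd at *
    rw [show (fun y => fderiv ℝ f y (EuclideanSpace.single b (1 : ℝ)))
      = fun y => (fderiv ℝ f y) ((fun _ => EuclideanSpace.single b (1 : ℝ)) y) from rfl, this]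
    simp
  rw [key, key]
  exact hs _ _

theorem eu_eq_sum (v : Eu n) : v = ∑ i, v i • (EuclideanSpace.single i (1 : ℝ)) := by
  conv_lhs => rw [← (EuclideanSpace.basisFun (Fin n) ℝ).sum_repr v]
  simp

theorem fderiv_apply_eq_sum (v : Eu n) : fderiv ℝ f x v = ∑ i, pd i f x * v i := by
  conv_lhs => rw [eu_eq_sum v]
  rw [map_sum]
  exact Finset.sum_congr rfl fun i _ => by rw [map_smul, smul_eq_mul, mul_comm]; rfl

theorem gradient_apply (f : Eu n → ℝ) (x : Eu n) (i : Fin n) : gradient f x i = pd i f x := by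
  have h : ⟪gradient f x, EuclideanSpace.single i (1 : ℝ)⟫_ℝ = pd i f x := by
    simp [gradient, pd, InnerProductSpace.toDual_symm_apply]
  rw [← h, EuclideanSpace.inner_single_right]; simp

theorem eu_inner_eq_sum (v w : Eu n) : ⟪v, w⟫_ℝ = ∑ i, v i * w i := by
  rw [PiLp.inner_apply]
  exact Finset.sum_congr rfl fun i _ => by simp [mul_comm]

theorem eu_norm_sq_eq_sum (v : Eu n) : ‖v‖ ^ 2 = ∑ i, v i ^ 2 := by
  rw [EuclideanSpace.norm_sq_eq]; simp

theorem gradient_norm_sq (f : Eu n → ℝ) (x : Eu n) : ‖gradient f x‖ ^ 2 = ∑ i, pd i f x ^ 2 := by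
  rw [eu_norm_sq_eq_sum]; simp [gradient_apply]

theorem tsupport_pd_subset (i : Fin n) (f : Eu n → ℝ) : tsupport (pd i f) ⊆ tsupport f := by
  refine closure_minimal (fun x hx => ?_) (isClosed_tsupport f)
  by_contra hxs
  refine hx ?_
  have : f =ᶠ[𝓝 x] fun _ => 0 := notMem_tsupport_iff_eventuallyEq.1 hxs
  rw [pd_congr i this, pd_const]

theorem hasCompactSupport_pd (i : Fin n) (hf : HasCompactSupport f) :
    HasCompactSupport (pd i f) :=
  hf.of_isClosed_subset (isClosed_tsupport _) (tsupport_pd_subset i f)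

/-- Integration by parts against the constant function `1`, whose derivative vanishes. -/
theorem integral_pd_eq_zero (i : Fin n) (hf : ContDiff ℝ ∞ f) (hc : HasCompactSupport f) :
    ∫ x, pd i f x = 0 := by
  have hint : Integrable (pd i f) :=
    (contDiff_pd i hf).continuous.integrable_of_hasCompactSupport (hasCompactSupport_pd i hc)
  have h := integral_mul_fderiv_eq_neg_fderiv_mul_of_integrable (μ := (volume : Measure (Eu n)))
    (f := fun _ : Eu n => (1 : ℝ)) (g := f) (v := EuclideanSpace.single i 1)
    (by simp) (by simp only [one_mul]; exact hint)
    (by simpa using hf.continuous.integrable_of_hasCompactSupport hc)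
    (fun _ _ => differentiableAt_const _) (fun y _ => smooth_differentiableAt hf y)
  simpa [pd] using h

theorem integral_divg_eq_zero {F : Fin n → Eu n → ℝ} (hF : ∀ i, ContDiff ℝ ∞ (F i))
    (hc : ∀ i, HasCompactSupport (F i)) : ∫ x, divg F x = 0 := by
  unfold divg
  rw [integral_finsetSum]
  · exact Finset.sum_eq_zero fun i _ => integral_pd_eq_zero i (hF i) (hc i)
  · intro i _
    exact (contDiff_pd i (hF i)).continuous.integrable_of_hasCompactSupport
      (hasCompactSupport_pd i (hc i))

/-- A product with a smooth function is smooth when the other factor is smooth near the support. -/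
theorem contDiff_mul_of_tsupport {U : Set (Eu n)} (hU : IsOpen U) (hf : ContDiff ℝ ∞ f)
    (hs : tsupport f ⊆ U) (hg : ContDiffOn ℝ ∞ g U) : ContDiff ℝ ∞ fun x => f x * g x := by
  rw [contDiff_iff_contDiffAt]
  intro x
  by_cases hx : x ∈ tsupport f
  · exact hf.contDiffAt.mul (hg.contDiffAt (hU.mem_nhds (hs hx)))
  · have : (fun x => f x * g x) =ᶠ[𝓝 x] fun _ => 0 := by
      filter_upwards [notMem_tsupport_iff_eventuallyEq.1 hx] with y hy
      simp [hy]
    exact contDiffAt_const.congr_of_eventuallyEq this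

/-- A function smooth near a compact set agrees near this set with a globally smooth function. -/
theorem exists_contDiff_eventuallyEq {U K : Set (Eu n)} (hU : IsOpen U) (hK : IsCompact K)
    (hKU : K ⊆ U) (hf : ContDiffOn ℝ ∞ f U) :
    ∃ g : Eu n → ℝ, ContDiff ℝ ∞ g ∧ ∀ x ∈ K, g =ᶠ[𝓝 x] f := by
  obtain ⟨V, hV, hKV, hVU⟩ := normal_exists_closure_subset hK.isClosed hU hKU
  obtain ⟨χ, h1, h0, -⟩ := exists_contMDiffMap_one_nhds_of_subset_interior (n := ⊤)
    (modelWithCornersSelf ℝ (Eu n)) hK.isClosed (by rwa [hV.interior_eq] : K ⊆ interior V)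
  have hχ : ContDiff ℝ ∞ χ := χ.contMDiff.contDiff
  have hs : tsupport χ ⊆ U :=
    (closure_mono fun x hx => by by_contra h; exact hx (h0 x h)).trans hVU
  refine ⟨fun x => χ x * f x, contDiff_mul_of_tsupport hU hχ hs hf, fun x hx => ?_⟩
  filter_upwards [(eventually_nhdsSet_iff_forall.1 h1) x hx] with y hy
  simp [hy]

end Calculus

end

end CarlemanEstimate

/-! ### Divergence of tangential fields, and integration along a coordinate axis. -/

namespace CarlemanEstimate

noncomputable section

/-- A compactly supported vector field tangential to the level sets of a local defining function has
integral zero divergence over the domain. -/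
theorem setIntegral_divg_eq_zero_of_tangential {n : ℕ} {Ω V : Set (Eu n)} (hΩ : MeasurableSet Ω)
    {ρ : Eu n → ℝ} (hρ : ContDiff ℝ ∞ ρ) {G : Fin n → Eu n → ℝ} (hG : ∀ i, ContDiff ℝ ∞ (G i))
    (hc : ∀ i, HasCompactSupport (G i)) (hV : ∀ i, tsupport (G i) ⊆ V)
    (hmem : ∀ x ∈ V, (x ∈ Ω ↔ ρ x < 0)) (htan : ∀ x ∈ V, ∑ i, pd i ρ x * G i x = 0) :
    ∫ x in Ω, divg G x = 0 := by
  have hcont : Continuous (divg G) := (contDiff_divg hG).continuous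
  have hsupp : ∀ x ∉ V, divg G x = 0 := fun x hx =>
    Finset.sum_eq_zero fun i _ =>
      image_eq_zero_of_notMem_tsupport fun h => hx (hV i (tsupport_pd_subset i _ h))
  have hint : Integrable (divg G) := integrable_finsetSum _ fun i _ =>
    (contDiff_pd i (hG i)).continuous.integrable_of_hasCompactSupport (hasCompactSupport_pd i (hc i))
  -- These cutoffs converge pointwise to the indicator of `{ρ < 0}`. As functions of `ρ` alone they
  -- have gradients parallel to `∇ρ`, so for a tangential `G` no derivative of the cutoff survives
  -- in `div (θ j • G)`, however large `j` is.
  let θ : ℕ → Eu n → ℝ := fun j x => Real.smoothTransition (-(j : ℝ) * ρ x)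
  have hθ : ∀ j, ContDiff ℝ ∞ (θ j) := fun j =>
    Real.smoothTransition.contDiff.comp (contDiff_const.mul hρ)
  have hθpd : ∀ j i x, pd i (θ j) x
      = deriv Real.smoothTransition (-(j : ℝ) * ρ x) * (-(j : ℝ) * pd i ρ x) := by
    intro j i x
    have h1 : DifferentiableAt ℝ Real.smoothTransition (-(j : ℝ) * ρ x) :=
      (Real.smoothTransition.contDiff (n := 1)).differentiable (by simp) _
    have h2 : DifferentiableAt ℝ (fun y => -(j : ℝ) * ρ y) x :=
      (smooth_differentiableAt hρ x).const_mul _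
    rw [pd_comp (f := fun y => -(j : ℝ) * ρ y) i h1 h2,
      pd_const_mul i _ (smooth_differentiableAt hρ x)]
  have hdiv : ∀ j x, divg (fun i y => θ j y * G i y) x = θ j x * divg G x := by
    intro j x
    have h0 : ∑ i, pd i ρ x * G i x = 0 := by
      by_cases hx : x ∈ V
      · exact htan x hx
      · exact Finset.sum_eq_zero fun i _ => by
          rw [image_eq_zero_of_notMem_tsupport fun h => hx (hV i h), mul_zero]
    have h1 : ∑ i, pd i (θ j) x * G i x = 0 := by
      have : ∀ i, pd i (θ j) x * G i x
          = deriv Real.smoothTransition (-(j : ℝ) * ρ x) * -(j : ℝ) * (pd i ρ x * G i x) := by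
        intro i; rw [hθpd]; ring
      simp_rw [this, ← Finset.mul_sum, h0, mul_zero]
    unfold divg
    have : ∀ i, pd i (fun y => θ j y * G i y) x = pd i (θ j) x * G i x + θ j x * pd i (G i) x :=
      fun i => pd_mul i (smooth_differentiableAt (hθ j) x) (smooth_differentiableAt (hG i) x)
    simp_rw [this, Finset.sum_add_distrib, h1, zero_add, Finset.mul_sum]
  have hzero : ∀ j, ∫ x, θ j x * divg G x = 0 := by
    intro j
    simp_rw [← hdiv j]
    exact integral_divg_eq_zero (fun i => (hθ j).mul (hG i)) fun i => (hc i).mul_left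
  have hlim : Tendsto (fun j => ∫ x, θ j x * divg G x) atTop
      (𝓝 (∫ x, Ω.indicator (divg G) x)) := by
    refine tendsto_integral_of_dominated_convergence (fun x => ‖divg G x‖)
      (fun j => ((hθ j).continuous.mul hcont).aestronglyMeasurable) hint.norm
      (fun j => Eventually.of_forall fun x => ?_) (Eventually.of_forall fun x => ?_)
    · rw [norm_mul]
      refine mul_le_of_le_one_left (norm_nonneg _) ?_
      rw [Real.norm_of_nonneg (Real.smoothTransition.nonneg _)]
      exact Real.smoothTransition.le_one _
    · by_cases hx : x ∈ V
      · by_cases hxΩ : x ∈ Ω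
        · have hneg : ρ x < 0 := (hmem x hx).1 hxΩ
          rw [indicator_of_mem hxΩ]
          refine tendsto_const_nhds.congr' ?_
          obtain ⟨N, hN⟩ := exists_nat_gt (1 / (-ρ x))
          filter_upwards [eventually_ge_atTop N] with j hj
          have hjN : (N : ℝ) ≤ j := by exact_mod_cast hj
          have : 1 ≤ -(j : ℝ) * ρ x := by
            have h1 := (div_lt_iff₀ (by linarith : 0 < -ρ x)).1 hN
            nlinarith
          change _ = Real.smoothTransition (-(j : ℝ) * ρ x) * _
          rw [Real.smoothTransition.one_of_one_le this, one_mul]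
        · have hnn : 0 ≤ ρ x := not_lt.1 fun h => hxΩ ((hmem x hx).2 h)
          rw [indicator_of_notMem hxΩ]
          refine tendsto_const_nhds.congr fun j => ?_
          have : -(j : ℝ) * ρ x ≤ 0 := by
            have : (0 : ℝ) ≤ j := by positivity
            nlinarith
          change _ = Real.smoothTransition (-(j : ℝ) * ρ x) * _
          rw [Real.smoothTransition.zero_of_nonpos this, zero_mul]
      · have : Ω.indicator (divg G) x = 0 := indicator_apply_eq_zero.2 fun _ => hsupp x hx
        rw [this, hsupp x hx]; simp
  simp_rw [hzero] at hlim
  rw [← integral_indicator hΩ]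
  exact (tendsto_nhds_unique hlim tendsto_const_nhds)

/-- The point of `ℝᵐ⁺¹` with `k`-th coordinate `t` and remaining coordinates `y`. -/
def ins {m : ℕ} (k : Fin (m + 1)) (t : ℝ) (y : Fin m → ℝ) : Eu (m + 1) :=
  WithLp.toLp 2 (k.insertNth (α := fun _ => ℝ) t y)

/-- The projection of `ℝᵐ⁺¹` forgetting the `k`-th coordinate. -/
def prj {m : ℕ} (k : Fin (m + 1)) (x : Eu (m + 1)) : Fin m → ℝ := fun i => x (k.succAbove i)

section Coordinates

variable {m : ℕ} (k : Fin (m + 1))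

@[simp] theorem ins_same (t : ℝ) (y : Fin m → ℝ) : ins k t y k = t := by simp [ins]

@[simp] theorem ins_succAbove (t : ℝ) (y : Fin m → ℝ) (i : Fin m) :
    ins k t y (k.succAbove i) = y i := by simp [ins]

@[simp] theorem prj_ins (t : ℝ) (y : Fin m → ℝ) : prj k (ins k t y) = y := by
  ext i; simp [prj]

theorem eu_ext_succAbove {x y : Eu (m + 1)} (h : x k = y k) (h' : prj k x = prj k y) : x = y := by
  ext j
  rcases Fin.eq_self_or_eq_succAbove k j with rfl | ⟨i, rfl⟩
  · exact h
  · exact congrFun h' i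

@[simp] theorem ins_prj (x : Eu (m + 1)) : ins k (x k) (prj k x) = x :=
  eu_ext_succAbove k (by simp) (by simp)

theorem ins_eq_add (t : ℝ) (y : Fin m → ℝ) :
    ins k t y = ins k 0 y + t • EuclideanSpace.single k (1 : ℝ) :=
  eu_ext_succAbove k (by simp) (by ext i; simp [prj])

theorem hasDerivAt_ins (t : ℝ) (y : Fin m → ℝ) :
    HasDerivAt (fun t => ins k t y) (EuclideanSpace.single k (1 : ℝ)) t := by
  rw [show (fun t => ins k t y) = fun t => ins k 0 y + t • EuclideanSpace.single k (1 : ℝ) from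
    funext fun t => ins_eq_add k t y]
  simpa using ((hasDerivAt_id t).smul_const (EuclideanSpace.single k (1 : ℝ))).const_add (ins k 0 y)

theorem continuous_ins : Continuous fun p : ℝ × (Fin m → ℝ) => ins k p.1 p.2 := by
  refine (PiLp.continuous_toLp 2 _).comp (continuous_pi fun j => ?_)
  rcases Fin.eq_self_or_eq_succAbove k j with rfl | ⟨i, rfl⟩
  · simpa using continuous_fst
  · simp only [Fin.insertNth_apply_succAbove]; fun_prop

theorem continuous_prj : Continuous (prj k) := by unfold prj; fun_prop

theorem integral_eq_integral_ins {f : Eu (m + 1) → ℝ} (hf : Integrable f) :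
    ∫ x, f x = ∫ y : Fin m → ℝ, ∫ t : ℝ, f (ins k t y) := by
  let e : ℝ × (Fin m → ℝ) ≃ᵐ Eu (m + 1) :=
    (MeasurableEquiv.piFinSuccAbove (fun _ : Fin (m + 1) => ℝ) k).symm.trans
      (MeasurableEquiv.toLp 2 (Fin (m + 1) → ℝ))
  have he : MeasurePreserving e (volume.prod volume) volume :=
    (PiLp.volume_preserving_toLp (Fin (m + 1))).comp
      (volume_preserving_piFinSuccAbove (fun _ : Fin (m + 1) => ℝ) k).symm
  have hfe : Integrable (fun p => f (e p)) (volume.prod volume) :=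
    (he.integrable_comp_emb e.measurableEmbedding).2 hf
  rw [← he.integral_comp e.measurableEmbedding, integral_prod_symm _ hfe]
  rfl

theorem exists_lipschitzWith_ins :
    ∃ K : NNReal, LipschitzWith K fun p : ℝ × (Fin m → ℝ) => ins k p.1 p.2 := by
  have h : LipschitzWith 1 fun p : ℝ × (Fin m → ℝ) =>
      (k.insertNth (α := fun _ => ℝ) p.1 p.2 : Fin (m + 1) → ℝ) := by
    refine LipschitzWith.mk_one fun p q => (dist_pi_le_iff dist_nonneg).2 fun j => ?_
    rcases Fin.eq_self_or_eq_succAbove k j with rfl | ⟨i, rfl⟩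
    · simp only [Fin.insertNth_apply_same]
      exact le_max_left (dist p.1 q.1) (dist p.2 q.2)
    · simp only [Fin.insertNth_apply_succAbove]
      exact (dist_le_pi_dist p.2 q.2 i).trans (le_max_right _ _)
  exact ⟨_, (PiLp.lipschitzWith_toLp 2 (fun _ : Fin (m + 1) => ℝ)).comp h⟩

attribute [irreducible] ins

/-- The fundamental theorem of calculus in the direction of the `k`-th coordinate for a domain which
is the sub- or supergraph of a function. -/
theorem setIntegral_pd_eq_integral_graph {s : ℝ} (hs : s = 1 ∨ s = -1) {Ω V : Set (Eu (m + 1))}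
    (hΩ : MeasurableSet Ω) {γ : (Fin m → ℝ) → ℝ}
    (hV : ∀ x ∈ V, (x ∈ Ω ↔ s * (x k - γ (prj k x)) < 0))
    {w : Eu (m + 1) → ℝ} (hw : ContDiff ℝ ∞ w) (hc : HasCompactSupport w) (hwV : tsupport w ⊆ V) :
    ∫ x in Ω, pd k w x = s * ∫ y, w (ins k (γ y) y) := by
  have hint : Integrable (pd k w) :=
    (contDiff_pd k hw).continuous.integrable_of_hasCompactSupport (hasCompactSupport_pd k hc)
  rw [← integral_indicator hΩ, integral_eq_integral_ins k (hint.indicator hΩ),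
    ← integral_const_mul]
  congr 1
  ext y
  set g : ℝ → ℝ := fun t => w (ins k t y) with hg
  have hins : ContDiff ℝ 1 (fun t => ins k t y) := by
    rw [show (fun t => ins k t y) = fun t => ins k 0 y + t • EuclideanSpace.single k (1 : ℝ) from
      funext fun t => ins_eq_add k t y]
    fun_prop
  have hg1 : ContDiff ℝ 1 g := (hw.of_le (by exact_mod_cast le_top)).comp hins
  have hgc : HasCompactSupport g := by
    refine HasCompactSupport.intro (K := (fun x : Eu (m + 1) => x k) '' tsupport w)
      (hc.isCompact.image (by fun_prop)) fun t ht => ?_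
    by_contra h
    exact ht ⟨ins k t y, subset_tsupport _ h, by simp⟩
  have hgd : ∀ t, deriv g t = pd k w (ins k t y) := fun t =>
    ((smooth_differentiableAt hw (ins k t y)).hasFDerivAt.comp_hasDerivAt t
      (hasDerivAt_ins k t y)).deriv
  -- Only inside `V` is the slice of `Ω` known to be a half-line; elsewhere both sides vanish
  -- because `∂ₖw` does.
  have hind : ∀ t, Ω.indicator (pd k w) (ins k t y)
      = {t | s * (t - γ y) < 0}.indicator (deriv g) t := by
    intro t
    by_cases ht : ins k t y ∈ V
    · have := hV _ ht
      simp only [ins_same, prj_ins] at this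
      by_cases h : s * (t - γ y) < 0
      · rw [indicator_of_mem (this.2 h), indicator_of_mem (by exact h), hgd]
      · rw [indicator_of_notMem (fun h' => h (this.1 h')), indicator_of_notMem (by exact h)]
    · have : pd k w (ins k t y) = 0 :=
        image_eq_zero_of_notMem_tsupport fun h => ht (hwV (tsupport_pd_subset k w h))
      simp [indicator_apply, hgd, this]
  simp_rw [hind]
  rcases hs with rfl | rfl
  · have : {t | 1 * (t - γ y) < 0} = Iio (γ y) := by ext t; simp
    rw [this, integral_indicator measurableSet_Iio, ← integral_Iic_eq_integral_Iio,
      hgc.integral_Iic_deriv_eq hg1, one_mul]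
  · have : {t | -1 * (t - γ y) < 0} = Ioi (γ y) := by ext t; simp
    rw [this, integral_indicator measurableSet_Ioi, hgc.integral_Ioi_deriv_eq hg1]
    simp [hg]

end Coordinates

end

end CarlemanEstimate

namespace CarlemanEstimate

noncomputable section

/-! ### Lipschitz graphs, Hausdorff measure and boundary charts. -/

section Graph

variable {m : ℕ} (k : Fin (m + 1))

theorem lipschitzWith_prj : LipschitzWith 1 (prj k) := by
  refine LipschitzWith.mk_one fun x y => (dist_pi_le_iff dist_nonneg).2 fun i => ?_
  rw [Real.dist_eq, dist_eq_norm]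
  exact PiLp.norm_apply_le (x - y) (k.succAbove i)

theorem exists_lipschitzWith_graph {γ : (Fin m → ℝ) → ℝ} {K : NNReal} (hγ : LipschitzWith K γ) :
    ∃ K' : NNReal, LipschitzWith K' fun y => ins k (γ y) y := by
  obtain ⟨L, hL⟩ := exists_lipschitzWith_ins k
  have h : LipschitzWith (max K 1) fun y => (γ y, y) := hγ.prodMk LipschitzWith.id
  have h' := hL.comp h
  exact ⟨L * max K 1, h'⟩

/-- The pushforward of Lebesgue measure to a Lipschitz graph is comparable with the Hausdorff
measure of the graph. -/
theorem exists_graph_measure_le {γ : (Fin m → ℝ) → ℝ} {K : NNReal} (hγ : LipschitzWith K γ)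
    (B : Set (Fin m → ℝ)) :
    ∃ C : NNReal,
      (volume.restrict B).map (fun y => ins k (γ y) y)
        ≤ (C : ENNReal) • (μHE[m] : Measure (Eu (m + 1))).restrict ((fun y => ins k (γ y) y) '' B) ∧
      (μHE[m] : Measure (Eu (m + 1))).restrict ((fun y => ins k (γ y) y) '' B)
        ≤ (C : ENNReal) • (volume.restrict B).map (fun y => ins k (γ y) y) := by
  obtain ⟨K', hK'⟩ := exists_lipschitzWith_graph k hγ
  set Γ : (Fin m → ℝ) → Eu (m + 1) := fun y => ins k (γ y) y with hΓ
  set c : NNReal := Measure.addHaarScalarFactor (volume : Measure (EuclideanSpace ℝ (Fin m))) μH[m]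
    with hc
  have hc0 : c ≠ 0 := Measure.addHaarScalarFactor_volume_hausdorffMeasure_ne_zero m
  have hHE : ∀ A : Set (Eu (m + 1)), (μHE[m] : Measure (Eu (m + 1))) A = c * μH[m] A := by
    intro A
    rw [Measure.euclideanHausdorffMeasure_def, Measure.smul_apply]; rfl
  -- For the sup norm of `Fin m → ℝ`, Lebesgue measure is exactly the Hausdorff measure; the
  -- normalisation `c` is needed only in the Euclidean target.
  have hvol : (volume : Measure (Fin m → ℝ)) = μH[m] := by
    rw [← hausdorffMeasure_pi_real, Fintype.card_fin]
  have hinv : ∀ y, prj k (Γ y) = y := fun y => by simp [hΓ]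
  have himg : ∀ A : Set (Eu (m + 1)), A ∩ Γ '' B = Γ '' (Γ ⁻¹' A ∩ B) := fun A => by
    ext x; constructor
    · rintro ⟨hx, y, hy, rfl⟩; exact ⟨y, ⟨hx, hy⟩, rfl⟩
    · rintro ⟨y, ⟨hx, hy⟩, rfl⟩; exact ⟨hx, y, hy, rfl⟩
  have hS : ∀ A : Set (Eu (m + 1)), MeasurableSet A →
      ((volume.restrict B).map Γ) A = (μH[m] : Measure (Fin m → ℝ)) (Γ ⁻¹' A ∩ B) := by
    intro A hA
    have hm := hK'.continuous.measurable hA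
    rw [Measure.map_apply hK'.continuous.measurable hA, Measure.restrict_apply hm, hvol]
  have hHS : ∀ A : Set (Eu (m + 1)), MeasurableSet A →
      ((μHE[m] : Measure (Eu (m + 1))).restrict (Γ '' B)) A
        = c * (μH[m] : Measure (Eu (m + 1))) (Γ '' (Γ ⁻¹' A ∩ B)) := by
    intro A hA
    rw [Measure.restrict_apply hA, hHE, himg]
  -- The projection is a 1-Lipschitz left inverse of the graph map, whence `c⁻¹`; the graph map is
  -- `K'`-Lipschitz, whence `c * K' ^ m`.
  refine ⟨max c⁻¹ (c * K' ^ m), ?_, ?_⟩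
  · refine Measure.le_iff.2 fun A hA => ?_
    rw [Measure.smul_apply, hS A hA, hHS A hA, smul_eq_mul, ← mul_assoc]
    have h1 : (μH[m] : Measure (Fin m → ℝ)) (Γ ⁻¹' A ∩ B)
        ≤ (μH[m] : Measure (Eu (m + 1))) (Γ '' (Γ ⁻¹' A ∩ B)) := by
      have := (lipschitzWith_prj k).hausdorffMeasure_image_le (d := m) (by positivity)
        (Γ '' (Γ ⁻¹' A ∩ B))
      rw [image_image] at this
      simpa [hinv] using this
    refine h1.trans (le_mul_of_one_le_left' ?_)
    have : (1 : NNReal) ≤ max c⁻¹ (c * K' ^ m) * c := by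
      calc (1 : NNReal) = c⁻¹ * c := (inv_mul_cancel₀ hc0).symm
        _ ≤ _ := mul_le_mul_left (le_max_left _ _) c
    exact_mod_cast this
  · refine Measure.le_iff.2 fun A hA => ?_
    rw [Measure.smul_apply, hS A hA, hHS A hA, smul_eq_mul]
    have h1 := hK'.hausdorffMeasure_image_le (d := m) (by positivity) (Γ ⁻¹' A ∩ B)
    rw [ENNReal.rpow_natCast] at h1
    calc (c : ENNReal) * (μH[m] : Measure (Eu (m + 1))) (Γ '' (Γ ⁻¹' A ∩ B))
        ≤ c * (K' ^ m * (μH[m] : Measure (Fin m → ℝ)) (Γ ⁻¹' A ∩ B)) := by gcongr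
      _ = ((c * K' ^ m : NNReal) : ENNReal) * (μH[m] : Measure (Fin m → ℝ)) (Γ ⁻¹' A ∩ B) := by
        push_cast; ring
      _ ≤ _ := by
        gcongr
        exact le_max_right _ _

end Graph

section DefiningFunction

variable {n : ℕ} {Ω U : Set (Eu n)} {ρ : Eu n → ℝ}

/-- A zero of `ρ` outside `closure Ω` would be a local minimum of `ρ`, which a nonvanishing gradient
forbids. -/
theorem IsDefiningFunction.mem_frontier_iff (hρ : IsDefiningFunction Ω U ρ) {x : Eu n}
    (hx : x ∈ U) : x ∈ frontier Ω ↔ ρ x = 0 := by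
  have hU : U ∈ 𝓝 x := hρ.isOpen.mem_nhds hx
  have hd : DifferentiableAt ℝ ρ x := (hρ.contDiffOn.contDiffAt hU).differentiableAt (by simp)
  constructor
  · intro hxf
    rcases lt_trichotomy (ρ x) 0 with h | h | h
    · exfalso
      have : ∀ᶠ y in 𝓝 x, y ∈ Ω := by
        filter_upwards [hd.continuousAt.eventually_lt continuousAt_const h, hU] with y hy hyU
        exact (hρ.mem_iff y hyU).2 hy
      exact hxf.2 (mem_interior_iff_mem_nhds.2 this)
    · exact h
    · exfalso
      have : ∀ᶠ y in 𝓝 x, y ∉ Ω := by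
        filter_upwards [continuousAt_const.eventually_lt hd.continuousAt h, hU] with y hy hyU hyΩ
        exact absurd ((hρ.mem_iff y hyU).1 hyΩ) (not_lt.2 hy.le)
      exact (mem_closure_iff_frequently.1 hxf.1) this
  · intro h0
    refine ⟨?_, fun hi => ?_⟩
    · by_contra hcl
      have hmin : IsLocalMin ρ x := by
        have : ∀ᶠ y in 𝓝 x, y ∉ closure Ω := isClosed_closure.isOpen_compl.mem_nhds hcl
        filter_upwards [this, hU] with y hy hyU
        rw [h0]
        exact not_lt.1 fun h => hy (subset_closure ((hρ.mem_iff y hyU).2 h))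
      refine hρ.gradient_ne_zero x hx ?_
      simp [gradient, hmin.fderiv_eq_zero]
    · have := (hρ.mem_iff x hx).1 (interior_subset hi)
      rw [h0] at this
      exact lt_irrefl _ this

end DefiningFunction

/-- Near a boundary point, the domain is the sub- or supergraph of a Lipschitz function over a
coordinate hyperplane. -/
theorem exists_boundary_chart {m : ℕ} {Ω U : Set (Eu (m + 1))} {ρ : Eu (m + 1) → ℝ}
    (hρ : IsDefiningFunction Ω U ρ) {x₀ : Eu (m + 1)} (hx₀ : x₀ ∈ frontier Ω) (hxU : x₀ ∈ U) :
    ∃ (k : Fin (m + 1)) (s : ℝ) (B : Set (Fin m → ℝ)) (a b : ℝ) (γ : (Fin m → ℝ) → ℝ) (K : NNReal)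
      (Q : Set (Eu (m + 1))), (s = 1 ∨ s = -1) ∧ IsOpen B ∧ volume B < ⊤ ∧ LipschitzWith K γ ∧
      IsCompact Q ∧ Q ⊆ U ∧ prj k x₀ ∈ B ∧ x₀ k ∈ Ioo a b ∧ (∀ y ∈ B, γ y ∈ Ioo a b) ∧
      (∀ x ∈ Q, 0 < s * pd k ρ x) ∧
      ∀ x, prj k x ∈ B → x k ∈ Ioo a b →
        x ∈ Q ∧ (ρ x < 0 ↔ s * (x k - γ (prj k x)) < 0) ∧ (ρ x = 0 ↔ x k = γ (prj k x)) := by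
  have hU : U ∈ 𝓝 x₀ := hρ.isOpen.mem_nhds hxU
  have hρ0 : ρ x₀ = 0 := (hρ.mem_frontier_iff hxU).1 hx₀
  obtain ⟨k, hk⟩ : ∃ k, pd k ρ x₀ ≠ 0 := by
    by_contra! h
    refine hρ.gradient_ne_zero x₀ hxU ?_
    ext i
    rw [gradient_apply, h i]; rfl
  obtain ⟨s, hs, hsk⟩ : ∃ s : ℝ, (s = 1 ∨ s = -1) ∧ 0 < s * pd k ρ x₀ := by
    rcases lt_or_gt_of_ne hk with h | h
    · exact ⟨-1, Or.inr rfl, by linarith⟩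
    · exact ⟨1, Or.inl rfl, by linarith⟩
  have hs2 : s * s = 1 := by rcases hs with rfl | rfl <;> norm_num
  have hsabs : |s| = 1 := by rcases hs with rfl | rfl <;> norm_num
  -- On a small ball `s ∂ₖρ` stays above `c` and the derivative of `ρ` below `M` in norm. So `s ρ`
  -- increases along slices at rate at least `c`, which gives a unique zero on each slice. Comparing
  -- two slices gives the Lipschitz constant `c⁻¹ * M * L` for the zero.
  set c : ℝ := s * pd k ρ x₀ / 2 with hc
  have hc0 : 0 < c := by positivity
  set M : ℝ := ‖fderiv ℝ ρ x₀‖ + 1 with hM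
  obtain ⟨R, hR0, hR⟩ : ∃ R > 0, Metric.closedBall x₀ R ⊆
      {x | x ∈ U ∧ c < s * pd k ρ x ∧ ‖fderiv ℝ ρ x‖ < M} := by
    refine Metric.nhds_basis_closedBall.mem_iff.1 ?_
    have h1 : ContinuousAt (fun x => s * pd k ρ x) x₀ :=
      continuousAt_const.mul ((contDiffOn_pd hρ.isOpen k hρ.contDiffOn).continuousOn.continuousAt hU)
    have h2 : ContinuousAt (fun x => ‖fderiv ℝ ρ x‖) x₀ :=
      ((hρ.contDiffOn.continuousOn_fderiv_of_isOpen hρ.isOpen (by simp)).continuousAt hU).norm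
    filter_upwards [hU, continuousAt_const.eventually_lt h1 (show c < s * pd k ρ x₀ by
      rw [hc]; linarith), h2.eventually_lt continuousAt_const (show ‖fderiv ℝ ρ x₀‖ < M by
      rw [hM]; linarith)] with x h1 h2 h3
    exact ⟨h1, h2, h3⟩
  have hdiff : ∀ x ∈ Metric.closedBall x₀ R, DifferentiableAt ℝ ρ x := fun x hx =>
    (hρ.contDiffOn.contDiffAt (hρ.isOpen.mem_nhds (hR hx).1)).differentiableAt (by simp)
  have hLipρ : ∀ x ∈ Metric.closedBall x₀ R, ∀ y ∈ Metric.closedBall x₀ R,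
      |ρ y - ρ x| ≤ M * ‖y - x‖ := fun x hx y hy =>
    (convex_closedBall x₀ R).norm_image_sub_le_of_norm_fderiv_le hdiff
      (fun z hz => (hR hz).2.2.le) hx hy
  obtain ⟨L, hL⟩ := exists_lipschitzWith_ins k
  obtain ⟨δ, hδ0, hδ⟩ : ∃ δ : ℝ, 0 < δ ∧ ∀ (t : ℝ) (y : Fin m → ℝ), |t - x₀ k| ≤ δ →
      dist y (prj k x₀) ≤ δ → ins k t y ∈ Metric.closedBall x₀ R := by
    refine ⟨R / (L + 1), by positivity, fun t y ht hy => ?_⟩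
    have h1 : dist (ins k t y) (ins k (x₀ k) (prj k x₀)) ≤ L * max |t - x₀ k| (dist y (prj k x₀)) :=
      hL.dist_le_mul (t, y) (x₀ k, prj k x₀)
    rw [ins_prj] at h1
    rw [Metric.mem_closedBall]
    calc dist (ins k t y) x₀ ≤ L * (R / (L + 1)) :=
          h1.trans (mul_le_mul_of_nonneg_left (max_le ht hy) L.2)
      _ = R * (L / (L + 1)) := by ring
      _ ≤ R * 1 := mul_le_mul_of_nonneg_left
          ((div_le_one (by positivity)).2 (by linarith)) hR0.le
      _ = R := mul_one R
  set a := x₀ k - δ with ha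
  set b := x₀ k + δ with hb
  have hab : a < b := by rw [ha, hb]; linarith
  have hmemR : ∀ t ∈ Icc a b, ∀ y, dist y (prj k x₀) ≤ δ → ins k t y ∈ Metric.closedBall x₀ R :=
    fun t ht y hy => hδ t y (abs_le.2 ⟨by linarith [ht.1], by linarith [ht.2]⟩) hy
  have hderiv : ∀ y, dist y (prj k x₀) ≤ δ → ∀ t ∈ Icc a b,
      HasDerivAt (fun t => s * ρ (ins k t y)) (s * pd k ρ (ins k t y)) t := fun y hy t ht =>
    ((hdiff _ (hmemR t ht y hy)).hasFDerivAt.comp_hasDerivAt t (hasDerivAt_ins k t y)).const_mul s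
  have hmono : ∀ y, dist y (prj k x₀) ≤ δ → ∀ t ∈ Icc a b, ∀ t' ∈ Icc a b, t ≤ t' →
      c * (t' - t) ≤ s * ρ (ins k t' y) - s * ρ (ins k t y) := fun y hy =>
    (convex_Icc a b).mul_sub_le_image_sub_of_le_deriv
      (fun t ht => (hderiv y hy t ht).continuousAt.continuousWithinAt)
      (fun t ht => (hderiv y hy t (interior_subset ht)).differentiableAt.differentiableWithinAt)
      (fun t ht => by
        rw [(hderiv y hy t (interior_subset ht)).deriv]
        exact (hR (hmemR t (interior_subset ht) y hy)).2.1.le)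
  have hend : ∀ t ∈ Icc a b, ContinuousAt (fun y => s * ρ (ins k t y)) (prj k x₀) := by
    intro t ht
    have h1 : ContinuousAt ρ (ins k t (prj k x₀)) :=
      (hdiff _ (hmemR t ht _ (by simpa using hδ0.le))).continuousAt
    have h2 : Continuous fun y : Fin m → ℝ => ins k t y :=
      (continuous_ins k).comp (continuous_const.prodMk continuous_id)
    exact continuousAt_const.mul (ContinuousAt.comp (f := fun y => ins k t y) h1 h2.continuousAt)
  have hx0k : x₀ k ∈ Icc a b := ⟨by rw [ha]; linarith, by rw [hb]; linarith⟩
  have hd0 : dist (prj k x₀) (prj k x₀) ≤ δ := by simpa using hδ0.le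
  have hea : s * ρ (ins k a (prj k x₀)) < 0 := by
    have := hmono _ hd0 a (left_mem_Icc.2 hab.le) _ hx0k hx0k.1
    rw [ins_prj, hρ0] at this
    have : 0 < c * (x₀ k - a) := mul_pos hc0 (by rw [ha]; linarith)
    linarith
  have heb : 0 < s * ρ (ins k b (prj k x₀)) := by
    have := hmono _ hd0 _ hx0k b (right_mem_Icc.2 hab.le) hx0k.2
    rw [ins_prj, hρ0] at this
    have : 0 < c * (b - x₀ k) := mul_pos hc0 (by rw [hb]; linarith)
    linarith
  obtain ⟨δ', hδ'0, hδ'⟩ : ∃ δ' > 0, Metric.ball (prj k x₀) δ' ⊆ {y | dist y (prj k x₀) ≤ δ ∧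
      s * ρ (ins k a y) < 0 ∧ 0 < s * ρ (ins k b y)} := by
    refine Metric.nhds_basis_ball.mem_iff.1 ?_
    filter_upwards [Metric.closedBall_mem_nhds _ hδ0,
      (hend a (left_mem_Icc.2 hab.le)).eventually_lt continuousAt_const hea,
      continuousAt_const.eventually_lt (hend b (right_mem_Icc.2 hab.le)) heb] with y h1 h2 h3
    exact ⟨h1, h2, h3⟩
  set B := Metric.ball (prj k x₀) δ' with hB
  have hzero : ∀ y ∈ B, ∃ t ∈ Ioo a b, ρ (ins k t y) = 0 := by
    intro y hy
    obtain ⟨h1, h2, h3⟩ := hδ' hy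
    obtain ⟨t, ht, ht0⟩ := intermediate_value_Ioo hab.le
      (fun t ht => (hderiv y h1 t ht).continuousAt.continuousWithinAt) ⟨h2, h3⟩
    refine ⟨t, ht, ?_⟩
    have : s * (s * ρ (ins k t y)) = 0 := by rw [show s * ρ (ins k t y) = 0 from ht0, mul_zero]
    rwa [← mul_assoc, hs2, one_mul] at this
  choose! γ₀ hγI hγ0 using hzero
  have hγLip : LipschitzOnWith (Real.toNNReal (c⁻¹ * M * L)) γ₀ B := by
    have hM0 : 0 ≤ M := by positivity
    refine LipschitzOnWith.of_dist_le_mul fun y hy y' hy' => ?_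
    rw [Real.coe_toNNReal _ (by positivity)]
    have hI := Ioo_subset_Icc_self (hγI y hy)
    have hI' := Ioo_subset_Icc_self (hγI y' hy')
    have h1 : c * |γ₀ y - γ₀ y'| ≤ |ρ (ins k (γ₀ y') y)| := by
      have hle : |s * ρ (ins k (γ₀ y') y)| = |ρ (ins k (γ₀ y') y)| := by
        rw [abs_mul, hsabs, one_mul]
      rw [← hle]
      rcases le_total (γ₀ y) (γ₀ y') with h | h
      · have := hmono y (hδ' hy).1 _ hI _ hI' h
        rw [hγ0 y hy, mul_zero, sub_zero] at this
        rw [abs_sub_comm, abs_of_nonneg (sub_nonneg.2 h)]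
        exact this.trans (le_abs_self _)
      · have := hmono y (hδ' hy).1 _ hI' _ hI h
        rw [hγ0 y hy, mul_zero, zero_sub] at this
        rw [abs_of_nonneg (sub_nonneg.2 h)]
        exact this.trans (neg_le_abs _)
    have h2 : |ρ (ins k (γ₀ y') y)| ≤ M * (L * dist y y') := by
      have := hLipρ _ (hmemR _ hI' y' (hδ' hy').1) _ (hmemR _ hI' y (hδ' hy).1)
      rw [hγ0 y' hy', sub_zero] at this
      refine this.trans (mul_le_mul_of_nonneg_left ?_ hM0)
      rw [← dist_eq_norm]
      have := hL.dist_le_mul (γ₀ y', y) (γ₀ y', y')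
      simpa [Prod.dist_eq] using this
    rw [Real.dist_eq]
    calc |γ₀ y - γ₀ y'| = c⁻¹ * (c * |γ₀ y - γ₀ y'|) := by field_simp
      _ ≤ c⁻¹ * (M * (L * dist y y')) :=
          mul_le_mul_of_nonneg_left (h1.trans h2) (inv_nonneg.2 hc0.le)
      _ = _ := by ring
  -- A globally Lipschitz `γ` makes the graph map globally Lipschitz, as the measure comparison
  -- requires; its values outside `B` play no role.
  obtain ⟨γ, hγLip', hγeq⟩ := hγLip.extend_real
  generalize Real.toNNReal (c⁻¹ * M * L) = Kγ at hγLip'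
  refine ⟨k, s, B, a, b, γ, Kγ, Metric.closedBall x₀ R, hs, Metric.isOpen_ball, measure_ball_lt_top,
    hγLip', isCompact_closedBall _ _, fun x hx => (hR hx).1, Metric.mem_ball_self hδ'0,
    ⟨by rw [ha]; linarith, by rw [hb]; linarith⟩, fun y hy => by rw [← hγeq hy]; exact hγI y hy,
    fun x hx => hc0.trans (hR hx).2.1, fun x hxB hxI => ?_⟩
  have hy := (hδ' hxB).1
  have hxI' := Ioo_subset_Icc_self hxI
  have hIγ := Ioo_subset_Icc_self (hγI _ hxB)
  have hup : x k ≤ γ₀ (prj k x) → c * (γ₀ (prj k x) - x k) ≤ - (s * ρ x) := fun h => by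
    have := hmono _ hy _ hxI' _ hIγ h
    rwa [hγ0 _ hxB, ins_prj, mul_zero, zero_sub] at this
  have hdn : γ₀ (prj k x) ≤ x k → c * (x k - γ₀ (prj k x)) ≤ s * ρ x := fun h => by
    have := hmono _ hy _ hIγ _ hxI' h
    rwa [hγ0 _ hxB, ins_prj, mul_zero, sub_zero] at this
  have hxQ := hmemR _ hxI' _ hy
  rw [ins_prj] at hxQ
  rw [← hγeq hxB]
  have hgt : γ₀ (prj k x) < x k → 0 < s * ρ x := fun h =>
    (mul_pos hc0 (sub_pos.2 h)).trans_le (hdn h.le)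
  have hlt : x k < γ₀ (prj k x) → s * ρ x < 0 := fun h => by
    have := (mul_pos hc0 (sub_pos.2 h)).trans_le (hup h.le)
    linarith
  have heq : x k = γ₀ (prj k x) → ρ x = 0 := fun h => by
    have := hγ0 _ hxB
    rwa [← h, ins_prj] at this
  refine ⟨hxQ, ?_, ⟨fun h => ?_, heq⟩⟩
  · rcases lt_trichotomy (x k) (γ₀ (prj k x)) with h | h | h
    · have h' := hlt h
      rcases hs with rfl | rfl
      · exact ⟨fun _ => by linarith, fun _ => by linarith⟩
      · exact ⟨fun _ => by linarith, fun _ => by linarith⟩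
    · rw [heq h, h]; simp
    · have h' := hgt h
      rcases hs with rfl | rfl
      · exact ⟨fun _ => by linarith, fun _ => by linarith⟩
      · exact ⟨fun _ => by linarith, fun _ => by linarith⟩
  · by_contra hne
    rcases lt_or_gt_of_ne hne with h' | h'
    · have := hlt h'; rw [h] at this; simp at this
    · have := hgt h'; rw [h] at this; simp at this

end

end CarlemanEstimate

namespace CarlemanEstimate

noncomputable section

/-! ### The exterior normal and the flux of a field. -/

section Normal

variable {n : ℕ} {Ω : Set (Eu n)}

theorem exteriorNormal_eq (hΩ : HasSmoothBoundary Ω) {U : Set (Eu n)} {ρ : Eu n → ℝ}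
    (hρ : IsDefiningFunction Ω U ρ) {x : Eu n} (hxU : x ∈ U) (hx : x ∈ frontier Ω) :
    exteriorNormal Ω x = ‖gradient ρ x‖⁻¹ • gradient ρ x :=
  (isExteriorUnitNormal_exteriorNormal hΩ hx).unique ⟨hx, U, ρ, hxU, hρ, rfl⟩

theorem exteriorNormal_of_notMem {x : Eu n} (hx : x ∉ frontier Ω) : exteriorNormal Ω x = 0 :=
  dif_neg fun ⟨_, h⟩ => hx h.1

theorem norm_exteriorNormal (hΩ : HasSmoothBoundary Ω) {x : Eu n} (hx : x ∈ frontier Ω) :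
    ‖exteriorNormal Ω x‖ = 1 := by
  obtain ⟨U, ρ, hxU, hρ⟩ := hΩ x hx
  have : ‖gradient ρ x‖ ≠ 0 := norm_ne_zero_iff.2 (hρ.gradient_ne_zero x hxU)
  rw [exteriorNormal_eq hΩ hρ hxU hx, norm_smul, norm_inv, norm_norm, inv_mul_cancel₀ this]

theorem continuousOn_exteriorNormal (hΩ : HasSmoothBoundary Ω) :
    ContinuousOn (exteriorNormal Ω) (frontier Ω) := by
  intro x hx
  obtain ⟨U, ρ, hxU, hρ⟩ := hΩ x hx
  have hU : U ∈ 𝓝 x := hρ.isOpen.mem_nhds hxU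
  have hg : ContinuousAt (gradient ρ) x := by
    have h1 : ContinuousAt (fderiv ℝ ρ) x :=
      (hρ.contDiffOn.continuousOn_fderiv_of_isOpen hρ.isOpen (by simp)).continuousAt hU
    exact (InnerProductSpace.toDual ℝ (Eu n)).symm.continuous.continuousAt.comp h1
  have h2 : ContinuousAt (fun y => ‖gradient ρ y‖⁻¹ • gradient ρ y) x :=
    (hg.norm.inv₀ (norm_ne_zero_iff.2 (hρ.gradient_ne_zero x hxU))).smul hg
  refine h2.continuousWithinAt.congr_of_eventuallyEq ?_ (exteriorNormal_eq hΩ hρ hxU hx)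
  filter_upwards [mem_nhdsWithin_of_mem_nhds hU, self_mem_nhdsWithin] with y hy hyf
  exact exteriorNormal_eq hΩ hρ hy hyf

theorem measurable_exteriorNormal (hΩ : HasSmoothBoundary Ω) : Measurable (exteriorNormal Ω) := by
  classical
  have h : (frontier Ω).piecewise (exteriorNormal Ω) (fun _ => 0) = exteriorNormal Ω := by
    ext1 x
    by_cases hx : x ∈ frontier Ω
    · simp [hx]
    · simp [hx, exteriorNormal_of_notMem hx]
  rw [← h]
  exact (continuousOn_exteriorNormal hΩ).measurable_piecewise continuousOn_const
    isClosed_frontier.measurableSet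

/-- The component of a vector field along the exterior normal (zero away from the boundary). -/
def flux (Ω : Set (Eu n)) (F : Fin n → Eu n → ℝ) (x : Eu n) : ℝ :=
  ∑ i, F i x * exteriorNormal Ω x i

theorem measurable_flux (hΩ : HasSmoothBoundary Ω) {F : Fin n → Eu n → ℝ}
    (hF : ∀ i, Continuous (F i)) : Measurable (flux Ω F) := by
  refine Finset.measurable_sum _ fun i _ => (hF i).measurable.mul ?_
  exact (by fun_prop : Continuous fun v : Eu n => v i).measurable.comp
    (measurable_exteriorNormal hΩ)

theorem abs_flux_le (hΩ : HasSmoothBoundary Ω) (F : Fin n → Eu n → ℝ) (x : Eu n) :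
    |flux Ω F x| ≤ ∑ i, |F i x| := by
  refine (Finset.abs_sum_le_sum_abs _ _).trans (Finset.sum_le_sum fun i _ => ?_)
  rw [abs_mul]
  refine mul_le_of_le_one_right (abs_nonneg _) ?_
  by_cases hx : x ∈ frontier Ω
  · rw [← norm_exteriorNormal hΩ hx]
    exact PiLp.norm_apply_le (exteriorNormal Ω x) i
  · simp [exteriorNormal_of_notMem hx]

theorem exists_flux_bound (hΩ : HasSmoothBoundary Ω) (hc : IsCompact (frontier Ω))
    {F : Fin n → Eu n → ℝ} (hF : ∀ i, Continuous (F i)) : ∃ D, ∀ x, |flux Ω F x| ≤ D := by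
  have hcont : Continuous fun x => ∑ i, |F i x| := by fun_prop
  obtain ⟨D, hD⟩ := hc.exists_bound_of_continuousOn hcont.continuousOn
  refine ⟨max D 0, fun x => ?_⟩
  by_cases hx : x ∈ frontier Ω
  · exact (abs_flux_le hΩ F x).trans ((le_abs_self _).trans ((hD x hx).trans (le_max_left _ _)))
  · simp [flux, exteriorNormal_of_notMem hx]

end Normal

/-- Integrals over a Lipschitz graph with respect to Hausdorff measure are comparable with integrals
in the base. -/
theorem exists_graph_integral_le {m : ℕ} (k : Fin (m + 1)) {γ : (Fin m → ℝ) → ℝ} {K : NNReal}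
    (hγ : LipschitzWith K γ) {B : Set (Fin m → ℝ)} (hB : volume B < ⊤) :
    ∃ C : ℝ, 1 ≤ C ∧ (μHE[m] : Measure (Eu (m + 1))) ((fun y => ins k (γ y) y) '' B) < ⊤ ∧
      ∀ f : Eu (m + 1) → ℝ, Measurable f → (∀ x, 0 ≤ f x) → (∃ D, ∀ x, f x ≤ D) →
        IntegrableOn (fun y => f (ins k (γ y) y)) B ∧
        ∫ y in B, f (ins k (γ y) y) ≤ C * ∫ x in (fun y => ins k (γ y) y) '' B, f x ∂(μHE[m]) ∧
        ∫ x in (fun y => ins k (γ y) y) '' B, f x ∂(μHE[m]) ≤ C * ∫ y in B, f (ins k (γ y) y) := by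
  obtain ⟨C, h1, h2⟩ := exists_graph_measure_le k hγ B
  obtain ⟨K', hK'⟩ := exists_lipschitzWith_graph k hγ
  have hm : Measurable fun y => ins k (γ y) y := hK'.continuous.measurable
  set σ := (volume.restrict B).map fun y => ins k (γ y) y with hσ
  set τ := (μHE[m] : Measure (Eu (m + 1))).restrict ((fun y => ins k (γ y) y) '' B) with hτ
  have : IsFiniteMeasure (volume.restrict B) := ⟨by simpa using hB⟩
  have : IsFiniteMeasure σ := Measure.isFiniteMeasure_map _ _
  have hCσ : ((C : ENNReal) • σ) univ < ⊤ := by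
    rw [Measure.smul_apply, smul_eq_mul]
    exact ENNReal.mul_lt_top ENNReal.coe_lt_top (measure_lt_top σ univ)
  have hτfin : τ univ < ⊤ := (h2 univ).trans_lt hCσ
  have : IsFiniteMeasure τ := ⟨hτfin⟩
  refine ⟨max C 1, le_max_right _ _, by simpa [hτ] using hτfin, fun f hf hf0 ⟨D, hD⟩ => ?_⟩
  have hb : ∀ x, ‖f x‖ ≤ D := fun x => by rw [Real.norm_of_nonneg (hf0 x)]; exact hD x
  have hiσ : Integrable f σ := Integrable.of_bound hf.aestronglyMeasurable D (Eventually.of_forall hb)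
  have hiτ : Integrable f τ := Integrable.of_bound hf.aestronglyMeasurable D (Eventually.of_forall hb)
  have hmap : ∫ x, f x ∂σ = ∫ y in B, f (ins k (γ y) y) :=
    integral_map hm.aemeasurable hf.aestronglyMeasurable
  have h0σ : 0 ≤ ∫ x, f x ∂σ := integral_nonneg hf0
  have h0τ : 0 ≤ ∫ x, f x ∂τ := integral_nonneg hf0
  have hC0 : (C : ENNReal) ≠ ⊤ := ENNReal.coe_ne_top
  refine ⟨hiσ.comp_measurable hm, ?_, ?_⟩
  · rw [← hmap]
    have := integral_mono_measure h1 (Eventually.of_forall hf0) (hiτ.smul_measure hC0)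
    rw [integral_smul_measure, smul_eq_mul, ENNReal.coe_toReal] at this
    exact this.trans (mul_le_mul_of_nonneg_right (le_max_left _ _) h0τ)
  · rw [← hmap]
    have := integral_mono_measure h2 (Eventually.of_forall hf0) (hiσ.smul_measure hC0)
    rw [integral_smul_measure, smul_eq_mul, ENNReal.coe_toReal] at this
    exact this.trans (mul_le_mul_of_nonneg_right (le_max_left _ _) h0σ)

/-! ### The divergence inequality, local and global. -/

section Local

variable {m : ℕ} {Ω : Set (Eu (m + 1))}

/-- The divergence inequality on the domain `Ω` with constant `C` for the field `F`. -/
def DivergenceBound (Ω : Set (Eu (m + 1))) (C : ℝ) (F : Fin (m + 1) → Eu (m + 1) → ℝ) : Prop :=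
  ∫ x in Ω, divg F x ≤ C * ∫ x in frontier Ω, max (flux Ω F x) 0 ∂(μHE[m])
    - C⁻¹ * ∫ x in frontier Ω, max (-flux Ω F x) 0 ∂(μHE[m])

theorem DivergenceBound.mono {C C' : ℝ} {F : Fin (m + 1) → Eu (m + 1) → ℝ}
    (h : DivergenceBound Ω C F) (hC : 0 < C) (hCC' : C ≤ C') : DivergenceBound Ω C' F := by
  have h1 : 0 ≤ ∫ x in frontier Ω, max (flux Ω F x) 0 ∂(μHE[m]) :=
    integral_nonneg fun x => le_max_right _ _
  have h2 : 0 ≤ ∫ x in frontier Ω, max (-flux Ω F x) 0 ∂(μHE[m]) :=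
    integral_nonneg fun x => le_max_right _ _
  exact h.trans (sub_le_sub (mul_le_mul_of_nonneg_right hCC' h1)
    (mul_le_mul_of_nonneg_right (inv_anti₀ hC hCC') h2))

/-- Write `F = G + w eₖ` with `w = (F·∇ρ)/∂ₖρ`. The field `G` is tangential, so its divergence
integrates to zero over `Ω`, and the fundamental theorem of calculus turns `∂ₖw` into an integral of
`s w` over the graph. There `s w` is the flux of `F` times `|∇ρ|/(s ∂ₖρ)`, a factor between `1` and
a constant `Λ`, and the base measure is comparable with surface measure. -/
theorem exists_divergenceBound_near_boundary (hΩm : MeasurableSet Ω) (hΩ : HasSmoothBoundary Ω)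
    (hcf : IsCompact (frontier Ω)) {x₀ : Eu (m + 1)} (hx₀ : x₀ ∈ frontier Ω) :
    ∃ V : Set (Eu (m + 1)), IsOpen V ∧ x₀ ∈ V ∧ Bornology.IsBounded V ∧
      (μHE[m] : Measure (Eu (m + 1))) (frontier Ω ∩ V) < ⊤ ∧ ∃ C : ℝ, 1 ≤ C ∧
      ∀ F : Fin (m + 1) → Eu (m + 1) → ℝ, (∀ i, ContDiff ℝ ∞ (F i)) → (∀ i, tsupport (F i) ⊆ V) →
        DivergenceBound Ω C F := by
  obtain ⟨U, ρ, hxU, hρ⟩ := hΩ x₀ hx₀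
  obtain ⟨k, s, B, a, b, γ, K, Q, hs, hBo, hBv, hγ, hQ, hQU, hx₀B, hx₀I, hγI, hpos, hchart⟩ :=
    exists_boundary_chart hρ hx₀ hxU
  have hs2 : s * s = 1 := by rcases hs with rfl | rfl <;> norm_num
  set V : Set (Eu (m + 1)) := {x | prj k x ∈ B ∧ x k ∈ Ioo a b} with hV
  have hVQ : V ⊆ Q := fun x hx => (hchart x hx.1 hx.2).1
  have hVo : IsOpen V := (hBo.preimage (continuous_prj k)).inter
    (isOpen_Ioo.preimage (by fun_prop : Continuous fun x : Eu (m + 1) => x k))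
  have hkne : ∀ x ∈ Q, pd k ρ x ≠ 0 := fun x hx h => by
    have := hpos x hx; rw [h, mul_zero] at this; exact lt_irrefl _ this
  have hinsV : ∀ y, ins k (γ y) y ∈ V ↔ y ∈ B := fun y => by
    constructor
    · intro h; have := h.1; rwa [prj_ins] at this
    · intro h
      refine ⟨by rwa [prj_ins], ?_⟩
      rw [ins_same]; exact hγI y h
  have himage : (fun y => ins k (γ y) y) '' B = frontier Ω ∩ V := by
    ext x
    constructor
    · rintro ⟨y, hy, rfl⟩
      have hyV := (hinsV y).2 hy
      have h1 := hchart _ hyV.1 hyV.2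
      refine ⟨(hρ.mem_frontier_iff (hQU h1.1)).2 (h1.2.2.2 ?_), hyV⟩
      rw [ins_same, prj_ins]
    · rintro ⟨hxf, hxV⟩
      have h1 := hchart x hxV.1 hxV.2
      refine ⟨prj k x, hxV.1, ?_⟩
      have h2 := h1.2.2.1 ((hρ.mem_frontier_iff (hQU h1.1)).1 hxf)
      simp only [← h2, ins_prj]
  obtain ⟨C₁, hC₁, hfin, hint⟩ := exists_graph_integral_le k hγ hBv
  rw [himage] at hfin hint
  obtain ⟨Λ, hΛ⟩ : ∃ Λ, ∀ x ∈ Q, ‖gradient ρ x‖ / (s * pd k ρ x) ≤ Λ := by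
    have hc1 : ContinuousOn (gradient ρ) Q :=
      (InnerProductSpace.toDual ℝ (Eu (m + 1))).symm.continuous.comp_continuousOn
        ((hρ.contDiffOn.continuousOn_fderiv_of_isOpen hρ.isOpen (by simp)).mono hQU)
    have hc2 : ContinuousOn (pd k ρ) Q :=
      ((contDiffOn_pd hρ.isOpen k hρ.contDiffOn).continuousOn).mono hQU
    obtain ⟨Λ, hΛ⟩ := hQ.exists_bound_of_continuousOn
      (hc1.norm.div (continuousOn_const.mul hc2) fun x hx => (hpos x hx).ne')
    exact ⟨Λ, fun x hx => (le_abs_self _).trans (hΛ x hx)⟩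
  have hratio : ∀ x ∈ Q, 1 ≤ ‖gradient ρ x‖ / (s * pd k ρ x) := fun x hx => by
    rw [one_le_div (hpos x hx)]
    have h1 : |s * pd k ρ x| = |pd k ρ x| := by
      rw [abs_mul]; rcases hs with rfl | rfl <;> simp
    refine (le_abs_self _).trans (h1.le.trans ?_)
    rw [← gradient_apply]
    exact PiLp.norm_apply_le (gradient ρ x) k
  have hΛ1 : 1 ≤ Λ := (hratio x₀ (hVQ ⟨hx₀B, hx₀I⟩)).trans (hΛ x₀ (hVQ ⟨hx₀B, hx₀I⟩))
  -- The functions `ρ` and `∂ⱼρ/∂ₖρ` are smooth only near `Q`. Global replacements make `w` and `G`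
  -- globally smooth fields without changing anything on the support of `F`.
  obtain ⟨ρ', hρ', hρeq⟩ := exists_contDiff_eventuallyEq hρ.isOpen hQ hQU hρ.contDiffOn
  have hQ' : IsOpen {x | x ∈ U ∧ pd k ρ x ≠ 0} :=
    ((contDiffOn_pd hρ.isOpen k hρ.contDiffOn).continuousOn).isOpen_inter_preimage hρ.isOpen
      isOpen_ne
  have hquot : ∀ j, ∃ r : Eu (m + 1) → ℝ, ContDiff ℝ ∞ r ∧
      ∀ x ∈ Q, r =ᶠ[𝓝 x] fun y => pd j ρ y / pd k ρ y := fun j =>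
    exists_contDiff_eventuallyEq hQ' hQ (fun x hx => ⟨hQU hx, hkne x hx⟩)
      (((contDiffOn_pd hρ.isOpen j hρ.contDiffOn).mono fun x hx => hx.1).div
        ((contDiffOn_pd hρ.isOpen k hρ.contDiffOn).mono fun x hx => hx.1) fun x hx => hx.2)
  choose r hr hreq using hquot
  refine ⟨V, hVo, ⟨hx₀B, hx₀I⟩, hQ.isBounded.subset hVQ, hfin, Λ * C₁, by nlinarith,
    fun F hF hFV => ?_⟩
  set T : Set (Eu (m + 1)) := ⋃ i, tsupport (F i) with hT
  have hTV : T ⊆ V := iUnion_subset hFV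
  have hTc : IsClosed T := isClosed_iUnion_of_finite fun i => isClosed_tsupport _
  have hTK : IsCompact T := hQ.of_isClosed_subset hTc (hTV.trans hVQ)
  have hFT : ∀ i, ∀ x ∉ T, F i x = 0 := fun i x hx =>
    image_eq_zero_of_notMem_tsupport fun h => hx (mem_iUnion.2 ⟨i, h⟩)
  have hsub : ∀ f : Eu (m + 1) → ℝ, (∀ x ∉ T, f x = 0) → tsupport f ⊆ T := fun f hf =>
    closure_minimal (fun x hx => by by_contra h; exact hx (hf x h)) hTc
  have hcs : ∀ f : Eu (m + 1) → ℝ, (∀ x ∉ T, f x = 0) → HasCompactSupport f := fun f hf =>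
    hTK.of_isClosed_subset (isClosed_tsupport _) (hsub f hf)
  set w : Eu (m + 1) → ℝ := fun x => ∑ j, F j x * r j x with hw
  have hwT : ∀ x ∉ T, w x = 0 := fun x hx => Finset.sum_eq_zero fun j _ => by
    rw [hFT j x hx, zero_mul]
  have hwd : ContDiff ℝ ∞ w := ContDiff.sum fun j _ => (hF j).mul (hr j)
  set G : Fin (m + 1) → Eu (m + 1) → ℝ := fun i x => F i x - (if i = k then 1 else 0) * w x with hG
  have hGd : ∀ i, ContDiff ℝ ∞ (G i) := fun i => (hF i).sub (contDiff_const.mul hwd)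
  have hGT : ∀ i, ∀ x ∉ T, G i x = 0 := fun i x hx => by
    simp only [hG, hFT i x hx, hwT x hx, mul_zero, sub_zero]
  have hwV : ∀ x ∈ V, w x = (∑ j, F j x * pd j ρ x) / pd k ρ x := fun x hx => by
    rw [Finset.sum_div]
    refine Finset.sum_congr rfl fun j _ => ?_
    rw [(hreq j x (hVQ hx)).eq_of_nhds, mul_div_assoc]
  have hGzero : ∫ x in Ω, divg G x = 0 := by
    refine setIntegral_divg_eq_zero_of_tangential (V := V) hΩm hρ' hGd (fun i => hcs _ (hGT i))
      (fun i => (hsub _ (hGT i)).trans hTV) (fun x hx => ?_) fun x hx => ?_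
    · rw [(hρeq x (hVQ hx)).eq_of_nhds]
      exact hρ.mem_iff x (hQU (hVQ hx))
    · have h1 : ∀ i, pd i ρ' x = pd i ρ x := fun i => pd_congr i (hρeq x (hVQ hx))
      have h2 : ∑ i, pd i ρ x * ((if i = k then 1 else 0) * w x) = pd k ρ x * w x := by
        simp
      simp_rw [h1, hG, mul_sub, Finset.sum_sub_distrib]
      rw [h2, hwV x hx, mul_div_cancel₀ _ (hkne x (hVQ hx)), sub_eq_zero]
      exact Finset.sum_congr rfl fun j _ => mul_comm _ _
  have hdivG : ∀ x, divg G x = divg F x - pd k w x := fun x => by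
    have h1 : ∀ i, pd i (G i) x = pd i (F i) x - (if i = k then 1 else 0) * pd i w x := fun i => by
      rw [← pd_const_mul i _ (smooth_differentiableAt hwd x)]
      exact pd_sub i (smooth_differentiableAt (hF i) x)
        ((smooth_differentiableAt hwd x).const_mul _)
    simp_rw [divg, h1, Finset.sum_sub_distrib]
    simp
  have hintF : Integrable (divg F) := integrable_finsetSum _ fun i _ =>
    (contDiff_pd i (hF i)).continuous.integrable_of_hasCompactSupport
      (hasCompactSupport_pd i (hcs _ (hFT i)))
  have hintw : Integrable (pd k w) :=
    (contDiff_pd k hwd).continuous.integrable_of_hasCompactSupport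
      (hasCompactSupport_pd k (hcs _ hwT))
  have hmain : ∫ x in Ω, divg F x = s * ∫ y, w (ins k (γ y) y) := by
    simp_rw [hdivG] at hGzero
    rw [integral_sub hintF.integrableOn hintw.integrableOn, sub_eq_zero] at hGzero
    rw [hGzero]
    refine setIntegral_pd_eq_integral_graph k hs hΩm (V := V) (fun x hx => ?_) hwd (hcs _ hwT)
      ((hsub _ hwT).trans hTV)
    rw [hρ.mem_iff x (hQU (hVQ hx))]
    exact (hchart x hx.1 hx.2).2.1
  have hB : ∫ y, w (ins k (γ y) y) = ∫ y in B, w (ins k (γ y) y) := by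
    refine (setIntegral_eq_integral_of_forall_compl_eq_zero fun y hy => ?_).symm
    exact hwT _ fun h => hy ((hinsV y).1 (hTV h))
  have hmeas := measurable_flux hΩ fun i => (hF i).continuous
  obtain ⟨D, hD⟩ := exists_flux_bound hΩ hcf fun i => (hF i).continuous
  have hD0 : 0 ≤ D := (abs_nonneg _).trans (hD x₀)
  obtain ⟨hp1, hp2, -⟩ := hint (fun x => max (flux Ω F x) 0) (hmeas.max measurable_const)
    (fun x => le_max_right _ _) ⟨D, fun x => max_le ((le_abs_self _).trans (hD x)) hD0⟩
  obtain ⟨hn1, -, hn3⟩ := hint (fun x => max (-flux Ω F x) 0) (hmeas.neg.max measurable_const)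
    (fun x => le_max_right _ _) ⟨D, fun x => max_le ((neg_le_abs _).trans (hD x)) hD0⟩
  have hpt : ∀ y ∈ B, s * w (ins k (γ y) y)
      ≤ Λ * max (flux Ω F (ins k (γ y) y)) 0 - max (-flux Ω F (ins k (γ y) y)) 0 := by
    intro y hy
    have hyV := (hinsV y).2 hy
    have hyf : ins k (γ y) y ∈ frontier Ω := by
      have : ins k (γ y) y ∈ frontier Ω ∩ V := himage ▸ ⟨y, hy, rfl⟩
      exact this.1
    set x := ins k (γ y) y
    have hxQ := hVQ hyV
    have hne : ‖gradient ρ x‖ ≠ 0 := norm_ne_zero_iff.2 (hρ.gradient_ne_zero x (hQU hxQ))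
    have hfl : flux Ω F x = ‖gradient ρ x‖⁻¹ * ∑ j, F j x * pd j ρ x := by
      rw [flux, exteriorNormal_eq hΩ hρ (hQU hxQ) hyf, Finset.mul_sum]
      refine Finset.sum_congr rfl fun j _ => ?_
      rw [PiLp.smul_apply, gradient_apply, smul_eq_mul]; ring
    have hsw : s * w x = ‖gradient ρ x‖ / (s * pd k ρ x) * flux Ω F x := by
      rw [hwV x hyV, hfl]
      have := hkne x hxQ
      have hs0 : s ≠ 0 := by rintro rfl; simp at hs2
      field_simp
      linear_combination hs2 * (∑ j, F j x * pd j ρ x)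
    rw [hsw]
    have h1 := hratio x hxQ
    have h2 := hΛ x hxQ
    rcases le_total 0 (flux Ω F x) with h | h
    · rw [max_eq_left h, max_eq_right (by linarith), sub_zero]
      exact mul_le_mul_of_nonneg_right h2 h
    · rw [max_eq_right h, max_eq_left (by linarith), mul_zero, zero_sub, neg_neg]
      nlinarith
  have hwint : IntegrableOn (fun y => s * w (ins k (γ y) y)) B := by
    have hcw : Continuous fun y => ins k (γ y) y :=
      (continuous_ins k).comp (hγ.continuous.prodMk continuous_id)
    obtain ⟨D', hD'⟩ := (hcs w hwT).exists_bound_of_continuous hwd.continuous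
    have : IsFiniteMeasure (volume.restrict B) := ⟨by simpa using hBv⟩
    exact (Integrable.of_bound (hwd.continuous.comp hcw).aestronglyMeasurable D'
      (Eventually.of_forall fun y => hD' _)).const_mul s
  have hle : ∫ x in Ω, divg F x ≤ Λ * (∫ y in B, max (flux Ω F (ins k (γ y) y)) 0)
      - ∫ y in B, max (-flux Ω F (ins k (γ y) y)) 0 := by
    rw [hmain, hB, ← integral_const_mul, ← integral_const_mul,
      ← integral_sub (hp1.const_mul Λ) hn1]
    exact setIntegral_mono_on hwint ((hp1.const_mul Λ).sub hn1) hBo.measurableSet hpt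
  have hrestr : ∀ f : Eu (m + 1) → ℝ, (∀ x ∉ T, f x = 0) →
      ∫ x in frontier Ω ∩ V, f x ∂(μHE[m]) = ∫ x in frontier Ω, f x ∂(μHE[m]) := fun f hf =>
    (setIntegral_eq_of_subset_of_forall_sdiff_eq_zero isClosed_frontier.measurableSet
      inter_subset_left fun x hx => hf x fun h => hx.2 ⟨hx.1, hTV h⟩).symm
  have hflT : ∀ x ∉ T, flux Ω F x = 0 := fun x hx => Finset.sum_eq_zero fun i _ => by
    rw [hFT i x hx, zero_mul]
  rw [hrestr _ fun x hx => by rw [hflT x hx]; simp] at hp2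
  rw [hrestr _ fun x hx => by rw [hflT x hx]; simp] at hn3
  have hN0 : 0 ≤ ∫ x in frontier Ω, max (-flux Ω F x) 0 ∂(μHE[m]) :=
    integral_nonneg fun x => le_max_right _ _
  unfold DivergenceBound
  refine hle.trans (sub_le_sub ?_ ?_)
  · rw [mul_assoc]
    exact mul_le_mul_of_nonneg_left hp2 (by linarith)
  · rw [mul_inv, mul_assoc, inv_mul_le_iff₀ (by linarith), inv_mul_le_iff₀ (by linarith)]
    refine hn3.trans (mul_le_mul_of_nonneg_left ?_ (by linarith))
    exact le_mul_of_one_le_left (integral_nonneg fun y => le_max_right _ _) hΛ1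

/-- Both sides are zero, since the field does not reach the boundary. -/
theorem divergenceBound_of_tsupport_subset (hΩo : IsOpen Ω) (hb : Bornology.IsBounded Ω)
    {F : Fin (m + 1) → Eu (m + 1) → ℝ} (hF : ∀ i, ContDiff ℝ ∞ (F i))
    (hs : ∀ i, tsupport (F i) ⊆ Ω) : DivergenceBound Ω 1 F := by
  have hc : ∀ i, HasCompactSupport (F i) := fun i =>
    Metric.isCompact_of_isClosed_isBounded (isClosed_tsupport _) (hb.subset (hs i))
  have h1 : ∫ x in Ω, divg F x = 0 := by
    rw [setIntegral_eq_integral_of_forall_compl_eq_zero fun x hx => ?_]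
    · exact integral_divg_eq_zero hF hc
    · exact Finset.sum_eq_zero fun i _ =>
        image_eq_zero_of_notMem_tsupport fun h => hx (hs i (tsupport_pd_subset i _ h))
  have h2 : ∀ x ∈ frontier Ω, flux Ω F x = 0 := fun x hx => Finset.sum_eq_zero fun i _ => by
    have : x ∉ Ω := by rw [hΩo.frontier_eq] at hx; exact hx.2
    rw [image_eq_zero_of_notMem_tsupport fun h => this (hs i h), zero_mul]
  have hm := (isClosed_frontier (s := Ω)).measurableSet
  have h3 : ∫ x in frontier Ω, max (flux Ω F x) 0 ∂(μHE[m]) = 0 :=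
    setIntegral_eq_zero_of_forall_eq_zero fun x hx => by rw [h2 x hx]; simp
  have h4 : ∫ x in frontier Ω, max (-flux Ω F x) 0 ∂(μHE[m]) = 0 :=
    setIntegral_eq_zero_of_forall_eq_zero fun x hx => by rw [h2 x hx]; simp
  rw [DivergenceBound, h1, h3, h4]; simp

/-- A smooth bounded domain has a boundary of finite surface measure, and the integral of a divergence
is bounded from above by the weighted outflow minus the weighted inflow through the boundary. -/
theorem exists_divergenceBound (hΩo : IsOpen Ω) (hΩc : IsCompact (closure Ω))
    (hΩ : HasSmoothBoundary Ω) :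
    (μHE[m] : Measure (Eu (m + 1))) (frontier Ω) < ⊤ ∧ ∃ C : ℝ, 1 ≤ C ∧
      ∀ F : Fin (m + 1) → Eu (m + 1) → ℝ, (∀ i, ContDiff ℝ ∞ (F i)) → DivergenceBound Ω C F := by
  have hcf : IsCompact (frontier Ω) := hΩc.of_isClosed_subset isClosed_frontier frontier_subset_closure
  have hloc : ∀ x ∈ closure Ω, ∃ V : Set (Eu (m + 1)), IsOpen V ∧ x ∈ V ∧ Bornology.IsBounded V ∧
      (μHE[m] : Measure (Eu (m + 1))) (frontier Ω ∩ V) < ⊤ ∧ ∃ C : ℝ, 1 ≤ C ∧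
      ∀ F : Fin (m + 1) → Eu (m + 1) → ℝ, (∀ i, ContDiff ℝ ∞ (F i)) → (∀ i, tsupport (F i) ⊆ V) →
        DivergenceBound Ω C F := by
    intro x hx
    by_cases hxΩ : x ∈ Ω
    · have hb : Bornology.IsBounded Ω := hΩc.isBounded.subset subset_closure
      refine ⟨Ω, hΩo, hxΩ, hb, ?_, 1, le_rfl, fun F hF hs =>
        divergenceBound_of_tsupport_subset hΩo hb hF hs⟩
      rw [hΩo.frontier_eq, sdiff_inter_self]; simp
    · exact exists_divergenceBound_near_boundary hΩo.measurableSet hΩ hcf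
        (by rw [hΩo.frontier_eq]; exact ⟨hx, hxΩ⟩)
  choose! V hVo hVx hVb hVfin C hC1 hVC using hloc
  obtain ⟨t, ht, hcover⟩ := hΩc.elim_nhds_subcover V fun x hx => (hVo x hx).mem_nhds (hVx x hx)
  have hcover' : closure Ω ⊆ ⋃ i : t, V i := fun x hx => by
    obtain ⟨i, hi, hxi⟩ := mem_iUnion₂.1 (hcover hx)
    exact mem_iUnion.2 ⟨⟨i, hi⟩, hxi⟩
  have hfin : (μHE[m] : Measure (Eu (m + 1))) (frontier Ω) < ⊤ := by
    have : frontier Ω ⊆ ⋃ i ∈ t, frontier Ω ∩ V i := fun x hx => by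
      obtain ⟨i, hi, hxi⟩ := mem_iUnion₂.1 (hcover (frontier_subset_closure hx))
      exact mem_iUnion₂.2 ⟨i, hi, hx, hxi⟩
    exact (measure_mono this).trans_lt
      (measure_biUnion_lt_top t.finite_toSet fun i hi => hVfin i (ht i hi))
  -- The summand `1` keeps the constant at least `1` even for an empty cover.
  refine ⟨hfin, 1 + ∑ i : t, C i, ?_, fun F hF => ?_⟩
  · have : 0 ≤ ∑ i : t, C i := Finset.sum_nonneg fun i _ => by linarith [hC1 i (ht i i.2)]
    linarith
  obtain ⟨χ, hχ⟩ := SmoothPartitionOfUnity.exists_isSubordinate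
    (modelWithCornersSelf ℝ (Eu (m + 1))) isClosed_closure (fun i : t => V i)
    (fun i => hVo i (ht i i.2)) hcover'
  have hχd : ∀ i, ContDiff ℝ ∞ (χ i) := fun i => (χ i).contMDiff.contDiff
  have hχsum : ∀ x ∈ closure Ω, ∑ i, χ i x = 1 := fun x hx => by
    rw [← finsum_eq_sum_of_fintype]; exact χ.sum_eq_one hx
  set Fi : t → Fin (m + 1) → Eu (m + 1) → ℝ := fun i j x => χ i x * F j x with hFi
  have hFid : ∀ i j, ContDiff ℝ ∞ (Fi i j) := fun i j => (hχd i).mul (hF j)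
  have hsubs : ∀ i j, tsupport (Fi i j) ⊆ tsupport (χ i) := fun i j =>
    tsupport_mul_subset_left (f := fun x => χ i x) (g := F j)
  have hbd : ∀ i, DivergenceBound Ω (1 + ∑ i : t, C i) (Fi i) := fun i => by
    have h1 := hC1 i (ht i i.2)
    refine (hVC i (ht i i.2) (Fi i) (hFid i) fun j => (hsubs i j).trans (hχ i)).mono
      (by linarith) ?_
    have : C i ≤ ∑ i : t, C i := Finset.single_le_sum (f := fun i : t => C i)
      (fun j _ => by linarith [hC1 j (ht j j.2)]) (Finset.mem_univ i)
    linarith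
  have hdiv : ∀ x ∈ Ω, divg F x = ∑ i, divg (Fi i) x := by
    intro x hx
    simp only [divg]
    rw [Finset.sum_comm]
    refine Finset.sum_congr rfl fun j _ => ?_
    rw [← pd_sum j Finset.univ fun i _ => smooth_differentiableAt (hFid i j) x]
    refine pd_congr j ?_
    filter_upwards [hΩo.mem_nhds hx] with y hy
    simp only [hFi]
    rw [← Finset.sum_mul, hχsum y (subset_closure hy), one_mul]
  have hintdiv : ∀ i, IntegrableOn (divg (Fi i)) Ω := fun i =>
    ((contDiff_divg (hFid i)).continuous.continuousOn.integrableOn_compact hΩc).mono_set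
      subset_closure
  have hflux : ∀ i x, flux Ω (Fi i) x = χ i x * flux Ω F x := fun i x => by
    simp only [flux, hFi, Finset.mul_sum, mul_assoc]
  have : IsFiniteMeasure ((μHE[m] : Measure (Eu (m + 1))).restrict (frontier Ω)) :=
    ⟨by simpa using hfin⟩
  have hintb : ∀ (G : Fin (m + 1) → Eu (m + 1) → ℝ), (∀ j, ContDiff ℝ ∞ (G j)) → ∀ c : ℝ,
      IntegrableOn (fun x => max (c * flux Ω G x) 0) (frontier Ω) (μHE[m]) := by
    intro G hG c
    obtain ⟨D, hD⟩ := exists_flux_bound hΩ hcf fun i => (hG i).continuous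
    refine Integrable.of_bound (((measurable_flux hΩ fun i => (hG i).continuous).const_mul c).max
      measurable_const).aestronglyMeasurable (|c| * D) (Eventually.of_forall fun x => ?_)
    rw [Real.norm_of_nonneg (le_max_right _ _)]
    have h1 : |c * flux Ω G x| ≤ |c| * D := by
      rw [abs_mul]; exact mul_le_mul_of_nonneg_left (hD x) (abs_nonneg c)
    exact max_le ((le_abs_self _).trans h1) ((abs_nonneg _).trans h1)
  -- Since `χ i ≥ 0`, multiplication by `χ i` commutes with taking positive parts; hence outflow and
  -- inflow are each additive over the partition, and the local inequalities can be summed.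
  have hsum : ∀ c : ℝ, ∫ x in frontier Ω, max (c * flux Ω F x) 0 ∂(μHE[m])
      = ∑ i, ∫ x in frontier Ω, max (c * flux Ω (Fi i) x) 0 ∂(μHE[m]) := by
    intro c
    rw [← integral_finsetSum _ fun i _ => hintb (Fi i) (hFid i) c]
    refine setIntegral_congr_fun isClosed_frontier.measurableSet fun x hx => ?_
    have h1 : ∀ i, max (c * flux Ω (Fi i) x) 0 = χ i x * max (c * flux Ω F x) 0 := fun i => by
      rw [hflux, mul_max_of_nonneg _ _ (χ.nonneg i x), mul_zero]; congr 1; ring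
    simp only [h1]
    rw [← Finset.sum_mul, hχsum x (frontier_subset_closure hx), one_mul]
  have hs1 := hsum 1
  have hs2 := hsum (-1)
  simp only [one_mul, neg_one_mul] at hs1 hs2
  unfold DivergenceBound
  rw [setIntegral_congr_fun hΩo.measurableSet hdiv, integral_finsetSum _ fun i _ => hintdiv i,
    hs1, hs2, Finset.mul_sum, Finset.mul_sum, ← Finset.sum_sub_distrib]
  exact Finset.sum_le_sum fun i _ => hbd i

end Local

end

end CarlemanEstimate

namespace CarlemanEstimate

noncomputable section

/-! ### Scalar products of gradients, Hessians and product rules. -/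

section GradientCalculus

variable {n : ℕ}

/-- The scalar product `∇f · ∇g`. -/
def gdot (f g : Eu n → ℝ) (x : Eu n) : ℝ := ∑ i, pd i f x * pd i g x

/-- The Laplacian in coordinates. -/
def lapl (f : Eu n → ℝ) (x : Eu n) : ℝ := ∑ i, pd i (pd i f) x

/-- The Hessian of `f`, applied to the gradients of `g` and `k`. -/
def hess (f g k : Eu n → ℝ) (x : Eu n) : ℝ := ∑ i, ∑ j, pd i (pd j f) x * pd i g x * pd j k x

/-- The vector field `f ∇g`. -/
def smulGrad (f g : Eu n → ℝ) (i : Fin n) (x : Eu n) : ℝ := f x * pd i g x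

variable {f g k : Eu n → ℝ}

theorem contDiff_gdot (hf : ContDiff ℝ ∞ f) (hg : ContDiff ℝ ∞ g) : ContDiff ℝ ∞ (gdot f g) :=
  ContDiff.sum fun i _ => (contDiff_pd i hf).mul (contDiff_pd i hg)

theorem contDiff_lapl (hf : ContDiff ℝ ∞ f) : ContDiff ℝ ∞ (lapl f) :=
  ContDiff.sum fun i _ => contDiff_pd i (contDiff_pd i hf)

theorem contDiff_smulGrad (hf : ContDiff ℝ ∞ f) (hg : ContDiff ℝ ∞ g) (i : Fin n) :
    ContDiff ℝ ∞ (smulGrad f g i) := hf.mul (contDiff_pd i hg)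

theorem gdot_comm (f g : Eu n → ℝ) (x : Eu n) : gdot f g x = gdot g f x :=
  Finset.sum_congr rfl fun _ _ => mul_comm _ _

theorem gdot_self_nonneg (f : Eu n → ℝ) (x : Eu n) : 0 ≤ gdot f f x :=
  Finset.sum_nonneg fun _ _ => mul_self_nonneg _

theorem abs_gdot_le (f g : Eu n → ℝ) (x : Eu n) :
    |gdot f g x| ≤ Real.sqrt (gdot f f x) * Real.sqrt (gdot g g x) := by
  rw [← Real.sqrt_mul (gdot_self_nonneg f x)]
  refine Real.abs_le_sqrt ?_
  simp only [gdot, ← pow_two]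
  exact Finset.sum_mul_sq_le_sq_mul_sq _ _ _

theorem gdot_mul_left (hf : ContDiff ℝ ∞ f) (hg : ContDiff ℝ ∞ g) (x : Eu n) :
    gdot (fun y => f y * g y) k x = f x * gdot g k x + g x * gdot f k x := by
  simp only [gdot, Finset.mul_sum, ← Finset.sum_add_distrib]
  refine Finset.sum_congr rfl fun i _ => ?_
  rw [pd_mul i (smooth_differentiableAt hf x) (smooth_differentiableAt hg x)]; ring

theorem gdot_add_left (hf : ContDiff ℝ ∞ f) (hg : ContDiff ℝ ∞ g) (x : Eu n) :
    gdot (fun y => f y + g y) k x = gdot f k x + gdot g k x := by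
  simp only [gdot, ← Finset.sum_add_distrib]
  refine Finset.sum_congr rfl fun i _ => ?_
  rw [pd_add i (smooth_differentiableAt hf x) (smooth_differentiableAt hg x)]; ring

theorem gdot_const_mul_left (c : ℝ) (hf : ContDiff ℝ ∞ f) (x : Eu n) :
    gdot (fun y => c * f y) k x = c * gdot f k x := by
  simp only [gdot, Finset.mul_sum]
  refine Finset.sum_congr rfl fun i _ => ?_
  rw [pd_const_mul i c (smooth_differentiableAt hf x)]; ring

theorem pd_gdot (hf : ContDiff ℝ ∞ f) (hg : ContDiff ℝ ∞ g) (i : Fin n) (x : Eu n) :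
    pd i (gdot f g) x = ∑ j, (pd i (pd j f) x * pd j g x + pd j f x * pd i (pd j g) x) := by
  have h : gdot f g = fun y => ∑ j, pd j f y * pd j g y := rfl
  rw [h, pd_sum i Finset.univ fun j _ =>
    smooth_differentiableAt ((contDiff_pd j hf).mul (contDiff_pd j hg)) x]
  exact Finset.sum_congr rfl fun j _ => pd_mul i (smooth_differentiableAt (contDiff_pd j hf) x)
    (smooth_differentiableAt (contDiff_pd j hg) x)

/-- The case `f = g = k` identifies `∇|∇f|²·∇f` with twice the Hessian of `f` on its own gradient.
-/
theorem gdot_gdot (hf : ContDiff ℝ ∞ f) (hg : ContDiff ℝ ∞ g) (x : Eu n) :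
    gdot (gdot f g) k x = hess f k g x + hess g k f x := by
  simp only [hess, ← Finset.sum_add_distrib]
  unfold gdot
  refine Finset.sum_congr rfl fun i _ => ?_
  have := pd_gdot hf hg i x
  unfold gdot at this
  rw [this, Finset.sum_mul]
  exact Finset.sum_congr rfl fun j _ => by ring

theorem hess_comm (hf : ContDiff ℝ ∞ f) (g k : Eu n → ℝ) (x : Eu n) :
    hess f g k x = hess f k g x := by
  unfold hess
  rw [Finset.sum_comm]
  refine Finset.sum_congr rfl fun i _ => Finset.sum_congr rfl fun j _ => ?_
  rw [pd_comm (contDiff_infty.1 hf 2).contDiffAt i j]; ring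

theorem divg_smulGrad (hf : ContDiff ℝ ∞ f) (hg : ContDiff ℝ ∞ g) (x : Eu n) :
    divg (smulGrad f g) x = gdot f g x + f x * lapl g x := by
  simp only [divg, gdot, lapl, Finset.mul_sum, ← Finset.sum_add_distrib]
  exact Finset.sum_congr rfl fun i _ => pd_mul i (smooth_differentiableAt hf x)
    (smooth_differentiableAt (contDiff_pd i hg) x)

theorem divg_add {F G : Fin n → Eu n → ℝ} (hF : ∀ i, ContDiff ℝ ∞ (F i))
    (hG : ∀ i, ContDiff ℝ ∞ (G i)) (x : Eu n) :
    divg (fun i y => F i y + G i y) x = divg F x + divg G x := by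
  simp only [divg, ← Finset.sum_add_distrib]
  exact Finset.sum_congr rfl fun i _ => pd_add i (smooth_differentiableAt (hF i) x)
    (smooth_differentiableAt (hG i) x)

end GradientCalculus

/-! ### The convexified weight. -/

section Convexified

variable {n : ℕ} {φ : Eu n → ℝ}

/-- The convexified weight `φ + κ φ² / 2`. -/
def convexify (κ : ℝ) (φ : Eu n → ℝ) (x : Eu n) : ℝ := φ x + κ / 2 * φ x ^ 2

theorem contDiff_convexify (κ : ℝ) (hφ : ContDiff ℝ ∞ φ) : ContDiff ℝ ∞ (convexify κ φ) :=
  hφ.add (contDiff_const.mul (hφ.pow 2))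

theorem pd_convexify (κ : ℝ) (hφ : ContDiff ℝ ∞ φ) (i : Fin n) (x : Eu n) :
    pd i (convexify κ φ) x = (1 + κ * φ x) * pd i φ x := by
  have hd := smooth_differentiableAt hφ x
  have h : convexify κ φ = fun y => φ y + κ / 2 * φ y ^ 2 := rfl
  rw [h, pd_add i hd ((hd.fun_pow 2).const_mul _), pd_const_mul i _ (hd.fun_pow 2), pd_sq i hd]
  ring

theorem pd_pd_convexify (κ : ℝ) (hφ : ContDiff ℝ ∞ φ) (i j : Fin n) (x : Eu n) :
    pd i (pd j (convexify κ φ)) x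
      = (1 + κ * φ x) * pd i (pd j φ) x + κ * (pd i φ x * pd j φ x) := by
  have hd := smooth_differentiableAt hφ x
  rw [funext (pd_convexify κ hφ j), pd_mul i ((hd.const_mul κ).const_add 1)
    (smooth_differentiableAt (contDiff_pd j hφ) x), pd_add i (differentiableAt_const _)
    (hd.const_mul κ), pd_const, pd_const_mul i κ hd]
  ring

theorem gdot_convexify (κ : ℝ) (hφ : ContDiff ℝ ∞ φ) (v : Eu n → ℝ) (x : Eu n) :
    gdot (convexify κ φ) v x = (1 + κ * φ x) * gdot φ v x := by
  simp only [gdot, pd_convexify κ hφ, Finset.mul_sum, mul_assoc]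

theorem gdot_convexify_self (κ : ℝ) (hφ : ContDiff ℝ ∞ φ) (x : Eu n) :
    gdot (convexify κ φ) (convexify κ φ) x = (1 + κ * φ x) ^ 2 * gdot φ φ x := by
  rw [gdot_convexify κ hφ, gdot_comm, gdot_convexify κ hφ]; ring

theorem lapl_convexify (κ : ℝ) (hφ : ContDiff ℝ ∞ φ) (x : Eu n) :
    lapl (convexify κ φ) x = lapl φ x + κ * (φ x * lapl φ x + gdot φ φ x) := by
  simp only [lapl, pd_pd_convexify κ hφ, Finset.sum_add_distrib, ← Finset.mul_sum, gdot]
  ring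

theorem hess_convexify (κ : ℝ) (hφ : ContDiff ℝ ∞ φ) (v w : Eu n → ℝ) (x : Eu n) :
    hess (convexify κ φ) v w x
      = (1 + κ * φ x) * hess φ v w x + κ * (gdot φ v x * gdot φ w x) := by
  simp only [hess, gdot, Finset.sum_mul_sum]
  simp only [Finset.mul_sum, ← Finset.sum_add_distrib]
  refine Finset.sum_congr rfl fun i _ => Finset.sum_congr rfl fun j _ => ?_
  rw [pd_pd_convexify κ hφ]; ring

/-- The term `κ * gdot φ φ x ^ 2` is the gain from convexification: it has a sign, whatever the sign
of the Hessian of `φ`. -/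
theorem hess_convexify_self (κ : ℝ) (hφ : ContDiff ℝ ∞ φ) (x : Eu n) :
    hess (convexify κ φ) (convexify κ φ) (convexify κ φ) x
      = (1 + κ * φ x) ^ 2 * ((1 + κ * φ x) * hess φ φ φ x + κ * gdot φ φ x ^ 2) := by
  rw [hess_convexify κ hφ, gdot_comm, gdot_convexify κ hφ]
  have : hess φ (convexify κ φ) (convexify κ φ) x = (1 + κ * φ x) ^ 2 * hess φ φ φ x := by
    simp only [hess, pd_convexify κ hφ, Finset.mul_sum]
    exact Finset.sum_congr rfl fun i _ => Finset.sum_congr rfl fun j _ => by ring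
  rw [this]; ring

end Convexified

/-! ### The pointwise commutator identity and inequality. -/

section Pointwise

variable {n : ℕ}

/-- The conjugated operator `e^{ψ/h} (-h²Δ) e^{-ψ/h}`. -/
def conjOp (ψ : Eu n → ℝ) (h : ℝ) (v : Eu n → ℝ) (x : Eu n) : ℝ :=
  (-h ^ 2 * lapl v x - gdot ψ ψ x * v x) + (2 * h * gdot ψ v x + h * lapl ψ x * v x)

/-- The vector field whose divergence appears in the Carleman estimate, with multiplier `m` and weight
`ψ`. -/
def carlemanField (ψ m : Eu n → ℝ) (h t : ℝ) (v : Eu n → ℝ) (i : Fin n) (x : Eu n) : ℝ :=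
  smulGrad (fun x => (-4 * h ^ 3) * gdot ψ v x
    + (v x * ((-2 * h ^ 3) * lapl ψ x + ((-4 * h ^ 3) * m x + -(t * h ^ 2))))) v i x
  + smulGrad (fun x => (2 * h ^ 3) * gdot v v x + (-2 * h) * (gdot ψ ψ x * (v x * v x))) ψ i x

theorem contDiff_carlemanField {ψ m v : Eu n → ℝ} (hψ : ContDiff ℝ ∞ ψ) (hm : ContDiff ℝ ∞ m)
    (hv : ContDiff ℝ ∞ v) (h t : ℝ) (i : Fin n) :
    ContDiff ℝ ∞ (carlemanField ψ m h t v i) := by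
  have h1 := contDiff_gdot hψ hv
  have h2 := contDiff_lapl hψ
  have h3 := contDiff_gdot hv hv
  have h4 := contDiff_gdot hψ hψ
  exact (contDiff_smulGrad (by fun_prop) hv i).add (contDiff_smulGrad (by fun_prop) hψ i)

/-- The product rule; the Hessians of `v` cancel, since `∇(∇ψ·∇v)·∇v` has one and `∇|∇v|²·∇ψ` has
two, with coefficients `-4h³` and `2h³`. Without `m` and `t` this writes the cross term of `conjOp`
squared as a divergence plus commutator terms. The divergences of `m v∇v` and `v∇v` are added so
that `|h∇v|²` can be traded for `v` times the symmetric part of `conjOp`. -/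
theorem divg_carlemanField {ψ m v : Eu n → ℝ} (hψ : ContDiff ℝ ∞ ψ) (hm : ContDiff ℝ ∞ m)
    (hv : ContDiff ℝ ∞ v) (h t : ℝ) (x : Eu n) :
    divg (carlemanField ψ m h t v) x
      = 2 * (-h ^ 2 * lapl v x - gdot ψ ψ x * v x) * (2 * h * gdot ψ v x + h * lapl ψ x * v x)
        - 4 * h ^ 3 * hess ψ v v x - 4 * h * hess ψ ψ ψ x * v x ^ 2
        - 2 * h ^ 3 * v x * gdot (lapl ψ) v x
        - 4 * h ^ 3 * (v x * gdot m v x + m x * gdot v v x + m x * v x * lapl v x)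
        - t * h ^ 2 * (gdot v v x + v x * lapl v x) := by
  have h1 := contDiff_gdot hψ hv
  have h2 := contDiff_lapl hψ
  have h3 := contDiff_gdot hv hv
  have h4 := contDiff_gdot hψ hψ
  have hc1 : ContDiff ℝ ∞ fun x => (-4 * h ^ 3) * m x + -(t * h ^ 2) := by fun_prop
  have hc2 : ContDiff ℝ ∞ fun x =>
    (-2 * h ^ 3) * lapl ψ x + ((-4 * h ^ 3) * m x + -(t * h ^ 2)) := by fun_prop
  have hc3 : ContDiff ℝ ∞ fun x => (-4 * h ^ 3) * gdot ψ v x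
    + (v x * ((-2 * h ^ 3) * lapl ψ x + ((-4 * h ^ 3) * m x + -(t * h ^ 2)))) := by fun_prop
  have hc4 : ContDiff ℝ ∞ fun x => gdot ψ ψ x * (v x * v x) := by fun_prop
  have hc5 : ContDiff ℝ ∞ fun x =>
    (2 * h ^ 3) * gdot v v x + (-2 * h) * (gdot ψ ψ x * (v x * v x)) := by fun_prop
  have hF : carlemanField ψ m h t v = fun i x => smulGrad _ v i x + smulGrad _ ψ i x := rfl
  have hgc : gdot (fun _ => -(t * h ^ 2)) v x = 0 := by simp [gdot, pd_const]
  rw [hF, divg_add (contDiff_smulGrad hc3 hv) (contDiff_smulGrad hc5 hψ),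
    divg_smulGrad hc3 hv, divg_smulGrad hc5 hψ,
    gdot_add_left (contDiff_const.mul h1) (hv.mul hc2), gdot_mul_left hv hc2,
    gdot_add_left (contDiff_const.mul h2) hc1,
    gdot_add_left (contDiff_const.mul hm) contDiff_const, hgc,
    gdot_const_mul_left _ h1, gdot_const_mul_left _ h2, gdot_const_mul_left _ hm,
    gdot_add_left (contDiff_const.mul h3) (contDiff_const.mul hc4),
    gdot_const_mul_left _ h3, gdot_const_mul_left _ hc4, gdot_mul_left h4 (hv.mul hv),
    gdot_mul_left hv hv, gdot_gdot hψ hv, gdot_gdot hv hv, gdot_gdot hψ hψ,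
    hess_comm hv ψ v, gdot_comm v ψ]
  ring

/-- Here `e` is the remainder `φ''(∇v,∇v) + m|∇v|²`, which contains the factor `d = ∇φ·∇v`, and `P =
h|∇v|`. The first order part `B` determines `d` up to a multiple of `V`, so half of `B ^ 2` absorbs
the term at a cost of order `h²`. -/
theorem neg_cross_term_le {h L f d lψ V B e P : ℝ} (hh : 0 < h) (hf0 : 0 ≤ f) (hL : 0 ≤ L)
    (hlψ : |lψ| ≤ L) (hP : 0 ≤ P) (hB : B = 2 * h * (f * d) + h * lψ * V)
    (he : h * |e| ≤ L * |d| * P) (hVP : 2 * (|V| * P) ≤ V ^ 2 + P ^ 2) :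
    -(4 * h ^ 3 * f * e) ≤ 1 / 2 * B ^ 2 + h ^ 2 * (L ^ 2 * (3 * P ^ 2 + V ^ 2)) := by
  have h1 : |2 * h * (f * d)| ≤ |B| + h * L * |V| := by
    have : 2 * h * (f * d) = B - h * lψ * V := by rw [hB]; ring
    rw [this]
    refine (abs_sub _ _).trans (add_le_add_right ?_ _)
    rw [abs_mul, abs_mul, abs_of_pos hh]
    gcongr
  have h2 : |2 * h * (f * d)| = 2 * h * f * |d| := by
    rw [abs_mul, abs_mul, abs_mul, abs_of_pos hh, abs_of_nonneg hf0]; norm_num; ring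
  have h3 : -(4 * h ^ 3 * f * e) ≤ 4 * h ^ 2 * f * (h * |e|) := by
    have := neg_abs_le e
    have h0 : 0 ≤ 4 * h ^ 3 * f := by positivity
    nlinarith
  have h4 : 4 * h ^ 2 * f * (h * |e|) ≤ 4 * h ^ 2 * f * (L * |d| * P) := by gcongr
  have h5 : 4 * h ^ 2 * f * (L * |d| * P) = 2 * h * L * P * (2 * h * f * |d|) := by ring
  have h6 : 2 * h * L * P * (2 * h * f * |d|) ≤ 2 * h * L * P * (|B| + h * L * |V|) := by
    rw [← h2]; gcongr
  have h7 : 2 * h * L * P * |B| ≤ 1 / 2 * B ^ 2 + 2 * h ^ 2 * L ^ 2 * P ^ 2 := by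
    have := sq_nonneg (|B| - 2 * h * L * P)
    have hb := sq_abs B
    nlinarith
  have h8 : 2 * h * L * P * (h * L * |V|) ≤ h ^ 2 * L ^ 2 * (V ^ 2 + P ^ 2) := by
    calc 2 * h * L * P * (h * L * |V|) = h ^ 2 * L ^ 2 * (2 * (|V| * P)) := by ring
      _ ≤ _ := by gcongr
  calc -(4 * h ^ 3 * f * e) ≤ 2 * h * L * P * |B| + 2 * h * L * P * (h * L * |V|) := by
        linarith
    _ ≤ _ := by linarith

set_option maxHeartbeats 800000 in
/-- The algebraic heart of the pointwise estimate. -/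
theorem pointwise_carleman_aux {h κ δ L G g₀ f m g V N d lv lψ H HH dm dl P : ℝ}
    (hh : 0 < h) (hκ : 0 < κ) (hκ1 : κ ≤ 1) (hδ : 0 < δ) (hδ1 : δ ≤ 1)
    (hδG : 9 / 4 * G * δ ≤ g₀ ^ 2 / 4) (hf1 : 1 / 2 ≤ f) (hf2 : f ≤ 3 / 2) (hg₀ : 0 < g₀)
    (hg : g₀ ≤ g) (hgG : g ≤ G) (hL : 0 ≤ L) (hm : |m| ≤ L) (hlψ : |lψ| ≤ L) (hP : 0 ≤ P)
    (hPN : P ^ 2 = h ^ 2 * N) (hdm : h * |dm| ≤ L * P) (hdl : h * |dl| ≤ L * P)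
    (hH : h * |H + m * N| ≤ L * |d| * P) (hHH : HH = m * g) :
    (2 * (-h ^ 2 * lv - f ^ 2 * g * V) * (2 * h * (f * d) + h * lψ * V)
        - 4 * h ^ 3 * (f * H + κ * (d * d)) - 4 * h * (f ^ 2 * (f * HH + κ * g ^ 2)) * V ^ 2
        - 2 * h ^ 3 * V * dl
        - 4 * h ^ 3 * (V * dm + f * m * N + f * m * V * lv)
        - δ * h * κ * h ^ 2 * (N + V * lv))
      + (min (3 / 4 * g₀ ^ 2) δ * h * κ - (40 * L ^ 2 + 3 * L + 1) * h ^ 2) * (V ^ 2 + h ^ 2 * N)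
      ≤ ((-h ^ 2 * lv - f ^ 2 * g * V) + (2 * h * (f * d) + h * lψ * V)) ^ 2 := by
  set A := -h ^ 2 * lv - f ^ 2 * g * V with hA
  set B := 2 * h * (f * d) + h * lψ * V with hB
  set e := H + m * N with he
  have hf0 : 0 ≤ f := by linarith
  have hVP : 2 * (|V| * P) ≤ V ^ 2 + P ^ 2 := by
    have := two_mul_le_add_sq |V| P
    rw [sq_abs] at this; linarith
  have hVP0 : 0 ≤ |V| * P := mul_nonneg (abs_nonneg _) hP
  have b1 : -(4 * h ^ 3 * f * e) ≤ 1 / 2 * B ^ 2 + h ^ 2 * (L ^ 2 * (3 * P ^ 2 + V ^ 2)) :=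
    neg_cross_term_le hh hf0 hL hlψ hP hB hH hVP
  have b2 : 4 * h * f * m * V * A ≤ 1 / 4 * A ^ 2 + h ^ 2 * (36 * L ^ 2 * V ^ 2) := by
    have h1 := sq_nonneg (A / 2 - 4 * h * (f * m) * V)
    have h2 : (f * m) ^ 2 ≤ 9 / 4 * L ^ 2 := by
      have h3 : |f * m| ≤ 3 / 2 * L := by
        rw [abs_mul, abs_of_nonneg hf0]; gcongr
      have := sq_le_sq' (by linarith [neg_abs_le (f * m)]) ((le_abs_self _).trans h3)
      linarith
    have h3 : 16 * h ^ 2 * V ^ 2 * (f * m) ^ 2 ≤ 16 * h ^ 2 * V ^ 2 * (9 / 4 * L ^ 2) := by gcongr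
    linarith
  have b3 : -(2 * h ^ 3 * V * dl) ≤ h ^ 2 * (L * (V ^ 2 + P ^ 2)) := by
    calc -(2 * h ^ 3 * V * dl) ≤ |2 * h ^ 3 * V * dl| := neg_le_abs _
      _ = 2 * h ^ 2 * |V| * (h * |dl|) := by
        rw [abs_mul, abs_mul, abs_of_nonneg (by positivity : 0 ≤ 2 * h ^ 3)]; ring
      _ ≤ 2 * h ^ 2 * |V| * (L * P) := by gcongr
      _ = h ^ 2 * (L * (2 * (|V| * P))) := by ring
      _ ≤ _ := by gcongr
  have b4 : -(4 * h ^ 3 * (V * dm)) ≤ h ^ 2 * (2 * L * (V ^ 2 + P ^ 2)) := by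
    calc -(4 * h ^ 3 * (V * dm)) ≤ |4 * h ^ 3 * (V * dm)| := neg_le_abs _
      _ = 4 * h ^ 2 * |V| * (h * |dm|) := by
        rw [abs_mul _ (V * dm), abs_mul V, abs_of_nonneg (by positivity : 0 ≤ 4 * h ^ 3)]; ring
      _ ≤ 4 * h ^ 2 * |V| * (L * P) := by gcongr
      _ = h ^ 2 * (2 * L * (2 * (|V| * P))) := by ring
      _ ≤ _ := by gcongr
  have b5 : δ * h * κ * (V * A) ≤ 1 / 4 * A ^ 2 + h ^ 2 * V ^ 2 := by
    have h1 := sq_nonneg (A / 2 - δ * h * κ * V)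
    have h2 : (δ * h * κ) ^ 2 ≤ h ^ 2 := by
      have : δ * h * κ ≤ h := by
        calc δ * h * κ ≤ 1 * h * 1 := by gcongr
          _ = h := by ring
      gcongr
    have h3 : (δ * h * κ) ^ 2 * V ^ 2 ≤ h ^ 2 * V ^ 2 := by gcongr
    linarith
  -- This loss is the price of gaining `δ * P ^ 2`. The choice of `δ` keeps it below a quarter of
  -- the gain in `b7`, which leaves the `3 / 4 * g₀ ^ 2` of the final constant.
  have b6 : δ * h * κ * (f ^ 2 * g * V ^ 2) ≤ h * κ * (g₀ ^ 2 / 4 * V ^ 2) := by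
    have hf2' : f ^ 2 ≤ 9 / 4 := by nlinarith
    have hg0 : 0 ≤ g := by linarith
    calc δ * h * κ * (f ^ 2 * g * V ^ 2) ≤ δ * h * κ * (9 / 4 * G * V ^ 2) := by gcongr
      _ = h * κ * (9 / 4 * G * δ * V ^ 2) := by ring
      _ ≤ _ := by gcongr
  have b7 : h * κ * (g₀ ^ 2 * V ^ 2) ≤ 4 * h * κ * f ^ 2 * g ^ 2 * V ^ 2 := by
    have hf2' : 1 / 4 ≤ f ^ 2 := by nlinarith
    calc h * κ * (g₀ ^ 2 * V ^ 2) = 4 * h * κ * (1 / 4) * g₀ ^ 2 * V ^ 2 := by ring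
      _ ≤ _ := by gcongr
  have b8 : 0 ≤ 4 * h ^ 3 * κ * (d * d) := by
    have := mul_self_nonneg d; positivity
  have b9 : (min (3 / 4 * g₀ ^ 2) δ * h * κ) * (V ^ 2 + P ^ 2)
      ≤ h * κ * (3 / 4 * g₀ ^ 2 * V ^ 2) + h * κ * (δ * P ^ 2) := by
    have h1 : min (3 / 4 * g₀ ^ 2) δ * V ^ 2 ≤ 3 / 4 * g₀ ^ 2 * V ^ 2 :=
      mul_le_mul_of_nonneg_right (min_le_left _ _) (sq_nonneg V)
    have h2 : min (3 / 4 * g₀ ^ 2) δ * P ^ 2 ≤ δ * P ^ 2 :=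
      mul_le_mul_of_nonneg_right (min_le_right _ _) (sq_nonneg P)
    have h3 := mul_le_mul_of_nonneg_left (add_le_add h1 h2) (by positivity : 0 ≤ h * κ)
    linarith
  -- The slack: the errors of `b1` to `b5` sum to `37L² + 3L + 1` on `V ^ 2` and `3L² + 3L` on `P ^
  -- 2`, against `40L² + 3L + 1` on both.
  have b10 : 0 ≤ h ^ 2 * (37 * L ^ 2 * P ^ 2 + 3 * L ^ 2 * V ^ 2 + P ^ 2) := by positivity
  rw [← hPN]
  -- Substituting `H = e - m N`, `HH = m g` and `h²lv = -A - f²gV` makes all other terms in `m`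
  -- collapse to `-4hfmVA`; the term in `δ` becomes `δhκ(P² - VA - f²gV²)`.
  have key : (A + B) ^ 2 - (2 * A * B
        - 4 * h ^ 3 * (f * H + κ * (d * d)) - 4 * h * (f ^ 2 * (f * HH + κ * g ^ 2)) * V ^ 2
        - 2 * h ^ 3 * V * dl
        - 4 * h ^ 3 * (V * dm + f * m * N + f * m * V * lv)
        - δ * h * κ * h ^ 2 * (N + V * lv))
      = A ^ 2 + B ^ 2 + 4 * h ^ 3 * f * e + 4 * h ^ 3 * κ * (d * d) - 4 * h * f * m * V * A
        + 4 * h * κ * f ^ 2 * g ^ 2 * V ^ 2 + 2 * h ^ 3 * V * dl + 4 * h ^ 3 * (V * dm)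
        + δ * h * κ * P ^ 2 - δ * h * κ * (V * A) - δ * h * κ * (f ^ 2 * g * V ^ 2) := by
    rw [hPN, he, hHH, hA]; ring
  linarith [key, b1, b2, b3, b4, b5, b6, b7, b8, b9, b10, sq_nonneg A, sq_nonneg B]

end Pointwise

end

end CarlemanEstimate

namespace CarlemanEstimate

noncomputable section

/-! ### The limiting condition as a statement about the Hessian. -/

section Weight

/-- If a quadratic form takes the value `-B(p, p)` at all vectors orthogonal to `p` and of the same
length, then it is the sum of a multiple of the norm squared and of a multiple of `⟨p, ·⟩`. -/
theorem quadratic_form_of_orthogonal {E : Type*} [NormedAddCommGroup E] [InnerProductSpace ℝ E]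
    (B : E →ₗ[ℝ] E →ₗ[ℝ] ℝ) (hB : ∀ ξ η, B ξ η = B η ξ) {p : E} (hp : p ≠ 0)
    (h : ∀ ξ, ‖ξ‖ ^ 2 = ‖p‖ ^ 2 → ⟪p, ξ⟫_ℝ = 0 → B ξ ξ + B p p = 0)
    {m : ℝ} (hm : B p p = m * ‖p‖ ^ 2) (ξ : E) :
    ‖p‖ ^ 2 * (B ξ ξ + m * ‖ξ‖ ^ 2) = ⟪p, ξ⟫_ℝ * (2 * B ξ p) := by
  have hp0 : ‖p‖ ≠ 0 := norm_ne_zero_iff.2 hp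
  -- The hypothesis concerns only vectors of the length of `p`; homogeneity removes this restriction
  -- on the orthogonal complement. A general `ξ` is then split as `τ p` plus an orthogonal vector.
  have horth : ∀ η, ⟪p, η⟫_ℝ = 0 → B η η = -m * ‖η‖ ^ 2 := by
    intro η hη
    by_cases h0 : η = 0
    · simp [h0]
    have hη0 : ‖η‖ ≠ 0 := norm_ne_zero_iff.2 h0
    have := h ((‖p‖ / ‖η‖) • η) (by
      rw [norm_smul, mul_pow, Real.norm_eq_abs, sq_abs]; field_simp) (by
      rw [inner_smul_right, hη, mul_zero])
    simp only [map_smul, LinearMap.smul_apply, smul_eq_mul, hm] at this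
    field_simp at this
    have h1 : ‖p‖ ^ 2 * (B η η + ‖η‖ ^ 2 * m) = 0 := by rw [this, mul_zero]
    linarith [(mul_eq_zero.1 h1).resolve_left (pow_ne_zero 2 hp0)]
  set τ := ⟪p, ξ⟫_ℝ / ‖p‖ ^ 2 with hτ
  have hτp : ⟪p, ξ⟫_ℝ = τ * ‖p‖ ^ 2 := by rw [hτ]; field_simp
  have h1 : ⟪p, ξ - τ • p⟫_ℝ = 0 := by
    rw [inner_sub_right, inner_smul_right, real_inner_self_eq_norm_sq, hτp, sub_self]
  have h2 := horth _ h1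
  have h3 : ‖ξ - τ • p‖ ^ 2 = ‖ξ‖ ^ 2 - τ ^ 2 * ‖p‖ ^ 2 := by
    rw [norm_sub_sq_real, inner_smul_right, real_inner_comm, hτp, norm_smul, mul_pow,
      Real.norm_eq_abs, sq_abs]; ring
  rw [h3] at h2
  simp only [map_sub, map_smul, LinearMap.sub_apply, LinearMap.smul_apply, smul_eq_mul, hm,
    hB p ξ] at h2
  rw [hτp]
  linear_combination ‖p‖ ^ 2 * h2

variable {n : ℕ}

theorem pd_pd_eq {f : Eu n → ℝ} (hf : ContDiff ℝ ∞ f) (i j : Fin n) (x : Eu n) :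
    pd i (pd j f) x
      = fderiv ℝ (fderiv ℝ f) x (EuclideanSpace.single i 1) (EuclideanSpace.single j 1) := by
  have hd : DifferentiableAt ℝ (fderiv ℝ f) x :=
    (hf.fderiv_right (m := ∞) (by simp)).contDiffAt.differentiableAt (by simp)
  have := (hd.hasFDerivAt.clm_apply
    (hasFDerivAt_const (EuclideanSpace.single j (1 : ℝ)) x)).fderiv
  change fderiv ℝ (fun y => (fderiv ℝ f y) ((fun _ => EuclideanSpace.single j (1 : ℝ)) y)) x _ = _
  rw [this]
  simp

theorem fderiv_fderiv_eq_sum {f : Eu n → ℝ} (hf : ContDiff ℝ ∞ f) (x ξ η : Eu n) :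
    fderiv ℝ (fderiv ℝ f) x ξ η = ∑ i, ∑ j, pd i (pd j f) x * ξ i * η j := by
  simp_rw [pd_pd_eq hf]
  conv_lhs => rw [eu_eq_sum ξ, eu_eq_sum η]
  simp only [map_sum, map_smul, sum_apply, smul_apply,
    smul_eq_mul, Finset.mul_sum]
  rw [Finset.sum_comm]
  exact Finset.sum_congr rfl fun i _ => Finset.sum_congr rfl fun j _ => by ring

theorem inner_gradient (f g : Eu n → ℝ) (x y : Eu n) :
    ⟪gradient f x, gradient g y⟫_ℝ = ∑ i, pd i f x * pd i g y := by
  simp_rw [eu_inner_eq_sum, gradient_apply]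

theorem gradient_norm_sq_eq_gdot (f : Eu n → ℝ) (x : Eu n) :
    ‖gradient f x‖ ^ 2 = gdot f f x := by
  rw [gradient_norm_sq, gdot]; simp only [pow_two]

/-- The first product of the bracket is `2ξ·∇(2φ'·ξ) = 4φ''(ξ,ξ)`, the second is `-∇|φ'|²·2φ' =
-4φ''(φ',φ')`. The globally smooth `ψ` stands in for `φ`, with which it agrees near `x`. -/
theorem poissonBracket_eq {φ ψ : Eu n → ℝ} (hψ : ContDiff ℝ ∞ ψ) {x : Eu n} (h : ψ =ᶠ[𝓝 x] φ)
    (ξ : Eu n) :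
    poissonBracket (symbolA φ) (symbolB φ) x ξ
      = 4 * (fderiv ℝ (fderiv ℝ ψ) x ξ ξ + hess ψ ψ ψ x) := by
  have hpd : ∀ᶠ y in 𝓝 x, ∀ j, pd j φ y = pd j ψ y :=
    eventually_all.2 fun j => (pd_eventuallyEq j h).symm
  have h1 : ∀ i, pd i (fun η => symbolA φ x η) ξ = 2 * ξ i := fun i => by
    have : (fun η => symbolA φ x η) = fun η : Eu n => ‖η‖ ^ 2 - ‖gradient φ x‖ ^ 2 := rfl
    rw [this, pd_sub i (differentiableAt_fun_id.norm_sq ℝ) (differentiableAt_const _), pd_const,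
      sub_zero, pd,
      fderiv_norm_sq_apply]
    simp [EuclideanSpace.inner_single_right]
  have h2 : ∀ i, pd i (fun y => symbolB φ y ξ) x = 2 * ∑ j, pd i (pd j ψ) x * ξ j := fun i => by
    have he : (fun y => symbolB φ y ξ) =ᶠ[𝓝 x] fun y => 2 * ∑ j, pd j ψ y * ξ j := by
      filter_upwards [hpd] with y hy
      simp only [symbolB, eu_inner_eq_sum, gradient_apply, hy]
    have hd : ∀ j, DifferentiableAt ℝ (fun y => pd j ψ y * ξ j) x := fun j =>
      (smooth_differentiableAt (contDiff_pd j hψ) x).mul_const _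
    rw [pd_congr i he, pd_const_mul i 2 (by fun_prop), pd_sum i _ fun j _ => hd j]
    congr 1
    refine Finset.sum_congr rfl fun j _ => ?_
    rw [pd_mul i (smooth_differentiableAt (contDiff_pd j hψ) x) (differentiableAt_const _),
      pd_const, mul_zero, add_zero]
  have h3 : ∀ i, pd i (fun y => symbolA φ y ξ) x = -pd i (gdot ψ ψ) x := fun i => by
    have he : (fun y => symbolA φ y ξ) =ᶠ[𝓝 x] fun y => ‖ξ‖ ^ 2 - gdot ψ ψ y := by
      filter_upwards [hpd] with y hy
      simp only [symbolA, gradient_norm_sq, hy, gdot]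
      simp only [← pow_two]
    rw [pd_congr i he, pd_sub i (differentiableAt_const _)
      (smooth_differentiableAt (contDiff_gdot hψ hψ) x), pd_const, zero_sub]
  have h4 : ∀ i, pd i (fun η => symbolB φ x η) ξ = 2 * pd i ψ x := fun i => by
    have : (fun η => symbolB φ x η) = fun η : Eu n => 2 * ⟪gradient φ x, η⟫_ℝ := rfl
    have hlin : HasFDerivAt (fun η : Eu n => ⟪gradient φ x, η⟫_ℝ) (innerSL ℝ (gradient φ x)) ξ :=
      (innerSL ℝ (gradient φ x)).hasFDerivAt
    rw [this, pd_const_mul i 2 hlin.differentiableAt, ← hpd.self_of_nhds i, pd,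
      hlin.fderiv, ← gradient_apply]
    simp [gradient_apply, pd]
  have h5 : hess ψ ψ ψ x * 2 = ∑ i, pd i (gdot ψ ψ) x * pd i ψ x := by
    have := gdot_gdot (k := ψ) hψ hψ x
    rw [mul_two, ← this]; rfl
  unfold poissonBracket
  simp_rw [inner_gradient, h1, h2, h3, h4]
  rw [fderiv_fderiv_eq_sum hψ, mul_add, show (4 : ℝ) * hess ψ ψ ψ x = 2 * (hess ψ ψ ψ x * 2) by ring,
    h5, sub_eq_add_neg, ← Finset.sum_neg_distrib]
  simp only [Finset.mul_sum]
  congr 1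
  · exact Finset.sum_congr rfl fun i _ => Finset.sum_congr rfl fun j _ => by ring
  · exact Finset.sum_congr rfl fun i _ => by ring

/-- A limiting Carleman weight agrees near a compact set with a globally smooth function whose Hessian
is controlled by a multiple of the identity and by the gradient. -/
theorem IsLimitingCarlemanWeight.exists_extension {W K : Set (Eu n)} {φ : Eu n → ℝ} (hW : IsOpen W)
    (hφ : IsLimitingCarlemanWeight W φ) (hK : IsCompact K) (hKW : K ⊆ W) :
    ∃ ψ m : Eu n → ℝ, ContDiff ℝ ∞ ψ ∧ ContDiff ℝ ∞ m ∧ (∀ x ∈ K, ψ =ᶠ[𝓝 x] φ) ∧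
      ∀ x ∈ K, 0 < gdot ψ ψ x ∧ hess ψ ψ ψ x = m x * gdot ψ ψ x ∧
        ∀ v : Eu n → ℝ, gdot ψ ψ x * (hess ψ v v x + m x * gdot v v x)
          = gdot ψ v x * gdot (gdot ψ ψ) v x := by
  obtain ⟨ψ, hψ, hψφ⟩ := exists_contDiff_eventuallyEq hW hK hKW hφ.contDiffOn
  have hgrad : ∀ x ∈ K, gradient ψ x ≠ 0 := fun x hx h0 => by
    refine hφ.gradient_ne_zero x (hKW hx) ?_
    rw [← h0, gradient, gradient, (hψφ x hx).fderiv_eq]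
  have hnorm : ∀ x, ‖gradient ψ x‖ ^ 2 = gdot ψ ψ x := gradient_norm_sq_eq_gdot ψ
  have hpos : ∀ x ∈ K, 0 < gdot ψ ψ x := fun x hx => by
    rw [← hnorm]; have := norm_pos_iff.2 (hgrad x hx); positivity
  have hS := contDiff_gdot hψ hψ
  have hU : IsOpen {x | gdot ψ ψ x ≠ 0} := isOpen_ne.preimage hS.continuous
  -- This is `ψ''(∇ψ,∇ψ)/|∇ψ|²`: the numerator `∇|∇ψ|²·∇ψ` is twice the Hessian term, hence the `2`
  -- below.
  obtain ⟨m, hm, hmeq⟩ := exists_contDiff_eventuallyEq hU hK (fun x hx => (hpos x hx).ne')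
    (f := fun x => gdot (gdot ψ ψ) ψ x / (2 * gdot ψ ψ x))
    ((contDiff_gdot hS hψ).contDiffOn.div (contDiff_const.mul hS).contDiffOn
      fun x hx => mul_ne_zero two_ne_zero hx)
  have hm1 : ∀ x ∈ K, hess ψ ψ ψ x = m x * gdot ψ ψ x := fun x hx => by
    rw [(hmeq x hx).eq_of_nhds]
    have := (hpos x hx).ne'
    rw [gdot_gdot hψ hψ]
    field_simp
    ring
  refine ⟨ψ, m, hψ, hm, hψφ, fun x hx => ⟨hpos x hx, hm1 x hx, fun v => ?_⟩⟩
  set B : Eu n →ₗ[ℝ] Eu n →ₗ[ℝ] ℝ :=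
    LinearMap.mk₂ ℝ (fun ξ η => fderiv ℝ (fderiv ℝ ψ) x ξ η) (by simp) (by simp) (by simp) (by simp)
    with hB
  have hBapp : ∀ ξ η, B ξ η = fderiv ℝ (fderiv ℝ ψ) x ξ η := fun _ _ => rfl
  have hBg : ∀ f g : Eu n → ℝ, B (gradient f x) (gradient g x) = hess ψ f g x := fun f g => by
    rw [hBapp, fderiv_fderiv_eq_sum hψ]
    simp only [gradient_apply]; rfl
  have hsymm : ∀ ξ η, B ξ η = B η ξ := fun ξ η => by
    have hs : IsSymmSndFDerivAt ℝ ψ x :=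
      (contDiff_infty.1 hψ 2).contDiffAt.isSymmSndFDerivAt (by simp)
    exact hs ξ η
  have hnx : ‖gradient φ x‖ ^ 2 = gdot ψ ψ x := by
    rw [← hnorm, gradient, gradient, (hψφ x hx).fderiv_eq]
  have hmain := quadratic_form_of_orthogonal B hsymm (hgrad x hx) (m := m x) (fun ξ h1 h2 => by
    have h3 := hφ.poissonBracket_eq_zero x (hKW hx) ξ
      (by rw [symbolA, h1, hnx, hnorm, sub_self])
      (by rw [symbolB, gradient, ← (hψφ x hx).fderiv_eq, ← gradient, h2, mul_zero])
    rw [poissonBracket_eq hψ (hψφ x hx)] at h3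
    rw [hBg, hBapp]
    linarith) (by rw [hBg, hnorm, hm1 x hx]) (gradient v x)
  rw [hBg, hBg, hnorm, inner_gradient] at hmain
  rw [gradient_norm_sq_eq_gdot] at hmain
  rw [hmain, gdot_gdot hψ hψ]
  change gdot ψ v x * _ = _
  ring

end Weight

/-! ### Constants uniform over a compact set and in `κ`. -/

section Uniform

variable {n : ℕ}

theorem continuous_sqrt_gdot {f : Eu n → ℝ} (hf : ContDiff ℝ ∞ f) :
    Continuous fun x => Real.sqrt (gdot f f x) :=
  Real.continuous_sqrt.comp (contDiff_gdot hf hf).continuous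

/-- The pointwise Carleman estimate with uniform constants. -/
theorem exists_pointwise_carleman {K : Set (Eu n)} (hK : IsCompact K) {φ m : Eu n → ℝ}
    (hφ : ContDiff ℝ ∞ φ) (hm : ContDiff ℝ ∞ m)
    (hyp : ∀ x ∈ K, 0 < gdot φ φ x ∧ hess φ φ φ x = m x * gdot φ φ x ∧
      ∀ v : Eu n → ℝ, gdot φ φ x * (hess φ v v x + m x * gdot v v x)
        = gdot φ v x * gdot (gdot φ φ) v x) :
    ∃ c C δ κ₀ : ℝ, 0 < c ∧ 0 ≤ C ∧ 0 < κ₀ ∧ ∀ κ, 0 < κ → κ ≤ κ₀ →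
      (∀ x ∈ K, 1 / 2 ≤ 1 + κ * φ x ∧ 1 + κ * φ x ≤ 3 / 2) ∧
      ∀ h, 0 < h → ∀ v : Eu n → ℝ, ContDiff ℝ ∞ v → ∀ x ∈ K,
        divg (carlemanField (convexify κ φ) (fun y => (1 + κ * φ y) * m y) h (δ * h * κ) v) x
          + (c * h * κ - C * h ^ 2) * (v x ^ 2 + h ^ 2 * gdot v v x)
          ≤ conjOp (convexify κ φ) h v x ^ 2 := by
  have hS := contDiff_gdot hφ hφ
  obtain ⟨g₀, hg₀, hg₀K⟩ := hK.exists_forall_le' hS.continuous.continuousOn fun x hx => (hyp x hx).1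
  obtain ⟨G', hG'⟩ := hK.exists_bound_of_continuousOn hS.continuous.continuousOn
  obtain ⟨Φ', hΦ'⟩ := hK.exists_bound_of_continuousOn hφ.continuous.continuousOn
  -- The quantities depending on `κ` are affine in it: the Laplacian of the convexified weight is
  -- `lapl φ + κ α₁`, the multiplier is `m + κ β₁`. Bounds on the coefficients are therefore uniform
  -- for `κ ≤ 1`, and a single `L` serves for all of them.
  set α₁ : Eu n → ℝ := fun y => φ y * lapl φ y + gdot φ φ y with hα₁
  set β₁ : Eu n → ℝ := fun y => φ y * m y with hβ₁
  have hα₀d := contDiff_lapl hφ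
  have hα₁d : ContDiff ℝ ∞ α₁ := (hφ.mul hα₀d).add hS
  have hβ₁d : ContDiff ℝ ∞ β₁ := hφ.mul hm
  have hc1 := continuous_sqrt_gdot hm
  have hc2 := continuous_sqrt_gdot hβ₁d
  have hc3 := continuous_sqrt_gdot hα₀d
  have hc4 := continuous_sqrt_gdot hα₁d
  have hc5 := continuous_sqrt_gdot hS
  obtain ⟨L', hL'⟩ := hK.exists_bound_of_continuousOn
    (f := fun x => 2 * |m x| + (|lapl φ x| + |α₁ x|)
      + (Real.sqrt (gdot m m x) + Real.sqrt (gdot β₁ β₁ x))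
      + (Real.sqrt (gdot (lapl φ) (lapl φ) x) + Real.sqrt (gdot α₁ α₁ x))
      + Real.sqrt (gdot (gdot φ φ) (gdot φ φ) x) / g₀)
    (by
      have := hm.continuous; have := hα₀d.continuous; have := hα₁d.continuous
      exact Continuous.continuousOn (by fun_prop))
  set L := max L' 0 with hL
  set G := max G' 0 with hG
  set Φ := max Φ' 0 with hΦ
  have hL0 : 0 ≤ L := le_max_right _ _
  have hG0 : 0 ≤ G := le_max_right _ _
  have hΦ0 : 0 ≤ Φ := le_max_right _ _
  set δ := min 1 (g₀ ^ 2 / (9 * (G + 1))) with hδ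
  have hδ0 : 0 < δ := lt_min one_pos (by positivity)
  have hδG : 9 / 4 * G * δ ≤ g₀ ^ 2 / 4 := by
    calc 9 / 4 * G * δ ≤ 9 / 4 * (G + 1) * (g₀ ^ 2 / (9 * (G + 1))) := by
          gcongr
          · linarith
          · exact min_le_right _ _
      _ = g₀ ^ 2 / 4 := by field_simp
  refine ⟨min (3 / 4 * g₀ ^ 2) δ, 40 * L ^ 2 + 3 * L + 1, δ, min 1 (1 / (2 * (Φ + 1))),
    lt_min (by positivity) hδ0, by positivity, lt_min one_pos (by positivity), fun κ hκ hκ₀ => ?_⟩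
  have hκ1 : κ ≤ 1 := hκ₀.trans (min_le_left _ _)
  have hf : ∀ x ∈ K, 1 / 2 ≤ 1 + κ * φ x ∧ 1 + κ * φ x ≤ 3 / 2 := fun x hx => by
    have h1 : |κ * φ x| ≤ 1 / 2 := by
      rw [abs_mul, abs_of_pos hκ]
      have h2 : |φ x| ≤ Φ + 1 := ((hΦ' x hx).trans (le_max_left _ _)).trans (by linarith)
      calc κ * |φ x| ≤ 1 / (2 * (Φ + 1)) * (Φ + 1) := by
            gcongr
            exact hκ₀.trans (min_le_right _ _)
        _ = 1 / 2 := by field_simp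
    constructor
    · linarith [neg_abs_le (κ * φ x)]
    · linarith [le_abs_self (κ * φ x)]
  refine ⟨hf, fun h hh v hv x hx => ?_⟩
  have hM : ContDiff ℝ ∞ fun y => (1 + κ * φ y) * m y := by fun_prop
  obtain ⟨-, hH1, hH2⟩ := hyp x hx
  have hsum := (le_abs_self _).trans ((hL' x hx).trans (le_max_left L' 0))
  have hg := hg₀K x hx
  have hgpos : 0 < gdot φ φ x := hg₀.trans_le hg
  have p1 := abs_nonneg (m x)
  have p2 := abs_nonneg (lapl φ x)
  have p3 := abs_nonneg (α₁ x)
  have p4 := Real.sqrt_nonneg (gdot m m x)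
  have p5 := Real.sqrt_nonneg (gdot β₁ β₁ x)
  have p6 := Real.sqrt_nonneg (gdot (lapl φ) (lapl φ) x)
  have p7 := Real.sqrt_nonneg (gdot α₁ α₁ x)
  have p8 : 0 ≤ Real.sqrt (gdot (gdot φ φ) (gdot φ φ) x) / g₀ :=
    div_nonneg (Real.sqrt_nonneg _) hg₀.le
  set P := h * Real.sqrt (gdot v v x) with hP
  have hN0 := Real.sqrt_nonneg (gdot v v x)
  have hP0 : 0 ≤ P := mul_nonneg hh.le hN0
  have hcomb : ∀ a b : Eu n → ℝ, ContDiff ℝ ∞ a → ContDiff ℝ ∞ b →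
      Real.sqrt (gdot a a x) + Real.sqrt (gdot b b x) ≤ L →
      h * |gdot (fun y => a y + κ * b y) v x| ≤ L * P := fun a b ha hb hab => by
    rw [gdot_add_left ha (contDiff_const.mul hb), gdot_const_mul_left κ hb]
    have h1 : |gdot a v x + κ * gdot b v x| ≤ L * Real.sqrt (gdot v v x) := by
      refine (abs_add_le _ _).trans ?_
      rw [abs_mul, abs_of_pos hκ]
      have h2 : κ * |gdot b v x| ≤ 1 * (Real.sqrt (gdot b b x) * Real.sqrt (gdot v v x)) := by
        gcongr
        exact abs_gdot_le b v x
      calc |gdot a v x| + κ * |gdot b v x|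
          ≤ (Real.sqrt (gdot a a x) + Real.sqrt (gdot b b x)) * Real.sqrt (gdot v v x) := by
            linarith [abs_gdot_le a v x]
        _ ≤ _ := by gcongr
    calc h * |gdot a v x + κ * gdot b v x| ≤ h * (L * Real.sqrt (gdot v v x)) := by gcongr
      _ = L * P := by rw [hP]; ring
  have hlapl : lapl (convexify κ φ) = fun y => lapl φ y + κ * α₁ y := funext (lapl_convexify κ hφ)
  have hMeq : (fun y => (1 + κ * φ y) * m y) = fun y => m y + κ * β₁ y := by
    ext y; rw [hβ₁]; ring
  have key := pointwise_carleman_aux (h := h) (κ := κ) (δ := δ) (L := L) (G := G) (g₀ := g₀)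
    (f := 1 + κ * φ x) (m := m x) (g := gdot φ φ x) (V := v x) (N := gdot v v x)
    (d := gdot φ v x) (lv := lapl v x) (lψ := lapl (convexify κ φ) x) (H := hess φ v v x)
    (HH := hess φ φ φ x) (dm := gdot (fun y => (1 + κ * φ y) * m y) v x)
    (dl := gdot (lapl (convexify κ φ)) v x) (P := P) hh hκ hκ1 hδ0 (min_le_left _ _) hδG
    (hf x hx).1 (hf x hx).2 hg₀ hg
    ((le_abs_self _).trans ((hG' x hx).trans (le_max_left _ _))) hL0 (by linarith)
    (by
      rw [lapl_convexify κ hφ]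
      refine (abs_add_le _ _).trans ?_
      rw [abs_mul, abs_of_pos hκ]
      have : κ * |α₁ x| ≤ 1 * |α₁ x| := by gcongr
      change |lapl φ x| + κ * |α₁ x| ≤ L
      linarith)
    hP0 (by rw [hP, mul_pow, Real.sq_sqrt (gdot_self_nonneg v x)])
    (by rw [hMeq]; exact hcomb m β₁ hm hβ₁d (by linarith))
    (by rw [hlapl]; exact hcomb _ α₁ hα₀d hα₁d (by linarith))
    (by
      have h1 : hess φ v v x + m x * gdot v v x
          = gdot φ v x * (gdot (gdot φ φ) v x / gdot φ φ x) := by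
        rw [eq_comm, ← mul_div_assoc, div_eq_iff hgpos.ne', ← hH2 v]; ring
      have h2 : |gdot (gdot φ φ) v x / gdot φ φ x| ≤ L * Real.sqrt (gdot v v x) := by
        rw [abs_div, abs_of_pos hgpos, div_le_iff₀ hgpos]
        calc |gdot (gdot φ φ) v x|
            ≤ Real.sqrt (gdot (gdot φ φ) (gdot φ φ) x) * Real.sqrt (gdot v v x) :=
              abs_gdot_le _ _ _
          _ = (Real.sqrt (gdot (gdot φ φ) (gdot φ φ) x) / g₀) * Real.sqrt (gdot v v x) * g₀ := by
              field_simp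
          _ ≤ L * Real.sqrt (gdot v v x) * gdot φ φ x := by
              gcongr
              linarith
      rw [h1, abs_mul]
      calc h * (|gdot φ v x| * |gdot (gdot φ φ) v x / gdot φ φ x|)
          ≤ h * (|gdot φ v x| * (L * Real.sqrt (gdot v v x))) := by gcongr
        _ = L * |gdot φ v x| * P := by rw [hP]; ring)
    hH1
  rw [divg_carlemanField (contDiff_convexify κ hφ) hM hv, conjOp, gdot_convexify_self κ hφ,
    gdot_convexify κ hφ, hess_convexify κ hφ, hess_convexify_self κ hφ]
  refine le_trans (le_of_eq ?_) (key.trans (le_of_eq ?_))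
  · ring
  · ring

end Uniform

end

end CarlemanEstimate

namespace CarlemanEstimate

noncomputable section

/-! ### Gradients at the boundary under the Dirichlet condition. -/

section BoundaryGradient

variable {n : ℕ} {Ω : Set (Eu n)}

theorem flux_pd_eq_fderiv (Ω : Set (Eu n)) (u : Eu n → ℝ) (x : Eu n) :
    flux Ω (fun i => pd i u) x = fderiv ℝ u x (exteriorNormal Ω x) :=
  (fderiv_apply_eq_sum _).symm

/-- The gradient of a function vanishing on the boundary is normal to the boundary. -/
theorem pd_eq_flux_mul_exteriorNormal (hΩ : HasSmoothBoundary Ω) {u : Eu n → ℝ}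
    (hu : ContDiff ℝ ∞ u) (hu0 : ∀ x ∈ frontier Ω, u x = 0) {x : Eu n} (hx : x ∈ frontier Ω)
    (i : Fin n) : pd i u x = flux Ω (fun i => pd i u) x * exteriorNormal Ω x i := by
  obtain ⟨U, ρ, hxU, hρ⟩ := hΩ x hx
  have hU : U ∈ 𝓝 x := hρ.isOpen.mem_nhds hxU
  have hρ0 := (hρ.mem_frontier_iff hxU).1 hx
  have hρs : HasStrictFDerivAt ρ (fderiv ℝ ρ x) x :=
    (hρ.contDiffOn.contDiffAt hU).hasStrictFDerivAt (by simp)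
  have hus : HasStrictFDerivAt u (fderiv ℝ u x) x := hu.contDiffAt.hasStrictFDerivAt (by simp)
  -- On the level set of `ρ` the function `u` is constant near `x`, so `x` is trivially a
  -- constrained extremum; Lagrange multipliers then make the two differentials proportional.
  have hext : IsLocalExtrOn u {y | ρ y = ρ x} x := by
    left
    filter_upwards [mem_nhdsWithin_of_mem_nhds hU, self_mem_nhdsWithin] with y hyU hy
    have h1 : ρ y = 0 := by rw [← hρ0]; exact hy
    rw [hu0 x hx, hu0 y ((hρ.mem_frontier_iff hyU).2 h1)]
  obtain ⟨a, b, hab, h⟩ := hext.exists_multipliers_of_hasStrictFDerivAt_1d hρs hus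
  have hg0 : gradient ρ x ≠ 0 := hρ.gradient_ne_zero x hxU
  have hb : b ≠ 0 := by
    rintro rfl
    rw [zero_smul, add_zero] at h
    have ha : a ≠ 0 := fun h0 => hab (by rw [h0]; rfl)
    refine hg0 ?_
    rw [gradient, (smul_eq_zero.1 h).resolve_left ha, map_zero]
  have hcomp : ∀ j, pd j u x = -(a / b) * pd j ρ x := fun j => by
    have := congrArg (fun l : Eu n →L[ℝ] ℝ => l (EuclideanSpace.single j 1)) h
    change a * pd j ρ x + b * pd j u x = 0 at this
    field_simp
    linarith
  have hν := exteriorNormal_eq hΩ hρ hxU hx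
  have hnorm : ‖gradient ρ x‖ ≠ 0 := norm_ne_zero_iff.2 hg0
  have hνi : ∀ j, pd j ρ x = ‖gradient ρ x‖ * exteriorNormal Ω x j := fun j => by
    rw [hν, PiLp.smul_apply, gradient_apply, smul_eq_mul, mul_inv_cancel_left₀ hnorm]
  have hν1 : ∑ j, exteriorNormal Ω x j * exteriorNormal Ω x j = 1 := by
    rw [← eu_inner_eq_sum, real_inner_self_eq_norm_sq, norm_exteriorNormal hΩ hx, one_pow]
  have hfl : flux Ω (fun i => pd i u) x = -(a / b) * ‖gradient ρ x‖ := by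
    rw [flux]
    simp_rw [hcomp, hνi]
    calc ∑ j, -(a / b) * (‖gradient ρ x‖ * exteriorNormal Ω x j) * exteriorNormal Ω x j
        = -(a / b) * ‖gradient ρ x‖ * ∑ j, exteriorNormal Ω x j * exteriorNormal Ω x j := by
          rw [Finset.mul_sum]; exact Finset.sum_congr rfl fun j _ => by ring
      _ = _ := by rw [hν1, mul_one]
  rw [hfl, hcomp, hνi]; ring

end BoundaryGradient

/-! ### Conjugation by the exponential weight. -/

section Conjugation

variable {n : ℕ} {ψ u : Eu n → ℝ}

theorem contDiff_exp_mul (hψ : ContDiff ℝ ∞ ψ) (hu : ContDiff ℝ ∞ u) (h : ℝ) :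
    ContDiff ℝ ∞ fun x => Real.exp (ψ x / h) * u x :=
  ((hψ.div_const h).exp).mul hu

theorem pd_exp_mul (hψ : ContDiff ℝ ∞ ψ) (hu : ContDiff ℝ ∞ u) (h : ℝ) (i : Fin n) (x : Eu n) :
    pd i (fun x => Real.exp (ψ x / h) * u x) x
      = Real.exp (ψ x / h) * (pd i u x + h⁻¹ * (pd i ψ x * u x)) := by
  have h1 : DifferentiableAt ℝ (fun x => h⁻¹ * ψ x) x :=
    (smooth_differentiableAt hψ x).const_mul _
  have h2 : (fun x => Real.exp (ψ x / h)) = fun x => Real.exp (h⁻¹ * ψ x) := by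
    ext y; rw [div_eq_inv_mul]
  have h3 : pd i (fun x => Real.exp (ψ x / h)) x
      = Real.exp (ψ x / h) * (h⁻¹ * pd i ψ x) := by
    rw [h2, pd_comp (f := fun x => h⁻¹ * ψ x) i Real.differentiableAt_exp h1, Real.deriv_exp,
      pd_const_mul i _ (smooth_differentiableAt hψ x), div_eq_inv_mul]
  rw [pd_mul i (smooth_differentiableAt ((hψ.div_const h).exp) x) (smooth_differentiableAt hu x),
    h3]
  ring

theorem gdot_exp_mul (hψ : ContDiff ℝ ∞ ψ) (hu : ContDiff ℝ ∞ u) (h : ℝ) (x : Eu n) :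
    gdot ψ (fun x => Real.exp (ψ x / h) * u x) x
      = Real.exp (ψ x / h) * (gdot ψ u x + h⁻¹ * (gdot ψ ψ x * u x)) := by
  simp only [gdot, pd_exp_mul hψ hu, Finset.sum_mul, Finset.mul_sum, ← Finset.sum_add_distrib]
  exact Finset.sum_congr rfl fun i _ => by ring

theorem lapl_exp_mul (hψ : ContDiff ℝ ∞ ψ) (hu : ContDiff ℝ ∞ u) (h : ℝ) (x : Eu n) :
    lapl (fun x => Real.exp (ψ x / h) * u x) x
      = Real.exp (ψ x / h) * (lapl u x + h⁻¹ * (lapl ψ x * u x) + 2 * h⁻¹ * gdot ψ u x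
          + h⁻¹ ^ 2 * (gdot ψ ψ x * u x)) := by
  have key : ∀ i, pd i (pd i fun x => Real.exp (ψ x / h) * u x) x
      = Real.exp (ψ x / h) * (pd i (pd i u) x + h⁻¹ * (pd i (pd i ψ) x * u x)
        + 2 * h⁻¹ * (pd i ψ x * pd i u x) + h⁻¹ ^ 2 * (pd i ψ x * pd i ψ x * u x)) := fun i => by
    have hu' := contDiff_pd i hu
    have hψ' := contDiff_pd i hψ
    have hw : ContDiff ℝ ∞ fun y => pd i u y + h⁻¹ * (pd i ψ y * u y) :=
      hu'.add (contDiff_const.mul (hψ'.mul hu))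
    rw [funext (pd_exp_mul hψ hu h i), pd_exp_mul hψ hw,
      pd_add i (smooth_differentiableAt hu' x)
        (smooth_differentiableAt (contDiff_const.mul (hψ'.mul hu)) x),
      pd_const_mul i _ (smooth_differentiableAt (hψ'.mul hu) x),
      pd_mul i (smooth_differentiableAt hψ' x) (smooth_differentiableAt hu x)]
    ring
  unfold lapl
  simp_rw [key, gdot, Finset.sum_mul, Finset.mul_sum, ← Finset.sum_add_distrib, Finset.mul_sum]

theorem conjOp_exp_mul (hψ : ContDiff ℝ ∞ ψ) (hu : ContDiff ℝ ∞ u) {h : ℝ} (hh : h ≠ 0)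
    (x : Eu n) :
    conjOp ψ h (fun x => Real.exp (ψ x / h) * u x) x
      = Real.exp (ψ x / h) * (-(h ^ 2 * lapl u x)) := by
  rw [conjOp, lapl_exp_mul hψ hu, gdot_exp_mul hψ hu]
  field_simp
  ring

/-- With `v = e^{ψ/h}u` one has `e^{ψ/h}h∇u = h∇v - v∇ψ`, and `(a - b)² ≤ 2a² + 2b²` in each
component. This carries the gradient bound from `v` back to `u`. -/
theorem sq_gradient_le_exp_mul (hψ : ContDiff ℝ ∞ ψ) (hu : ContDiff ℝ ∞ u) {h : ℝ} (hh : h ≠ 0)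
    (x : Eu n) :
    Real.exp (ψ x / h) ^ 2 * (h ^ 2 * gdot u u x)
      ≤ 2 * (h ^ 2 * gdot (fun x => Real.exp (ψ x / h) * u x)
          (fun x => Real.exp (ψ x / h) * u x) x)
        + 2 * (gdot ψ ψ x * (Real.exp (ψ x / h) * u x) ^ 2) := by
  simp only [gdot, pd_exp_mul hψ hu, Finset.sum_mul, Finset.mul_sum, ← Finset.sum_add_distrib]
  refine Finset.sum_le_sum fun i _ => ?_
  have h1 := sq_nonneg (Real.exp (ψ x / h) * (h * pd i u x + pd i ψ x * u x)
    + Real.exp (ψ x / h) * (pd i ψ x * u x))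
  have h2 : h * (pd i u x + h⁻¹ * (pd i ψ x * u x)) = h * pd i u x + pd i ψ x * u x := by
    field_simp
  have h3 : h ^ 2 * (Real.exp (ψ x / h) * (pd i u x + h⁻¹ * (pd i ψ x * u x))
        * (Real.exp (ψ x / h) * (pd i u x + h⁻¹ * (pd i ψ x * u x))))
      = (Real.exp (ψ x / h) * (h * pd i u x + pd i ψ x * u x)) ^ 2 := by
    rw [← h2]; ring
  rw [h3]
  linarith

end Conjugation

end

end CarlemanEstimate

namespace CarlemanEstimate

noncomputable section

/-! ### Comparison of weights, boundary flux and integrability. -/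

section RealEstimate

variable {d : ℕ} {Ω : Set (Eu (d + 1))} {φ m : Eu (d + 1) → ℝ}

theorem flux_neg {n : ℕ} (Ω : Set (Eu n)) (F : Fin n → Eu n → ℝ) (x : Eu n) :
    flux Ω (fun i y => -F i y) x = -flux Ω F x := by
  simp only [flux, neg_mul, Finset.sum_neg_distrib]

theorem divg_neg {n : ℕ} {F : Fin n → Eu n → ℝ} (hF : ∀ i, ContDiff ℝ ∞ (F i)) (x : Eu n) :
    divg (fun i y => -F i y) x = -divg F x := by
  simp only [divg, ← Finset.sum_neg_distrib]
  refine Finset.sum_congr rfl fun i _ => ?_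
  have := pd_const_mul i (-1) (smooth_differentiableAt (hF i) x)
  simpa using this

/-- For `κ = h/ε` the correction `κφ²/(2h) = φ²/(2ε)` is free of `h`, so on a compact set the two
weights are comparable uniformly in `h`. -/
theorem exp_convexify_sq {n : ℕ} (φ : Eu n → ℝ) {h ε : ℝ} (hh : h ≠ 0) (hε : ε ≠ 0) (x : Eu n) :
    Real.exp (convexify (h / ε) φ x / h) ^ 2 = Real.exp (φ x ^ 2 / ε) * Real.exp (φ x / h) ^ 2 := by
  rw [← Real.exp_nat_mul, ← Real.exp_nat_mul, ← Real.exp_add, convexify]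
  congr 1
  push_cast
  field_simp
  ring

/-- On the boundary `v = 0` and `∇v = e^{ψ/h}∂_νu ν`. Only the two terms quadratic in `∇v` survive,
with coefficients `-4h³` and `2h³`; the corrections with `m` and `t` carry a factor `v` and leave no
trace. -/
theorem flux_carlemanField_exp_mul {n : ℕ} {Ω : Set (Eu n)} {φ u : Eu n → ℝ}
    (hΩ : HasSmoothBoundary Ω) (hφ : ContDiff ℝ ∞ φ) (hu : ContDiff ℝ ∞ u)
    (hu0 : ∀ x ∈ frontier Ω, u x = 0) (m : Eu n → ℝ) (κ h t : ℝ) {x : Eu n}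
    (hx : x ∈ frontier Ω) :
    flux Ω (carlemanField (convexify κ φ) m h t
        (fun y => Real.exp (convexify κ φ y / h) * u y)) x
      = -(2 * h ^ 3 * (1 + κ * φ x) * flux Ω (fun i => pd i φ) x
          * (Real.exp (convexify κ φ x / h) * flux Ω (fun i => pd i u) x) ^ 2) := by
  have hψ := contDiff_convexify κ hφ
  have hux := hu0 x hx
  set E := Real.exp (convexify κ φ x / h) with hE
  set nd := flux Ω (fun i => pd i u) x with hnd
  set ν := exteriorNormal Ω x with hν
  have hν1 : ∑ j, ν j * ν j = 1 := by
    rw [← eu_inner_eq_sum, real_inner_self_eq_norm_sq, norm_exteriorNormal hΩ hx, one_pow]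
  have hpd : ∀ i, pd i (fun y => Real.exp (convexify κ φ y / h) * u y) x = E * nd * ν i := by
    intro i
    rw [pd_exp_mul hψ hu, pd_eq_flux_mul_exteriorNormal hΩ hu hu0 hx, hux]
    ring
  have hg1 : gdot (convexify κ φ) (fun y => Real.exp (convexify κ φ y / h) * u y) x
      = E * nd * ((1 + κ * φ x) * flux Ω (fun i => pd i φ) x) := by
    simp only [gdot, hpd, pd_convexify κ hφ, flux, Finset.mul_sum]
    exact Finset.sum_congr rfl fun i _ => by ring
  have hg2 : gdot (fun y => Real.exp (convexify κ φ y / h) * u y)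
      (fun y => Real.exp (convexify κ φ y / h) * u y) x = (E * nd) ^ 2 := by
    simp only [gdot, hpd]
    rw [← mul_one ((E * nd) ^ 2), ← hν1, Finset.mul_sum]
    exact Finset.sum_congr rfl fun i _ => by ring
  have hcomp : ∀ i, carlemanField (convexify κ φ) m h t
        (fun y => Real.exp (convexify κ φ y / h) * u y) i x * ν i
      = (-4 * h ^ 3 * (E * nd * ((1 + κ * φ x) * flux Ω (fun i => pd i φ) x)) * (E * nd))
          * (ν i * ν i)
        + (2 * h ^ 3 * (E * nd) ^ 2 * (1 + κ * φ x)) * (pd i φ x * ν i) := by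
    intro i
    simp only [carlemanField, smulGrad, hg1, hg2, hpd, pd_convexify κ hφ, hux]
    ring
  have hs : ∑ i, pd i φ x * ν i = flux Ω (fun i => pd i φ) x := rfl
  have hfl : flux Ω (carlemanField (convexify κ φ) m h t
        (fun y => Real.exp (convexify κ φ y / h) * u y)) x
      = ∑ i, carlemanField (convexify κ φ) m h t
        (fun y => Real.exp (convexify κ φ y / h) * u y) i x * ν i := rfl
  rw [hfl, Finset.sum_congr rfl fun i _ => hcomp i, Finset.sum_add_distrib, ← Finset.mul_sum,
    ← Finset.mul_sum, hν1, hs]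
  ring

theorem integrableOn_of_continuous {n : ℕ} {Ω : Set (Eu n)} (hΩc : IsCompact (closure Ω))
    {f : Eu n → ℝ} (hf : Continuous f) : IntegrableOn f Ω :=
  (hf.continuousOn.integrableOn_compact hΩc).mono_set subset_closure

/-- A function on the boundary that is measurable and bounded on it is integrable. -/
theorem integrableOn_frontier_of_bound {n : ℕ} {Ω : Set (Eu n)} {μ : Measure (Eu n)}
    (hfin : μ (frontier Ω) < ⊤)
    {f : Eu n → ℝ} (hf : Measurable f) {D : ℝ} (hD : ∀ x ∈ frontier Ω, |f x| ≤ D) :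
    IntegrableOn f (frontier Ω) μ := by
  have : IsFiniteMeasure (μ.restrict (frontier Ω)) := ⟨by simpa using hfin⟩
  refine Integrable.of_bound hf.aestronglyMeasurable D ?_
  filter_upwards [ae_restrict_mem isClosed_frontier.measurableSet] with x hx
  exact hD x hx

theorem integrableOn_frontier_weighted_flux {n : ℕ} {Ω : Set (Eu n)} {μ : Measure (Eu n)}
    (hfin : μ (frontier Ω) < ⊤) (hΩ : HasSmoothBoundary Ω) (hcf : IsCompact (frontier Ω))
    {φ u w : Eu n → ℝ} (hφ : ContDiff ℝ ∞ φ) (hu : ContDiff ℝ ∞ u) (hw : Continuous w) (c : ℝ) :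
    IntegrableOn (fun x => max (c * flux Ω (fun i => pd i φ) x) 0
      * (w x * flux Ω (fun i => pd i u) x) ^ 2) (frontier Ω) μ := by
  have hc1 : ∀ i, Continuous (pd i φ) := fun i => (contDiff_pd i hφ).continuous
  have hc2 : ∀ i, Continuous (pd i u) := fun i => (contDiff_pd i hu).continuous
  obtain ⟨D₁, hD₁⟩ := exists_flux_bound hΩ hcf hc1
  obtain ⟨D₂, hD₂⟩ := exists_flux_bound hΩ hcf hc2
  obtain ⟨D₃, hD₃⟩ := hcf.exists_bound_of_continuousOn hw.continuousOn
  have hm1 := measurable_flux hΩ hc1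
  have hm2 := measurable_flux hΩ hc2
  refine integrableOn_frontier_of_bound hfin (((hm1.const_mul c).max measurable_const).mul
    ((hw.measurable.mul hm2).pow_const 2)) (D := |c| * D₁ * (D₃ * D₂) ^ 2) fun x hx => ?_
  have h3 : |w x| ≤ D₃ := hD₃ x hx
  rw [abs_mul, abs_pow, abs_mul]
  have h4 : |max (c * flux Ω (fun i => pd i φ) x) 0| ≤ |c| * D₁ := by
    have h5 : |c * flux Ω (fun i => pd i φ) x| ≤ |c| * D₁ := by
      rw [abs_mul]; exact mul_le_mul_of_nonneg_left (hD₁ x) (abs_nonneg c)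
    rw [abs_of_nonneg (le_max_right _ _)]
    exact max_le ((le_abs_self _).trans h5) ((abs_nonneg _).trans h5)
  have h6 : |w x| * |flux Ω (fun i => pd i u) x| ≤ D₃ * D₂ :=
    mul_le_mul h3 (hD₂ x) (abs_nonneg _) ((abs_nonneg _).trans h3)
  have h7 : 0 ≤ |w x| * |flux Ω (fun i => pd i u) x| := by positivity
  exact mul_le_mul h4 (pow_le_pow_left₀ h7 h6 2) (by positivity) ((abs_nonneg _).trans h4)

end RealEstimate

end

end CarlemanEstimate

namespace CarlemanEstimate

noncomputable section

/-! ### The estimate for real functions. -/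

section RealCarleman

variable {d : ℕ} {Ω : Set (Eu (d + 1))} {φ m : Eu (d + 1) → ℝ}

set_option maxHeartbeats 800000 in
/-- The Carleman estimate for real functions vanishing on the boundary. -/
theorem exists_real_carleman (hΩo : IsOpen Ω) (hΩc : IsCompact (closure Ω))
    (hΩ : HasSmoothBoundary Ω) (hφ : ContDiff ℝ ∞ φ) (hm : ContDiff ℝ ∞ m)
    (hyp : ∀ x ∈ closure Ω, 0 < gdot φ φ x ∧ hess φ φ φ x = m x * gdot φ φ x ∧
      ∀ v : Eu (d + 1) → ℝ, gdot φ φ x * (hess φ v v x + m x * gdot v v x)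
        = gdot φ v x * gdot (gdot φ φ) v x) :
    (μHE[d] : Measure (Eu (d + 1))) (frontier Ω) < ⊤ ∧ ∃ A h₀ : ℝ, 1 ≤ A ∧ 0 < h₀ ∧
      ∀ h, 0 < h → h < h₀ → ∀ u : Eu (d + 1) → ℝ, ContDiff ℝ ∞ u → (∀ x ∈ frontier Ω, u x = 0) →
        h ^ 3 * ∫ x in frontier Ω, max (-1 * flux Ω (fun i => pd i φ) x) 0
            * (Real.exp (φ x / h) * flux Ω (fun i => pd i u) x) ^ 2 ∂(μHE[d])
          + h ^ 2 * ∫ x in Ω, Real.exp (φ x / h) ^ 2 * (u x ^ 2 + h ^ 2 * gdot u u x)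
        ≤ A * ((∫ x in Ω, (Real.exp (φ x / h) * (h ^ 2 * lapl u x)) ^ 2)
          + h ^ 3 * ∫ x in frontier Ω, max (1 * flux Ω (fun i => pd i φ) x) 0
            * (Real.exp (φ x / h) * flux Ω (fun i => pd i u) x) ^ 2 ∂(μHE[d])) := by
  have hcf : IsCompact (frontier Ω) :=
    hΩc.of_isClosed_subset isClosed_frontier frontier_subset_closure
  obtain ⟨hfin, D, hD, hdiv⟩ := exists_divergenceBound hΩo hΩc hΩ
  obtain ⟨c, C, δ, κ₀, hc, hC, hκ₀, hpt⟩ := exists_pointwise_carleman hΩc hφ hm hyp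
  obtain ⟨G', hG'⟩ := hΩc.exists_bound_of_continuousOn (contDiff_gdot hφ hφ).continuous.continuousOn
  obtain ⟨B, hB⟩ := hΩc.exists_bound_of_continuousOn hφ.continuous.continuousOn
  set G := max G' 0 with hGdef
  have hG0 : 0 ≤ G := le_max_right _ _
  have hG : ∀ x ∈ closure Ω, gdot φ φ x ≤ G := fun x hx =>
    (le_abs_self _).trans ((hG' x hx).trans (le_max_left _ _))
  -- With `κ = h/ε` the pointwise gain `c h κ - C h²` is exactly `h²`.
  set ε := c / (C + 1) with hε
  have hε0 : 0 < ε := by positivity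
  set M := Real.exp (B ^ 2 / ε) with hM
  have hM1 : 1 ≤ M := Real.one_le_exp (by positivity)
  have hMx : ∀ x ∈ closure Ω, Real.exp (φ x ^ 2 / ε) ≤ M := fun x hx => by
    refine Real.exp_le_exp.2 (div_le_div_of_nonneg_right ?_ hε0.le)
    exact sq_le_sq' (abs_le.1 (hB x hx)).1 (abs_le.1 (hB x hx)).2
  -- From `|∇ψ|² ≤ 9/4 G`, passing from `v` to `u` costs `1 + 9/2 G` on `v²` and `2` on `|h∇v|²`;
  -- `Q` dominates both.
  set Q := 2 + 5 * G with hQ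
  have hQ1 : 1 ≤ Q := by rw [hQ]; linarith
  refine ⟨hfin, 3 * (D * Q) * (D * M), κ₀ * ε, ?_, by positivity, fun h hh hh0 u hu hu0 => ?_⟩
  · have h1 := one_le_mul_of_one_le_of_one_le hD hQ1
    have h2 := one_le_mul_of_one_le_of_one_le hD hM1
    rw [mul_assoc]
    exact one_le_mul_of_one_le_of_one_le (by norm_num) (one_le_mul_of_one_le_of_one_le h1 h2)
  have hκ : 0 < h / ε := by positivity
  have hκ' : h / ε ≤ κ₀ := by rw [div_le_iff₀ hε0]; exact hh0.le
  obtain ⟨hf, hpt⟩ := hpt (h / ε) hκ hκ'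
  set κ := h / ε with hκdef
  have hcoef : c * h * κ - C * h ^ 2 = h ^ 2 := by
    rw [hκdef, hε]; field_simp; ring
  have hψ := contDiff_convexify κ hφ
  set ψ := convexify κ φ with hψdef
  set v : Eu (d + 1) → ℝ := fun y => Real.exp (ψ y / h) * u y with hv
  have hvd : ContDiff ℝ ∞ v := contDiff_exp_mul hψ hu h
  set F := carlemanField ψ (fun y => (1 + κ * φ y) * m y) h (δ * h * κ) v with hF
  have hmd : ContDiff ℝ ∞ fun y => (1 + κ * φ y) * m y :=
    (contDiff_const.add (contDiff_const.mul hφ)).mul hm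
  have hFd : ∀ i, ContDiff ℝ ∞ (F i) := contDiff_carlemanField hψ hmd hvd h _
  have hE : ∀ x, Real.exp (ψ x / h) ^ 2 = Real.exp (φ x ^ 2 / ε) * Real.exp (φ x / h) ^ 2 :=
    exp_convexify_sq φ hh.ne' hε0.ne'
  have hE1 : ∀ x, Real.exp (φ x / h) ^ 2 ≤ Real.exp (ψ x / h) ^ 2 := fun x => by
    rw [hE]
    exact le_mul_of_one_le_left (sq_nonneg _) (Real.one_le_exp (by positivity))
  have hE2 : ∀ x ∈ closure Ω, Real.exp (ψ x / h) ^ 2 ≤ M * Real.exp (φ x / h) ^ 2 := fun x hx => by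
    rw [hE]
    exact mul_le_mul_of_nonneg_right (hMx x hx) (sq_nonneg _)
  set s := flux Ω fun i => pd i φ with hs
  set nd := flux Ω fun i => pd i u with hnd
  have hexpc : Continuous fun x => Real.exp (φ x / h) :=
    Real.continuous_exp.comp (hφ.continuous.div_const h)
  have hgv := (contDiff_gdot hvd hvd).continuous
  have hgu := (contDiff_gdot hu hu).continuous
  have hlu := (contDiff_lapl hu).continuous
  have hvc := hvd.continuous
  have huc := hu.continuous
  have hIm := integrableOn_frontier_weighted_flux hfin hΩ hcf hφ hu hexpc (-1)
  have hIp := integrableOn_frontier_weighted_flux hfin hΩ hcf hφ hu hexpc 1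
  set Im := ∫ x in frontier Ω, max (-1 * s x) 0 * (Real.exp (φ x / h) * nd x) ^ 2 ∂(μHE[d]) with hImd
  set Ip := ∫ x in frontier Ω, max (1 * s x) 0 * (Real.exp (φ x / h) * nd x) ^ 2 ∂(μHE[d]) with hIpd
  set Iv := ∫ x in Ω, Real.exp (φ x / h) ^ 2 * (u x ^ 2 + h ^ 2 * gdot u u x) with hIvd
  set Il := ∫ x in Ω, (Real.exp (φ x / h) * (h ^ 2 * lapl u x)) ^ 2 with hIld
  set Iw := ∫ x in Ω, (v x ^ 2 + h ^ 2 * gdot v v x) with hIwd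
  have hIm0 : 0 ≤ Im := integral_nonneg fun x => mul_nonneg (le_max_right _ _) (sq_nonneg _)
  have hIp0 : 0 ≤ Ip := integral_nonneg fun x => mul_nonneg (le_max_right _ _) (sq_nonneg _)
  have hIv0 : 0 ≤ Iv := integral_nonneg fun x =>
    mul_nonneg (sq_nonneg _) (add_nonneg (sq_nonneg _) (mul_nonneg (sq_nonneg _)
      (gdot_self_nonneg _ _)))
  have hIl0 : 0 ≤ Il := integral_nonneg fun x => sq_nonneg _
  have hdivc : Continuous (divg F) := (contDiff_divg hFd).continuous
  have hvint : IntegrableOn (fun x => v x ^ 2 + h ^ 2 * gdot v v x) Ω :=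
    integrableOn_of_continuous hΩc (by fun_prop)
  -- the integrated pointwise estimate
  have hmain : (∫ x in Ω, divg F x) + h ^ 2 * Iw ≤ M * Il := by
    rw [hIwd, hIld, ← integral_const_mul, ← integral_const_mul, ← integral_add
      (integrableOn_of_continuous hΩc hdivc) (hvint.const_mul _)]
    refine setIntegral_mono_on ((integrableOn_of_continuous hΩc hdivc).add (hvint.const_mul _))
      (integrableOn_of_continuous hΩc (by fun_prop)) hΩo.measurableSet fun x hx => ?_
    have h1 := hpt h hh v hvd x (subset_closure hx)
    have h2 : conjOp ψ h v x ^ 2 = Real.exp (ψ x / h) ^ 2 * (h ^ 2 * lapl u x) ^ 2 := by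
      rw [conjOp_exp_mul hψ hu hh.ne']; ring
    rw [hcoef, h2] at h1
    refine (h1.trans (mul_le_mul_of_nonneg_right (hE2 x (subset_closure hx))
      (sq_nonneg (h ^ 2 * lapl u x)))).trans_eq ?_
    ring
  have hIvw : Iv ≤ Q * Iw := by
    rw [hIvd, hIwd, ← integral_const_mul]
    refine setIntegral_mono_on (integrableOn_of_continuous hΩc (by fun_prop))
      (hvint.const_mul _) hΩo.measurableSet fun x hx => ?_
    have hx := subset_closure hx
    have h1 := sq_gradient_le_exp_mul hψ hu hh.ne' x
    have h2 : gdot ψ ψ x ≤ 9 / 4 * G := by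
      rw [hψdef, gdot_convexify_self κ hφ]
      have h3 : (1 + κ * φ x) ^ 2 ≤ 9 / 4 := by nlinarith [hf x hx]
      exact mul_le_mul h3 (hG x hx) (gdot_self_nonneg _ _) (by norm_num)
    have h4 : Real.exp (φ x / h) ^ 2 * (u x ^ 2 + h ^ 2 * gdot u u x)
        ≤ v x ^ 2 + Real.exp (ψ x / h) ^ 2 * (h ^ 2 * gdot u u x) := by
      rw [hv]
      have := mul_le_mul_of_nonneg_right (hE1 x) (add_nonneg (sq_nonneg (u x))
        (mul_nonneg (sq_nonneg h) (gdot_self_nonneg u x)))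
      linarith
    have h5 : gdot ψ ψ x * (Real.exp (ψ x / h) * u x) ^ 2 ≤ 9 / 4 * G * v x ^ 2 :=
      mul_le_mul_of_nonneg_right h2 (sq_nonneg _)
    have h6 : 0 ≤ h ^ 2 * gdot v v x := mul_nonneg (sq_nonneg _) (gdot_self_nonneg _ _)
    have h7 : 0 ≤ v x ^ 2 := sq_nonneg _
    have h8 := mul_nonneg hG0 h6
    have h9 := mul_nonneg hG0 h7
    change Real.exp (φ x / h) ^ 2 * (u x ^ 2 + h ^ 2 * gdot u u x) ≤ Q * (v x ^ 2 + h ^ 2 * gdot v v x)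
    rw [hQ]
    linarith
  -- the boundary terms
  have hb := hdiv (fun i y => -F i y) fun i => (hFd i).neg
  unfold DivergenceBound at hb
  simp_rw [divg_neg hFd, flux_neg, neg_neg, integral_neg] at hb
  -- A lower bound for `∫ div F` is wanted, so the divergence inequality is used for `-F`. By this
  -- formula `-F` flows out where `φ'·ν > 0` and in where `φ'·ν < 0`: the inflow gives the boundary
  -- term on the left of the estimate, the outflow the one on the right.
  have hflux : ∀ x ∈ frontier Ω, flux Ω F x
      = -(2 * h ^ 3 * (1 + κ * φ x) * s x * (Real.exp (ψ x / h) * nd x) ^ 2) := fun x hx =>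
    flux_carlemanField_exp_mul hΩ hφ hu hu0 _ κ h _ hx
  have hFc : ∀ i, Continuous (F i) := fun i => (hFd i).continuous
  obtain ⟨DF, hDF⟩ := exists_flux_bound hΩ hcf hFc
  have hmF := measurable_flux hΩ hFc
  have hfcl : ∀ x ∈ frontier Ω, x ∈ closure Ω := fun x hx => frontier_subset_closure hx
  have hout : ∫ x in frontier Ω, max (-flux Ω F x) 0 ∂(μHE[d]) ≤ 3 * h ^ 3 * M * Ip := by
    rw [hIpd, ← integral_const_mul]
    refine setIntegral_mono_on (integrableOn_frontier_of_bound hfin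
      (hmF.neg.max measurable_const) (D := DF) fun x _ => ?_) (hIp.const_mul _)
      isClosed_frontier.measurableSet fun x hx => ?_
    · rw [abs_of_nonneg (le_max_right _ _)]
      exact max_le ((neg_le_abs _).trans (hDF x)) ((abs_nonneg _).trans (hDF x))
    · have hf1 := hf x (hfcl x hx)
      have h1 := hE2 x (hfcl x hx)
      rw [hflux x hx, neg_neg, one_mul]
      refine max_le ?_ (mul_nonneg (by positivity) (mul_nonneg (le_max_right _ _) (sq_nonneg _)))
      have h2 : 0 ≤ max (s x) 0 := le_max_right _ _
      have h3 : (Real.exp (ψ x / h) * nd x) ^ 2 ≤ M * (Real.exp (φ x / h) * nd x) ^ 2 := by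
        rw [mul_pow, mul_pow, ← mul_assoc]
        exact mul_le_mul_of_nonneg_right h1 (sq_nonneg _)
      calc 2 * h ^ 3 * (1 + κ * φ x) * s x * (Real.exp (ψ x / h) * nd x) ^ 2
          ≤ 2 * h ^ 3 * (1 + κ * φ x) * max (s x) 0 * (Real.exp (ψ x / h) * nd x) ^ 2 := by
            refine mul_le_mul_of_nonneg_right (mul_le_mul_of_nonneg_left (le_max_left _ _) ?_)
              (sq_nonneg _)
            have : 0 ≤ 1 + κ * φ x := by linarith [hf1.1]
            positivity
        _ ≤ 2 * h ^ 3 * (3 / 2) * max (s x) 0 * (M * (Real.exp (φ x / h) * nd x) ^ 2) := by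
            have := hf1.2
            gcongr
        _ = _ := by ring
  have hin : h ^ 3 * Im ≤ ∫ x in frontier Ω, max (flux Ω F x) 0 ∂(μHE[d]) := by
    rw [hImd, ← integral_const_mul]
    refine setIntegral_mono_on (hIm.const_mul _) (integrableOn_frontier_of_bound hfin
      (hmF.max measurable_const) (D := DF) fun x _ => ?_)
      isClosed_frontier.measurableSet fun x hx => ?_
    · rw [abs_of_nonneg (le_max_right _ _)]
      exact max_le ((le_abs_self _).trans (hDF x)) ((abs_nonneg _).trans (hDF x))
    · have hf1 := hf x (hfcl x hx)
      rw [hflux x hx]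
      rcases le_total (-1 * s x) 0 with h0 | h0
      · rw [max_eq_right h0, zero_mul, mul_zero]; exact le_max_right _ _
      · rw [max_eq_left h0]
        refine le_trans ?_ (le_max_left _ _)
        have h3 : (Real.exp (φ x / h) * nd x) ^ 2 ≤ (Real.exp (ψ x / h) * nd x) ^ 2 := by
          rw [mul_pow, mul_pow]
          exact mul_le_mul_of_nonneg_right (hE1 x) (sq_nonneg _)
        calc h ^ 3 * (-1 * s x * (Real.exp (φ x / h) * nd x) ^ 2)
            = 2 * h ^ 3 * (1 / 2) * (-1 * s x) * (Real.exp (φ x / h) * nd x) ^ 2 := by ring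
          _ ≤ 2 * h ^ 3 * (1 + κ * φ x) * (-1 * s x) * (Real.exp (ψ x / h) * nd x) ^ 2 := by
              have := hf1.1
              gcongr
          _ = _ := by ring
  have hD0 : 0 < D := lt_of_lt_of_le one_pos hD
  have hQ0 : 0 < Q := lt_of_lt_of_le one_pos hQ1
  have hM0 : 0 < M := lt_of_lt_of_le one_pos hM1
  have hb' : D⁻¹ * (h ^ 3 * Im) + h ^ 2 * Iw ≤ M * Il + D * (3 * h ^ 3 * M * Ip) := by
    have h1 := mul_le_mul_of_nonneg_left hin (inv_nonneg.2 hD0.le)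
    have h2 := mul_le_mul_of_nonneg_left hout hD0.le
    linarith
  have h3 : 0 ≤ h ^ 3 * Im := by positivity
  have h4 : 0 ≤ h ^ 3 * Ip := by positivity
  have h5 : 0 ≤ h ^ 2 * Iv := by positivity
  calc h ^ 3 * Im + h ^ 2 * Iv ≤ Q * (h ^ 3 * Im) + D * (h ^ 2 * Iv) :=
        add_le_add (le_mul_of_one_le_left h3 hQ1) (le_mul_of_one_le_left h5 hD)
    _ ≤ Q * (h ^ 3 * Im) + D * (h ^ 2 * (Q * Iw)) := by gcongr
    _ = D * Q * (D⁻¹ * (h ^ 3 * Im) + h ^ 2 * Iw) := by field_simp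
    _ ≤ D * Q * (M * Il + D * (3 * h ^ 3 * M * Ip)) := by gcongr
    _ ≤ D * Q * (3 * (D * M) * Il + D * (3 * h ^ 3 * M * Ip)) := by
        have h6 : M ≤ 3 * (D * M) :=
          (le_mul_of_one_le_left hM0.le hD).trans
            (le_mul_of_one_le_left (mul_pos hD0 hM0).le (by norm_num))
        gcongr
    _ = _ := by ring

end RealCarleman

end

end CarlemanEstimate

namespace CarlemanEstimate

noncomputable section

/-! ### Reduction of complex functions to real and imaginary parts. -/

section ComplexValued

variable {n : ℕ} {u : Eu n → ℂ}

theorem contDiff_re (hu : ContDiff ℝ ∞ u) : ContDiff ℝ ∞ fun x => (u x).re :=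
  Complex.reCLM.contDiff.comp hu

theorem contDiff_im (hu : ContDiff ℝ ∞ u) : ContDiff ℝ ∞ fun x => (u x).im :=
  Complex.imCLM.contDiff.comp hu

theorem complex_norm_sq (z : ℂ) : ‖z‖ ^ 2 = z.re ^ 2 + z.im ^ 2 := by
  rw [Complex.sq_norm, Complex.normSq_apply]; ring

theorem fderiv_re (hu : ContDiff ℝ ∞ u) (x v : Eu n) :
    fderiv ℝ (fun x => (u x).re) x v = (fderiv ℝ u x v).re := by
  have h := Complex.reCLM.hasFDerivAt.comp x ((hu.differentiable (by simp)) x).hasFDerivAt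
  have h' : fderiv ℝ (fun x => (u x).re) x = Complex.reCLM.comp (fderiv ℝ u x) := h.fderiv
  rw [h']; rfl

theorem fderiv_im (hu : ContDiff ℝ ∞ u) (x v : Eu n) :
    fderiv ℝ (fun x => (u x).im) x v = (fderiv ℝ u x v).im := by
  have h := Complex.imCLM.hasFDerivAt.comp x ((hu.differentiable (by simp)) x).hasFDerivAt
  have h' : fderiv ℝ (fun x => (u x).im) x = Complex.imCLM.comp (fderiv ℝ u x) := h.fderiv
  rw [h']; rfl

theorem norm_sq_normalDeriv (hu : ContDiff ℝ ∞ u) (Ω : Set (Eu n)) (x : Eu n) :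
    ‖normalDeriv Ω u x‖ ^ 2 = flux Ω (fun i => pd i fun x => (u x).re) x ^ 2
      + flux Ω (fun i => pd i fun x => (u x).im) x ^ 2 := by
  rw [complex_norm_sq, flux_pd_eq_fderiv, flux_pd_eq_fderiv, fderiv_re hu, fderiv_im hu,
    normalDeriv]

theorem norm_sq_complexGradient (hu : ContDiff ℝ ∞ u) (x : Eu n) :
    ‖complexGradient u x‖ ^ 2 = gdot (fun x => (u x).re) (fun x => (u x).re) x
      + gdot (fun x => (u x).im) (fun x => (u x).im) x := by
  rw [EuclideanSpace.norm_sq_eq, gdot, gdot, ← Finset.sum_add_distrib]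
  refine Finset.sum_congr rfl fun i _ => ?_
  change ‖fderiv ℝ u x (EuclideanSpace.single i 1)‖ ^ 2 = _
  rw [complex_norm_sq, ← fderiv_re hu, ← fderiv_im hu, pow_two, pow_two]
  rfl

theorem laplacian_eq_lapl {f : Eu n → ℝ} (hf : ContDiff ℝ ∞ f) (x : Eu n) :
    Laplacian.laplacian f x = lapl f x := by
  rw [InnerProductSpace.laplacian_eq_iteratedFDeriv_orthonormalBasis f
    (EuclideanSpace.basisFun (Fin n) ℝ), lapl]
  refine Finset.sum_congr rfl fun i _ => ?_
  rw [iteratedFDeriv_two_apply]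
  have hd : DifferentiableAt ℝ (fderiv ℝ f) x :=
    (hf.fderiv_right (m := ∞) (by simp)).differentiable (by simp) x
  have h := hd.hasFDerivAt.clm_apply (hasFDerivAt_const (EuclideanSpace.single i (1 : ℝ)) x)
  have h' : pd i (pd i f) x
      = fderiv ℝ (fun y => fderiv ℝ f y (EuclideanSpace.single i 1)) x (EuclideanSpace.single i 1) :=
    rfl
  rw [h', h.fderiv]
  simp

theorem laplacian_eq_lapl_add (hu : ContDiff ℝ ∞ u) (x : Eu n) :
    Laplacian.laplacian u x
      = (lapl (fun x => (u x).re) x : ℂ) + (lapl (fun x => (u x).im) x : ℂ) * Complex.I := by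
  have h2 : ContDiffAt ℝ 2 u x := (contDiff_infty.1 hu 2).contDiffAt
  have h3 : Laplacian.laplacian (fun x => (u x).re) x = (Laplacian.laplacian u x).re :=
    h2.laplacian_CLM_comp_left (l := Complex.reCLM)
  have h4 : Laplacian.laplacian (fun x => (u x).im) x = (Laplacian.laplacian u x).im :=
    h2.laplacian_CLM_comp_left (l := Complex.imCLM)
  rw [← laplacian_eq_lapl (contDiff_re hu), ← laplacian_eq_lapl (contDiff_im hu), h3, h4,
    Complex.re_add_im]

theorem continuous_laplacian (hu : ContDiff ℝ ∞ u) : Continuous (Laplacian.laplacian u) := by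
  rw [funext (laplacian_eq_lapl_add hu)]
  have h1 := (contDiff_lapl (contDiff_re hu)).continuous
  have h2 := (contDiff_lapl (contDiff_im hu)).continuous
  fun_prop

theorem norm_sq_laplacian (hu : ContDiff ℝ ∞ u) (x : Eu n) :
    ‖Laplacian.laplacian u x‖ ^ 2
      = lapl (fun x => (u x).re) x ^ 2 + lapl (fun x => (u x).im) x ^ 2 := by
  rw [laplacian_eq_lapl_add hu, complex_norm_sq]
  simp

end ComplexValued

/-! ### Boundary forms as integrals over the whole boundary. -/

section BoundaryForm

variable {n : ℕ} {Ω : Set (Eu n)} {φ : Eu n → ℝ}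

/-- The positive part of the slope vanishes on the rest of `frontier Ω`, so the domain of
integration can be enlarged. This is the form in which outflow and inflow enter the divergence
inequality. -/
theorem boundaryForm_boundaryPlus (hs : Measurable (normalSlope Ω φ)) (f : Eu n → ℂ) :
    boundaryForm Ω φ (boundaryPlus Ω φ) f
      = ∫ x in frontier Ω, max (1 * normalSlope Ω φ x) 0 * ‖f x‖ ^ 2 ∂(μHE[n - 1]) := by
  have hm : MeasurableSet (boundaryPlus Ω φ) :=
    isClosed_frontier.measurableSet.inter (measurableSet_le measurable_const hs)
  rw [setIntegral_eq_of_subset_of_forall_sdiff_eq_zero isClosed_frontier.measurableSet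
    (fun x hx => hx.1 : boundaryPlus Ω φ ⊆ frontier Ω), boundaryForm]
  · refine setIntegral_congr_fun hm fun x hx => ?_
    have : 0 ≤ normalSlope Ω φ x := hx.2
    simp only [one_mul, max_eq_left this]
  · intro x hx
    have h : normalSlope Ω φ x ≤ 0 := le_of_lt (not_le.1 fun h => hx.2 ⟨hx.1, h⟩)
    rw [one_mul, max_eq_right h, zero_mul]

theorem boundaryForm_boundaryMinus (hs : Measurable (normalSlope Ω φ)) (f : Eu n → ℂ) :
    boundaryForm Ω φ (boundaryMinus Ω φ) f
      = -∫ x in frontier Ω, max (-1 * normalSlope Ω φ x) 0 * ‖f x‖ ^ 2 ∂(μHE[n - 1]) := by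
  have hm : MeasurableSet (boundaryMinus Ω φ) :=
    isClosed_frontier.measurableSet.inter (measurableSet_le hs measurable_const)
  rw [setIntegral_eq_of_subset_of_forall_sdiff_eq_zero isClosed_frontier.measurableSet
    (fun x hx => hx.1 : boundaryMinus Ω φ ⊆ frontier Ω), boundaryForm, ← integral_neg]
  · refine setIntegral_congr_fun hm fun x hx => ?_
    have : normalSlope Ω φ x ≤ 0 := hx.2
    simp only [neg_one_mul]
    rw [max_eq_left (neg_nonneg.2 this), neg_mul, neg_neg]
  · intro x hx
    have h : 0 ≤ normalSlope Ω φ x := le_of_lt (not_le.1 fun h => hx.2 ⟨hx.1, h⟩)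
    rw [neg_one_mul, max_eq_right (neg_nonpos.2 h), zero_mul]

/-- Away from the boundary both sides vanish because the normal has the default value `0`; hence the
equality holds everywhere and yields global measurability. -/
theorem normalSlope_eq_flux {ψ : Eu n → ℝ} (hψφ : ∀ x ∈ closure Ω, ψ =ᶠ[𝓝 x] φ) :
    normalSlope Ω φ = flux Ω fun i => pd i ψ := by
  funext x
  by_cases hx : x ∈ frontier Ω
  · rw [flux_pd_eq_fderiv, (hψφ x (frontier_subset_closure hx)).fderiv_eq, fderiv_apply_eq_sum,
      normalSlope, eu_inner_eq_sum]
    simp_rw [gradient_apply]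
  · rw [normalSlope, flux_pd_eq_fderiv, exteriorNormal_of_notMem hx, inner_zero_right, map_zero]

end BoundaryForm

/-! ### The complex estimate and the perturbation by a potential. -/

section ComplexCarleman

variable {d : ℕ} {Ω : Set (Eu (d + 1))} {φ m : Eu (d + 1) → ℝ}

/-- The Carleman estimate for the Laplacian on complex functions vanishing on the boundary. -/
theorem exists_complex_carleman (hΩo : IsOpen Ω) (hΩc : IsCompact (closure Ω))
    (hΩ : HasSmoothBoundary Ω) (hφ : ContDiff ℝ ∞ φ) (hm : ContDiff ℝ ∞ m)
    (hyp : ∀ x ∈ closure Ω, 0 < gdot φ φ x ∧ hess φ φ φ x = m x * gdot φ φ x ∧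
      ∀ v : Eu (d + 1) → ℝ, gdot φ φ x * (hess φ v v x + m x * gdot v v x)
        = gdot φ v x * gdot (gdot φ φ) v x) :
    ∃ A h₀ : ℝ, 1 ≤ A ∧ 0 < h₀ ∧
      ∀ h, 0 < h → h < h₀ → ∀ u : Eu (d + 1) → ℂ, ContDiff ℝ ∞ u → (∀ x ∈ frontier Ω, u x = 0) →
        h ^ 3 * ∫ x in frontier Ω, max (-1 * flux Ω (fun i => pd i φ) x) 0
            * ‖Real.exp (φ x / h) • normalDeriv Ω u x‖ ^ 2 ∂(μHE[d])
          + h ^ 2 * (normSqL2 Ω (fun x => Real.exp (φ x / h) • u x)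
            + normSqL2 Ω (fun x => Real.exp (φ x / h) • h • complexGradient u x))
        ≤ A * (normSqL2 Ω (fun x => Real.exp (φ x / h) • h ^ 2 • Laplacian.laplacian u x)
          + h ^ 3 * ∫ x in frontier Ω, max (1 * flux Ω (fun i => pd i φ) x) 0
            * ‖Real.exp (φ x / h) • normalDeriv Ω u x‖ ^ 2 ∂(μHE[d])) := by
  have hcf : IsCompact (frontier Ω) :=
    hΩc.of_isClosed_subset isClosed_frontier frontier_subset_closure
  obtain ⟨hfin, A, h₀, hA, hh₀, hest⟩ := exists_real_carleman hΩo hΩc hΩ hφ hm hyp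
  refine ⟨A, h₀, hA, hh₀, fun h hh hh0 u hu hu0 => ?_⟩
  have hr := contDiff_re hu
  have hi := contDiff_im hu
  have hexpc : Continuous fun x => Real.exp (φ x / h) :=
    Real.continuous_exp.comp (hφ.continuous.div_const h)
  have e1 := hest h hh hh0 _ hr fun x hx => by rw [hu0 x hx]; rfl
  have e2 := hest h hh hh0 _ hi fun x hx => by rw [hu0 x hx]; rfl
  have hbd : ∀ c : ℝ, ∫ x in frontier Ω, max (c * flux Ω (fun i => pd i φ) x) 0
        * ‖Real.exp (φ x / h) • normalDeriv Ω u x‖ ^ 2 ∂(μHE[d])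
      = (∫ x in frontier Ω, max (c * flux Ω (fun i => pd i φ) x) 0
          * (Real.exp (φ x / h) * flux Ω (fun i => pd i fun x => (u x).re) x) ^ 2 ∂(μHE[d]))
        + ∫ x in frontier Ω, max (c * flux Ω (fun i => pd i φ) x) 0
          * (Real.exp (φ x / h) * flux Ω (fun i => pd i fun x => (u x).im) x) ^ 2 ∂(μHE[d]) := by
    intro c
    rw [← integral_add (integrableOn_frontier_weighted_flux hfin hΩ hcf hφ hr hexpc c)
      (integrableOn_frontier_weighted_flux hfin hΩ hcf hφ hi hexpc c)]
    refine integral_congr_ae (Eventually.of_forall fun x => ?_)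
    simp only [norm_smul, mul_pow, norm_sq_normalDeriv hu, Real.norm_eq_abs, sq_abs]
    ring
  have hgr := (contDiff_gdot hr hr).continuous
  have hgi := (contDiff_gdot hi hi).continuous
  have hlr := (contDiff_lapl hr).continuous
  have hli := (contDiff_lapl hi).continuous
  have hrc := hr.continuous
  have hic := hi.continuous
  have hnu : ∀ x, ‖Real.exp (φ x / h) • u x‖ ^ 2
      = Real.exp (φ x / h) ^ 2 * ((u x).re ^ 2 + (u x).im ^ 2) := fun x => by
    rw [norm_smul, mul_pow, complex_norm_sq, Real.norm_eq_abs, sq_abs]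
  have hng : ∀ x, ‖Real.exp (φ x / h) • h • complexGradient u x‖ ^ 2
      = Real.exp (φ x / h) ^ 2 * (h ^ 2 * (gdot (fun x => (u x).re) (fun x => (u x).re) x
        + gdot (fun x => (u x).im) (fun x => (u x).im) x)) := fun x => by
    rw [norm_smul, norm_smul, mul_pow, mul_pow, norm_sq_complexGradient hu, Real.norm_eq_abs,
      Real.norm_eq_abs, sq_abs, sq_abs]
  have hnl : ∀ x, ‖Real.exp (φ x / h) • h ^ 2 • Laplacian.laplacian u x‖ ^ 2
      = Real.exp (φ x / h) ^ 2 * ((h ^ 2) ^ 2 * (lapl (fun x => (u x).re) x ^ 2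
        + lapl (fun x => (u x).im) x ^ 2)) := fun x => by
    rw [norm_smul, norm_smul, mul_pow, mul_pow, norm_sq_laplacian hu, Real.norm_eq_abs,
      Real.norm_eq_abs, sq_abs, sq_abs]
  have hv : normSqL2 Ω (fun x => Real.exp (φ x / h) • u x)
        + normSqL2 Ω (fun x => Real.exp (φ x / h) • h • complexGradient u x)
      = (∫ x in Ω, Real.exp (φ x / h) ^ 2 * ((u x).re ^ 2
          + h ^ 2 * gdot (fun x => (u x).re) (fun x => (u x).re) x))
        + ∫ x in Ω, Real.exp (φ x / h) ^ 2 * ((u x).im ^ 2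
          + h ^ 2 * gdot (fun x => (u x).im) (fun x => (u x).im) x) := by
    simp only [normSqL2, hnu, hng]
    rw [← integral_add (integrableOn_of_continuous hΩc (by fun_prop))
      (integrableOn_of_continuous hΩc (by fun_prop)),
      ← integral_add (integrableOn_of_continuous hΩc (by fun_prop))
      (integrableOn_of_continuous hΩc (by fun_prop))]
    refine integral_congr_ae (Eventually.of_forall fun x => ?_)
    ring
  have hl : normSqL2 Ω (fun x => Real.exp (φ x / h) • h ^ 2 • Laplacian.laplacian u x)
      = (∫ x in Ω, (Real.exp (φ x / h) * (h ^ 2 * lapl (fun x => (u x).re) x)) ^ 2)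
        + ∫ x in Ω, (Real.exp (φ x / h) * (h ^ 2 * lapl (fun x => (u x).im) x)) ^ 2 := by
    simp only [normSqL2, hnl]
    rw [← integral_add (integrableOn_of_continuous hΩc (by fun_prop))
      (integrableOn_of_continuous hΩc (by fun_prop))]
    refine integral_congr_ae (Eventually.of_forall fun x => ?_)
    ring
  rw [hbd, hbd, hv, hl]
  linarith

/-- A bounded potential may be added to the Laplacian at the expense of a lower order term. -/
theorem normSqL2_laplacian_le (hΩc : IsCompact (closure Ω)) (hφ : ContDiff ℝ ∞ φ)
    {q : Eu (d + 1) → ℂ} (hqm : AEStronglyMeasurable q (volume.restrict Ω)) {Bq : ℝ}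
    (hq : ∀ᵐ x ∂(volume.restrict Ω), ‖q x‖ ≤ Bq) {u : Eu (d + 1) → ℂ} (hu : ContDiff ℝ ∞ u)
    (h : ℝ) :
    normSqL2 Ω (fun x => Real.exp (φ x / h) • h ^ 2 • Laplacian.laplacian u x)
      ≤ 2 * normSqL2 Ω (fun x => Real.exp (φ x / h) • schrodingerOp q h u x)
        + 2 * (h ^ 2 * Bq) ^ 2 * normSqL2 Ω (fun x => Real.exp (φ x / h) • u x) := by
  have hexpc : Continuous fun x => Real.exp (φ x / h) :=
    Real.continuous_exp.comp (hφ.continuous.div_const h)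
  have hlc := continuous_laplacian hu
  have huc := hu.continuous
  have hi1 : IntegrableOn (fun x => ‖Real.exp (φ x / h) • h ^ 2 • Laplacian.laplacian u x‖ ^ 2) Ω :=
    integrableOn_of_continuous hΩc (by fun_prop)
  have hi2 : IntegrableOn (fun x => ‖Real.exp (φ x / h) • u x‖ ^ 2) Ω :=
    integrableOn_of_continuous hΩc (by fun_prop)
  have hpot : ∀ᵐ x ∂(volume.restrict Ω), ‖Real.exp (φ x / h) • ((h : ℂ) ^ 2 * q x * u x)‖
      ≤ h ^ 2 * Bq * ‖Real.exp (φ x / h) • u x‖ := by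
    filter_upwards [hq] with x hx
    rw [norm_smul, norm_smul, norm_mul, norm_mul, norm_pow, Complex.norm_real, Real.norm_eq_abs h,
      sq_abs]
    calc ‖Real.exp (φ x / h)‖ * (h ^ 2 * ‖q x‖ * ‖u x‖)
        ≤ ‖Real.exp (φ x / h)‖ * (h ^ 2 * Bq * ‖u x‖) := by gcongr
      _ = _ := by ring
  have hsplit : ∀ x, Real.exp (φ x / h) • schrodingerOp q h u x
      = -(Real.exp (φ x / h) • h ^ 2 • Laplacian.laplacian u x)
        + Real.exp (φ x / h) • ((h : ℂ) ^ 2 * q x * u x) := fun x => by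
    simp only [schrodingerOp, Complex.real_smul]
    push_cast
    ring
  -- Integrability has to be checked here: the integral of a nonintegrable function is `0` by
  -- convention, which would destroy an upper bound. The essential bound on `q` supplies a
  -- dominating function.
  have hi3 : IntegrableOn (fun x => ‖Real.exp (φ x / h) • schrodingerOp q h u x‖ ^ 2) Ω := by
    refine Integrable.mono' ((hi1.const_mul 2).add (hi2.const_mul (2 * (h ^ 2 * Bq) ^ 2))) ?_ ?_
    · have h1 : AEStronglyMeasurable (fun x => Real.exp (φ x / h) • schrodingerOp q h u x)
          (volume.restrict Ω) := by
        refine hexpc.aestronglyMeasurable.smul ?_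
        exact (hlc.aestronglyMeasurable.const_mul _).add
          ((hqm.const_mul _).mul huc.aestronglyMeasurable)
      exact h1.norm.pow 2
    · filter_upwards [hpot] with x hx
      rw [Real.norm_of_nonneg (sq_nonneg _), hsplit]
      have h1 := norm_add_le (-(Real.exp (φ x / h) • h ^ 2 • Laplacian.laplacian u x))
        (Real.exp (φ x / h) • ((h : ℂ) ^ 2 * q x * u x))
      rw [norm_neg] at h1
      have h2 := pow_le_pow_left₀ (norm_nonneg _) (h1.trans (add_le_add_right hx _)) 2
      refine h2.trans ?_
      have h3 := add_sq_le (a := ‖Real.exp (φ x / h) • h ^ 2 • Laplacian.laplacian u x‖)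
        (b := h ^ 2 * Bq * ‖Real.exp (φ x / h) • u x‖)
      refine h3.trans_eq ?_
      simp only [Pi.add_apply]
      ring
  simp only [normSqL2]
  rw [← integral_const_mul, ← integral_const_mul, ← integral_add (hi3.const_mul _)
    (hi2.const_mul _)]
  refine integral_mono_ae hi1 ((hi3.const_mul _).add (hi2.const_mul _)) ?_
  filter_upwards [hpot] with x hx
  have h1 : ‖Real.exp (φ x / h) • h ^ 2 • Laplacian.laplacian u x‖
      ≤ ‖Real.exp (φ x / h) • schrodingerOp q h u x‖ + h ^ 2 * Bq * ‖Real.exp (φ x / h) • u x‖ := by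
    have h2 : Real.exp (φ x / h) • h ^ 2 • Laplacian.laplacian u x
        = Real.exp (φ x / h) • ((h : ℂ) ^ 2 * q x * u x)
          - Real.exp (φ x / h) • schrodingerOp q h u x := by
      rw [hsplit]; abel
    rw [h2]
    have h3 := norm_sub_le (Real.exp (φ x / h) • ((h : ℂ) ^ 2 * q x * u x))
      (Real.exp (φ x / h) • schrodingerOp q h u x)
    linarith
  have h2 := pow_le_pow_left₀ (norm_nonneg _) h1 2
  refine h2.trans ((add_sq_le).trans_eq ?_)
  ring

end ComplexCarleman

theorem normSqL2_nonneg {n : ℕ} {F : Type*} [NormedAddCommGroup F] (Ω : Set (Eu n))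
    (f : Eu n → F) : 0 ≤ normSqL2 Ω f :=
  integral_nonneg fun _ => sq_nonneg _

theorem normSqL2_congr {n : ℕ} {F : Type*} [NormedAddCommGroup F] {Ω : Set (Eu n)}
    (hΩ : MeasurableSet Ω) {f g : Eu n → F} (h : ∀ x ∈ Ω, f x = g x) :
    normSqL2 Ω f = normSqL2 Ω g :=
  setIntegral_congr_fun hΩ fun x hx => by simp only [h x hx]

end

end CarlemanEstimate

/-! ### Absorption of the potential and the final constants. -/

/-- The functions in `C^∞` of the closure of `Ω` are the restrictions of functions in `C^∞(ℝⁿ)`. -/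
theorem proposition3p2 (n : ℕ) (hn : 2 ≤ n)
    (Ω' : Set (EuclideanSpace ℝ (Fin n))) (hΩ'open : IsOpen Ω')
    (φ : EuclideanSpace ℝ (Fin n) → ℝ) (hφ : IsLimitingCarlemanWeight Ω' φ)
    (Ω : Set (EuclideanSpace ℝ (Fin n))) (hΩopen : IsOpen Ω)
    (hΩcompact : IsCompact (closure Ω)) (hΩsub : closure Ω ⊆ Ω')
    (hΩsmooth : HasSmoothBoundary Ω)
    (q : EuclideanSpace ℝ (Fin n) → ℂ)
    (hq : MemLp q ⊤ (volume.restrict Ω)) :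
    ∃ C₀ : ℝ, 0 < C₀ ∧ ∃ h₀ : ℝ, 0 < h₀ ∧
      ∀ u : EuclideanSpace ℝ (Fin n) → ℂ, ContDiff ℝ ∞ u → (∀ x ∈ frontier Ω, u x = 0) →
        ∀ h : ℝ, 0 < h → h < h₀ →
          -(h ^ 3 / C₀) * boundaryForm Ω φ (boundaryMinus Ω φ)
                (fun x => Real.exp (φ x / h) • normalDeriv Ω u x)
              + h ^ 2 / C₀ *
                (normSqL2 Ω (fun x => Real.exp (φ x / h) • u x)
                  + normSqL2 Ω (fun x => Real.exp (φ x / h) • h • complexGradient u x))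
            ≤ normSqL2 Ω (fun x => Real.exp (φ x / h) • schrodingerOp q h u x)
              + C₀ * h ^ 3 * boundaryForm Ω φ (boundaryPlus Ω φ)
                (fun x => Real.exp (φ x / h) • normalDeriv Ω u x) := by
  obtain ⟨d, rfl⟩ : ∃ d, n = d + 1 := ⟨n - 1, by omega⟩
  obtain ⟨ψ, m, hψ, hm, hψφ, hyp⟩ := hφ.exists_extension hΩ'open hΩcompact hΩsub
  obtain ⟨A, h₁, hA, hh₁, hest⟩ :=
    exists_complex_carleman hΩopen hΩcompact hΩsmooth hψ hm hyp
  obtain ⟨Bq, hBq⟩ : ∃ Bq : ℝ, ∀ᵐ x ∂(volume.restrict Ω), ‖q x‖ ≤ Bq := by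
    refine ⟨(eLpNormEssSup q (volume.restrict Ω)).toReal, ?_⟩
    have hlt : eLpNormEssSup q (volume.restrict Ω) < ⊤ := by
      rw [← eLpNorm_exponent_top]; exact hq.2
    filter_upwards [ae_le_eLpNormEssSup (f := q) (μ := volume.restrict Ω)] with x hx
    rw [← toReal_enorm]
    exact ENNReal.toReal_mono hlt.ne hx
  have hA0 : 0 < A := lt_of_lt_of_le one_pos hA
  have hslope := normalSlope_eq_flux hψφ
  have hsm : Measurable (normalSlope Ω φ) := by
    rw [hslope]
    exact measurable_flux hΩsmooth fun i => (contDiff_pd i hψ).continuous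
  -- The second bound on `h`, together with `1 ≤ A`, makes the contribution of `q` at most half of
  -- `h²N₀`. Moving it to the left and doubling gives `4 * A` in front of the operator term.
  refine ⟨4 * A, by positivity, min h₁ (1 / (2 * A * (Bq ^ 2 + 1))), by positivity,
    fun u hu hu0 h hh hh0 => ?_⟩
  have hsmall : 4 * A * (h ^ 2 * Bq ^ 2) ≤ 1 := by
    have h1 : h < 1 / (2 * A * (Bq ^ 2 + 1)) := hh0.trans_le (min_le_right _ _)
    rw [lt_div_iff₀ (by positivity)] at h1
    have h2 : (h * (2 * A * (Bq ^ 2 + 1))) ^ 2 ≤ 1 := pow_le_one₀ (by positivity) h1.le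
    refine le_trans ?_ h2
    have h3 : A ≤ A ^ 2 := le_self_pow₀ hA two_ne_zero
    have h4 : Bq ^ 2 ≤ (Bq ^ 2 + 1) ^ 2 := by nlinarith [sq_nonneg Bq]
    calc 4 * A * (h ^ 2 * Bq ^ 2) ≤ 4 * A ^ 2 * (h ^ 2 * (Bq ^ 2 + 1) ^ 2) := by gcongr
      _ = _ := by ring
  have heq : ∀ x ∈ closure Ω, Real.exp (φ x / h) = Real.exp (ψ x / h) := fun x hx => by
    rw [(hψφ x hx).eq_of_nhds]
  have hΩm := hΩopen.measurableSet
  have hmain := hest h hh (hh0.trans_le (min_le_left _ _)) u hu hu0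
  have hpot := normSqL2_laplacian_le hΩcompact hψ hq.1 hBq hu h
  have hbd : ∀ c : ℝ, ∫ x in frontier Ω, max (c * normalSlope Ω φ x) 0
        * ‖Real.exp (φ x / h) • normalDeriv Ω u x‖ ^ 2 ∂(μHE[d])
      = ∫ x in frontier Ω, max (c * flux Ω (fun i => pd i ψ) x) 0
        * ‖Real.exp (ψ x / h) • normalDeriv Ω u x‖ ^ 2 ∂(μHE[d]) := fun c =>
    setIntegral_congr_fun isClosed_frontier.measurableSet fun x hx => by
      simp only [hslope, heq x (frontier_subset_closure hx)]
  rw [boundaryForm_boundaryPlus hsm, boundaryForm_boundaryMinus hsm, Nat.add_sub_cancel, hbd, hbd,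
    normSqL2_congr hΩm (f := fun x => Real.exp (φ x / h) • u x)
      fun x hx => by rw [heq x (subset_closure hx)],
    normSqL2_congr hΩm (f := fun x => Real.exp (φ x / h) • h • complexGradient u x)
      fun x hx => by rw [heq x (subset_closure hx)],
    normSqL2_congr hΩm (f := fun x => Real.exp (φ x / h) • schrodingerOp q h u x)
      fun x hx => by rw [heq x (subset_closure hx)]]
  set Im := ∫ x in frontier Ω, max (-1 * flux Ω (fun i => pd i ψ) x) 0
    * ‖Real.exp (ψ x / h) • normalDeriv Ω u x‖ ^ 2 ∂(μHE[d]) with hIm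
  set Ip := ∫ x in frontier Ω, max (1 * flux Ω (fun i => pd i ψ) x) 0
    * ‖Real.exp (ψ x / h) • normalDeriv Ω u x‖ ^ 2 ∂(μHE[d]) with hIp
  have hIm0 : 0 ≤ Im := integral_nonneg fun x => mul_nonneg (le_max_right _ _) (sq_nonneg _)
  have hIp0 : 0 ≤ Ip := integral_nonneg fun x => mul_nonneg (le_max_right _ _) (sq_nonneg _)
  set N₀ := normSqL2 Ω fun x => Real.exp (ψ x / h) • u x with hN₀
  set N₁ := normSqL2 Ω fun x => Real.exp (ψ x / h) • h • complexGradient u x with hN₁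
  set S := normSqL2 Ω fun x => Real.exp (ψ x / h) • schrodingerOp q h u x with hS
  have hN₀0 : 0 ≤ N₀ := normSqL2_nonneg _ _
  have hN₁0 : 0 ≤ N₁ := normSqL2_nonneg _ _
  have habs : A * (2 * (h ^ 2 * Bq) ^ 2 * N₀) ≤ h ^ 2 * N₀ / 2 := by
    have h1 := mul_le_mul_of_nonneg_right hsmall (mul_nonneg (sq_nonneg h) hN₀0)
    linarith
  have h1 := mul_le_mul_of_nonneg_left hpot hA0.le
  have h2 : 0 ≤ h ^ 3 * Im := by positivity
  have h3 : 0 ≤ h ^ 3 * Ip := by positivity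
  have h4 : 0 ≤ h ^ 2 * N₁ := by positivity
  have h5 : h ^ 3 * Im + h ^ 2 * (N₀ + N₁) ≤ 4 * A * S + 2 * A * (h ^ 3 * Ip) := by linarith
  have h6 : 2 * A * (h ^ 3 * Ip) ≤ 4 * A * (4 * A * h ^ 3 * Ip) := by
    have h7 : 1 * (A * (h ^ 3 * Ip)) ≤ A * (A * (h ^ 3 * Ip)) :=
      mul_le_mul_of_nonneg_right hA (mul_nonneg hA0.le h3)
    have h8 := mul_nonneg hA0.le h3
    linarith
  rw [show -(h ^ 3 / (4 * A)) * -Im + h ^ 2 / (4 * A) * (N₀ + N₁)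
    = (h ^ 3 * Im + h ^ 2 * (N₀ + N₁)) / (4 * A) by ring, div_le_iff₀ (by positivity)]
  linarith
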